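/- **Approximation Lemma.** *Setting.* A poc set is a poset $P$ with minimum $0$ and an order-reversing involution $a\mapsto a^*$ such that $a\le a^*$ implies $a=0$; elements other than $0,0^*$ are proper, and a pair $\{a,a^*\}$ of proper elements is a wall. $P$ is discrete if $[a,b]$ is finite for all proper $a,b$. An ultrafilter is a set $U\subset P$ containing exactly one of $a,a^*$ for each $a\in P$ and with no $a,b\in U$ such that $a\le b^*$. A cube of the dual complex $C(P)$ is a finite-dimensional face of the cube of all complete $*$-selections all of whose vertices are ultrafilters. For an ultrafilter $B$, $C(P)_B$ is the connected component of $C(P)$ containing $B$, realized in $[0,1]^B$ so that a vertex $U$ is the indicator function of $B\smallsetminus U$. A weight is a function $w:P\to[0,\infty)$ with $w(0)=0$, $w(a^*)=w(a)$; the weighted dual $X=C^w(P)_B$ is the image of $C(P)_B$ under $x\mapsto wx$, with base point $b$ the image of $B$ (the origin). It carries the metric $d_1$ induced from $\ell^1(B)$ and the metric $d_\infty$, the infimum of the $\ell^\infty$-lengths of broken paths (finite sequences whose consecutive points lie in a common cube). For $n\ge1$ put $u_n(a)=\lfloor n\,w(a)\rfloor$ and let $P_n$ be the refinement of $P$ in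 which each proper $a$ is replaced by a chain $(a,0)<(a,1)<\dots<(a,u_n(a)-1)$ (so $a$ is deleted if $u_n(a)=0$), with $(a,i)^*=(a^*,u_n(a)-1-i)$ and, for $a\neq a'$, $(a,i)<(a',j)$ iff $a<a'$. Let $B_n\subset P_n$ be the preimage of $B$ under $(a,i)\mapsto a$, $0\mapsto 0$, $0^*\mapsto0^*$, and let $X_n$ be the weighted dual of $P_n$ with basepoint $B_n$ and all proper weights $1/n$; its base point is $b_n$. Say that $z\in X_n$ *corresponds* to $x\in X$ if $\sum_{i}z(a,i)=\frac{u_n(a)}{n\,w(a)}\,x(a)$ for all proper $a\in B$ with $w(a)>0$. For $d_p$ on $X$ and on all $X_n$, say that $z_n\in X_n$ converges to $x\in X$ if there are $x'_n\in X_n$ corresponding to $x$, for all large $n$, with $d_p(z_n,x_n')\to0$. *Statement.* Let $P$ be a discrete poc set with weight $w$ and ultrafilter $B$ such that $C(P)_B$ is locally finite (each vertex lies in finitely many cubes), and let $p\in\{1,\infty\}$. 1. Assume that $(X,d_p)$ is proper and that every wall of positive weight crosses $C(P)_B$ (that is, for every proper $a$ with $w(a)>0$ some vertex $U$ of $C(P)_B$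 has $a\in U\Leftrightarrow a\notin B$). Then $(X_n,d_p,b_n)$ converges to $(X,d_p,b)$ in the pointed Gromov–Hausdorff sense: for every $R>0$ the closed $R$-balls about $b_n$ converge to the closed $R$-ball about $b$ in the Gromov–Hausdorff sense. Moreover, for all $R,\varepsilon>0$ and all large $n$ the correspondence above, restricted to these balls, is an $\varepsilon$-approximation (both projections are $\varepsilon$-dense, and distances of related pairs differ by less than $\varepsilon$). 2. Let $x,y\in X$, and let $x_n,y_n$ be vertices of $X_n$ with $x_n\to x$ and $y_n\to y$ with respect to $d_p$. Then for each $n$ there is a normal cube path $(U_0,\dots,U_m)$ from $x_n$ to $y_n$, that is, a sequence of vertices with $U_i\neq U_m$ and $U_i\smallsetminus U_{i+1}=\min(U_i\smallsetminus U_m)$ for $i<m$. There is a $d_\infty$-geodesic $\gamma:[0,L]\to X$, $L=d_\infty(x,y)$, from $x$ to $y$, with $d_1(\gamma(r),\gamma(t))=d_1(\gamma(r),\gamma(s))+d_1(\gamma(s),\gamma(t))$ for $0\le r\le s\le t\le L$ (so its image is also a $d_1$-geodesic arc), to which the normal cube paths $\mathbf p_n=(x_n=\mathbf p_n(0),\dots,\mathbf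 p_n(m_n)=y_n)$ converge: $m_n/n\to L$, and, extending $\gamma$ by $\gamma(t)=y$ for $t\ge L$, for every $\varepsilon>0$ and all large $n$, for each $k\le m_n$ the vertex $\mathbf p_n(k)$ is within $d_p$-distance $\varepsilon$ of a point of $X_n$ corresponding to $\gamma(k/n)$. -/

import Mathlib

open Set Filter Topology

/-! ### Poc sets -/

/-- A poc set: a partial order with a minimum `⊥` and an order-reversing involution `a ↦ aᶜ`
such that `a ≤ aᶜ` only for `a = ⊥`. -/
class PocSet (P : Type*) extends PartialOrder P, OrderBot P, Compl P where
  compl_invol : ∀ a : P, aᶜᶜ = a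
  compl_anti : ∀ a b : P, a ≤ b → bᶜ ≤ aᶜ
  eq_bot_of_le : ∀ a : P, a ≤ aᶜ → a = ⊥

namespace PocSet

section Basic

variable {P : Type*} [PocSet P]

/-- Proper elements: all except `⊥` and `⊥ᶜ`. -/
def IsProper (a : P) : Prop := a ≠ ⊥ ∧ a ≠ ⊥ᶜ

variable (P) in
/-- A poc set is discrete if the order intervals between proper elements are finite. -/
def IsDiscrete : Prop := ∀ a b : P, IsProper a → IsProper b → (Set.Icc a b).Finite

/-- Complete `ᶜ`-selections: exactly one of `a`, `aᶜ` is chosen, for every `a`. -/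
def IsSelection (U : Set P) : Prop := ∀ a : P, Xor (a ∈ U) (aᶜ ∈ U)

/-- Ultrafilters on a poc set: coherent complete selections. -/
def IsUltra (U : Set P) : Prop := IsSelection U ∧ ∀ a ∈ U, ∀ b ∈ U, ¬ a ≤ bᶜ

theorem compl_eq_bot {a : P} : aᶜ = ⊥ ↔ a = ⊥ᶜ :=
  ⟨fun h => by rw [← h, compl_invol], fun h => by rw [h, compl_invol]⟩

theorem compl_eq_compl {a b : P} (h : aᶜ = bᶜ) : a = b := by
  rw [← compl_invol a, h, compl_invol]

theorem IsProper.compl {a : P} (h : IsProper a) : IsProper aᶜ :=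
  ⟨fun h' => h.2 (compl_eq_bot.1 h'), fun h' => h.1 (compl_eq_compl h')⟩

/-! ### The dual cubical complex -/

/-- `V` and the finite set `A ⊆ V` span a cube of the dual: the face of the cube of all selections
with vertices the selections that agree with `V` off the walls of `A` is a cube of the dual
complex if none of its vertices is incoherent. -/
def IsCube (V A : Set P) : Prop :=
  IsSelection V ∧ A ⊆ V ∧ A.Finite ∧ ∀ W : Set P, IsSelection W → V \ A ⊆ W → IsUltra W

open Classical in
/-- The image of a vertex `U` in `[0,1]^B`: the indicator function of `B \ U`. -/
noncomputable def vertexPoint (B U : Set P) : B → ℝ := fun b => if (b : P) ∈ U then 0 else 1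

/-- The points of the cube spanned by `V` and `A`, in `[0,1]^B`: the coordinates of walls that do
not meet `A` are those of the vertex `V`, the other ones are arbitrary. -/
def unitCube (B V A : Set P) : Set (B → ℝ) :=
  {x | ∀ b : B, x b ∈ Set.Icc (0 : ℝ) 1 ∧
    ((b : P) ∉ A → (b : P)ᶜ ∉ A → x b = vertexPoint B V b)}

/-- Two points of the dual complex lie in a common cube. -/
def InCommonCube (B : Set P) (x y : B → ℝ) : Prop :=
  ∃ V A : Set P, IsCube V A ∧ x ∈ unitCube B V A ∧ y ∈ unitCube B V A

/-- The connected component of the vertex `B` in the dual complex, as a subset of `[0,1]^B`. -/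
def dualComponent (B : Set P) : Set (B → ℝ) :=
  {x | Relation.ReflTransGen (InCommonCube B) (vertexPoint B B) x}

/-- The vertices of the component of `B`. -/
def Vertex (B : Set P) : Type _ := {U : Set P // IsUltra U ∧ vertexPoint B U ∈ dualComponent B}

/-- The component of `B` is locally finite: each of its vertices lies in finitely many cubes. -/
def IsLocallyFinite (B : Set P) : Prop := ∀ U : Vertex B, {A : Set P | IsCube U.1 A}.Finite

variable (P) in
/-- Weights on a poc set; they may vanish on proper elements. -/
structure Weight where
  toFun : P → ℝ
  nonneg : ∀ a, 0 ≤ toFun a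
  map_bot : toFun ⊥ = 0
  map_compl : ∀ a, toFun aᶜ = toFun a

instance : CoeFun (Weight P) fun _ => P → ℝ := ⟨Weight.toFun⟩

open Classical in
variable (P) in
/-- The weight that is equal to `c` on all proper elements. -/
noncomputable def constWeight (c : ℝ) (hc : 0 ≤ c) : Weight P where
  toFun a := if IsProper a then c else 0
  nonneg a := by split_ifs <;> simp [hc]
  map_bot := by simp [IsProper]
  map_compl a := by
    have : IsProper aᶜ ↔ IsProper a :=
      ⟨fun h => by simpa [compl_invol] using h.compl, fun h => h.compl⟩
    simp [this]

/-- The map `diag w` of `ℝ^B`. -/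
def diag (w : Weight P) (B : Set P) (x : B → ℝ) : B → ℝ := fun b => w b * x b

/-- The weighted dual: the image in `ℝ^B` of the component of `B` under `diag w`. -/
def WeightedDual (w : Weight P) (B : Set P) : Type _ := {x : B → ℝ // x ∈ diag w B '' dualComponent B}

/-- Two points of the weighted dual lie in the image of a common cube of the component of `B`. -/
def ShareCube {w : Weight P} {B : Set P} (x y : WeightedDual w B) : Prop :=
  ∃ V A : Set P, IsCube V A ∧ unitCube B V A ⊆ dualComponent B ∧
    x.1 ∈ diag w B '' unitCube B V A ∧ y.1 ∈ diag w B '' unitCube B V A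

/-- The `ℓ^1` distance induced from `ℓ^1(B)`. -/
noncomputable def ellOne {w : Weight P} {B : Set P} (x y : WeightedDual w B) : ℝ :=
  ∑' b : B, |x.1 b - y.1 b|

/-- The distance in the norm of `ℓ^∞(B)`; it is used for points of a common cube. -/
noncomputable def supDist {w : Weight P} {B : Set P} (x y : WeightedDual w B) : ℝ :=
  ⨆ b : B, |x.1 b - y.1 b|

/-- `HasBrokenPath x y L`: some broken path from `x` to `y` (consecutive points lie in a common
cube) has length `L`, where lengths within a cube are measured in the `ℓ^∞` norm. -/
inductive HasBrokenPath {w : Weight P} {B : Set P} :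
    WeightedDual w B → WeightedDual w B → ℝ → Prop
  | nil (x) : HasBrokenPath x x 0
  | cons (x y z : WeightedDual w B) (L : ℝ) :
      ShareCube x y → HasBrokenPath y z L → HasBrokenPath x z (supDist x y + L)

/-- The piecewise-`ℓ^∞` distance: the infimum of the lengths of broken paths. -/
noncomputable def ellInf {w : Weight P} {B : Set P} (x y : WeightedDual w B) : ℝ :=
  sInf {L : ℝ | HasBrokenPath x y L}

/-! ### The two distances are metrics -/

section Metric

variable {w : Weight P} {B : Set P}

theorem finite_of_unitCube {V A : Set P} (h : IsCube V A) {x y : B → ℝ}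
    (hx : x ∈ unitCube B V A) (hy : y ∈ unitCube B V A) : {b : B | x b ≠ y b}.Finite := by
  have h1 : {b : B | (b : P) ∈ A}.Finite := h.2.2.1.preimage Subtype.val_injective.injOn
  have h2 : {b : B | (b : P)ᶜ ∈ A}.Finite :=
    h.2.2.1.preimage (f := fun b : B => (b : P)ᶜ)
      (fun a _ b _ hab => Subtype.ext (compl_eq_compl hab))
  refine (h1.union h2).subset fun b hb => ?_
  by_contra hc
  simp only [mem_union, mem_ofPred_eq, not_or] at hc
  exact hb (((hx b).2 hc.1 hc.2).trans ((hy b).2 hc.1 hc.2).symm)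

theorem finite_dualComponent {x : B → ℝ} (hx : x ∈ dualComponent B) :
    {b : B | vertexPoint B B b ≠ x b}.Finite := by
  induction hx with
  | refl => simp
  | tail _ h ih =>
    obtain ⟨V, A, hc, h1, h2⟩ := h
    refine (ih.union (finite_of_unitCube hc h1 h2)).subset fun b hb => ?_
    by_contra hc
    simp only [mem_union, mem_ofPred_eq, not_or, not_not] at hc
    exact hb (hc.1.trans hc.2)

theorem WeightedDual.finite_ne (x y : WeightedDual w B) : {b : B | x.1 b - y.1 b ≠ 0}.Finite := by
  obtain ⟨_, x', hx, rfl⟩ := x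
  obtain ⟨_, y', hy, rfl⟩ := y
  refine ((finite_dualComponent hx).union (finite_dualComponent hy)).subset fun b hb => ?_
  by_contra hc
  simp only [mem_union, mem_ofPred_eq, not_or, not_not] at hc
  exact hb (by simp [diag, ← hc.1, ← hc.2])

theorem WeightedDual.summable (x y : WeightedDual w B) : Summable fun b : B => |x.1 b - y.1 b| :=
  summable_of_hasFiniteSupport ((WeightedDual.finite_ne x y).subset fun b hb => by simpa using hb)

theorem le_supDist (x y : WeightedDual w B) (b : B) : |x.1 b - y.1 b| ≤ supDist x y := by
  refine le_ciSup (f := fun b : B => |x.1 b - y.1 b|) ?_ b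
  refine ⟨ellOne x y, ?_⟩
  rintro _ ⟨c, rfl⟩
  exact (WeightedDual.summable x y).le_tsum c fun _ _ => abs_nonneg _

theorem supDist_nonneg (x y : WeightedDual w B) : 0 ≤ supDist x y :=
  Real.iSup_nonneg fun _ => abs_nonneg _

theorem supDist_comm (x y : WeightedDual w B) : supDist x y = supDist y x := by
  simp only [supDist, abs_sub_comm]

theorem ShareCube.symm {x y : WeightedDual w B} : ShareCube x y → ShareCube y x :=
  fun ⟨V, A, h, h', hx, hy⟩ => ⟨V, A, h, h', hy, hx⟩

theorem HasBrokenPath.nonneg {x y : WeightedDual w B} {L : ℝ} (h : HasBrokenPath x y L) :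
    0 ≤ L := by
  induction h with
  | nil => exact le_rfl
  | cons x y z L _ _ ih => exact add_nonneg (supDist_nonneg _ _) ih

theorem HasBrokenPath.coord_le {x y : WeightedDual w B} {L : ℝ} (h : HasBrokenPath x y L)
    (b : B) : |x.1 b - y.1 b| ≤ L := by
  induction h with
  | nil => simp
  | cons x y z L _ _ ih =>
    exact (abs_sub_le _ _ _).trans (add_le_add (le_supDist _ _ b) ih)

theorem HasBrokenPath.append {x y z : WeightedDual w B} {L M : ℝ} (h : HasBrokenPath x y L)
    (h' : HasBrokenPath y z M) : HasBrokenPath x z (L + M) := by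
  induction h with
  | nil => simpa using h'
  | cons x y _ L hs _ ih => rw [add_assoc]; exact .cons _ _ _ _ hs (ih h')

theorem HasBrokenPath.symm {x y : WeightedDual w B} {L : ℝ} (h : HasBrokenPath x y L) :
    HasBrokenPath y x L := by
  induction h with
  | nil => exact .nil _
  | cons x y z L hs _ ih =>
    rw [add_comm, supDist_comm]
    simpa using ih.append (.cons y x x 0 hs.symm (.nil x))

/-- The base point of the weighted dual: the image of the vertex `B`, which is the origin. -/
noncomputable def basePoint (w : Weight P) (B : Set P) : WeightedDual w B :=
  ⟨diag w B (vertexPoint B B), mem_image_of_mem _ .refl⟩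

theorem exists_path_of_mem {x : B → ℝ} (hx : x ∈ dualComponent B) :
    ∃ L, HasBrokenPath (basePoint w B) ⟨diag w B x, mem_image_of_mem _ hx⟩ L := by
  induction hx with
  | refl => exact ⟨0, .nil _⟩
  | tail h1 h ih =>
    rename_i y z
    obtain ⟨L, hL⟩ := ih
    obtain ⟨V, A, hc, hy, hz⟩ := h
    refine ⟨_, hL.append (.cons _ _ _ 0 ⟨V, A, hc, ?_, ?_, ?_⟩ (.nil _))⟩
    · exact fun t ht => Relation.ReflTransGen.tail h1 ⟨V, A, hc, hy, ht⟩
    · exact mem_image_of_mem _ hy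
    · exact mem_image_of_mem _ hz

theorem exists_path (x y : WeightedDual w B) : ∃ L, HasBrokenPath x y L := by
  obtain ⟨_, x', hx, rfl⟩ := x
  obtain ⟨_, y', hy, rfl⟩ := y
  obtain ⟨L, hL⟩ := exists_path_of_mem (w := w) hx
  obtain ⟨M, hM⟩ := exists_path_of_mem (w := w) hy
  exact ⟨_, hL.symm.append hM⟩

theorem bddBelow_paths (x y : WeightedDual w B) : BddBelow {L : ℝ | HasBrokenPath x y L} :=
  ⟨0, fun _ h => HasBrokenPath.nonneg h⟩

variable (w B) in
/-- The metric space `(C^w(P)_B, ℓ^1_w)`. -/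
@[reducible] noncomputable def ellOneMetric : MetricSpace (WeightedDual w B) where
  dist := ellOne
  dist_self x := by simp [ellOne]
  dist_comm x y := by simp only [ellOne, abs_sub_comm]
  dist_triangle x y z := by
    simp only [ellOne]
    rw [← (WeightedDual.summable x y).tsum_add (WeightedDual.summable y z)]
    exact (WeightedDual.summable x z).tsum_le_tsum (fun b => abs_sub_le _ _ _)
      ((WeightedDual.summable x y).add (WeightedDual.summable y z))
  eq_of_dist_eq_zero {x y} h := by
    refine Subtype.ext (funext fun b => ?_)
    have := (WeightedDual.summable x y).le_tsum b fun _ _ => abs_nonneg _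
    have h' : |x.1 b - y.1 b| ≤ 0 := this.trans h.le
    exact sub_eq_zero.1 (abs_nonpos_iff.1 h')

variable (w B) in
/-- The metric space `(C^w(P)_B, ℓ^∞_w)`. -/
@[reducible] noncomputable def ellInfMetric : MetricSpace (WeightedDual w B) where
  dist := ellInf
  dist_self x := le_antisymm (csInf_le (bddBelow_paths x x) (.nil x))
    (le_csInf ⟨0, .nil x⟩ fun _ h => HasBrokenPath.nonneg h)
  dist_comm x y := by
    have : {L : ℝ | HasBrokenPath x y L} = {L : ℝ | HasBrokenPath y x L} :=
      Set.ext fun L => ⟨HasBrokenPath.symm, HasBrokenPath.symm⟩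
    simp only [ellInf, this]
  dist_triangle x y z := by
    refine le_of_forall_pos_le_add fun ε hε => ?_
    obtain ⟨L, hL, hL'⟩ := Real.lt_sInf_add_pos (exists_path x y) (half_pos hε)
    obtain ⟨M, hM, hM'⟩ := Real.lt_sInf_add_pos (exists_path y z) (half_pos hε)
    have h : ellInf x z ≤ L + M := csInf_le (bddBelow_paths x z) (HasBrokenPath.append hL hM)
    have h1 : L < ellInf x y + ε / 2 := hL'
    have h2 : M < ellInf y z + ε / 2 := hM'
    linarith
  eq_of_dist_eq_zero {x y} h := by
    refine Subtype.ext (funext fun b => ?_)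
    have h' : |x.1 b - y.1 b| ≤ 0 :=
      (le_csInf (exists_path x y) fun L hL => HasBrokenPath.coord_le hL b).trans
        (show sInf {L : ℝ | HasBrokenPath x y L} = 0 from h).le
    exact sub_eq_zero.1 (abs_nonpos_iff.1 h')

end Metric

/-- The two geometries on the cubes. -/
inductive Ell
  | one
  | infty

/-- The weighted dual with basepoint `B` as a piecewise-`ℓ^p` cubing, `p = 1` or `p = ∞`. -/
def Cubing (_ : Ell) (w : Weight P) (B : Set P) : Type _ := WeightedDual w B

noncomputable instance (p : Ell) (w : Weight P) (B : Set P) : MetricSpace (Cubing p w B) :=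
  match p with
  | .one => ellOneMetric w B
  | .infty => ellInfMetric w B

/-- The point of the weighted dual that is given by a vertex. -/
noncomputable def Vertex.toPoint (w : Weight P) {B : Set P} (U : Vertex B) : WeightedDual w B :=
  ⟨diag w B (vertexPoint B U.1), mem_image_of_mem _ U.2.2⟩

/-- `(p 0, …, p m)` is the normal cube path from `p 0` to `p m`. -/
def IsNormalCubePath {B : Set P} (p : ℕ → Vertex B) (m : ℕ) : Prop :=
  ∀ i < m, p i ≠ p m ∧
    (p i).1 \ (p (i + 1)).1 = {a | Minimal (· ∈ (p i).1 \ (p m).1) a}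

/-- Every wall of positive weight crosses the component of `B`: it separates `B` from some vertex
of that component. -/
def WallsCross (w : Weight P) (B : Set P) : Prop :=
  ∀ a : P, IsProper a → 0 < w a → ∃ U : Vertex B, (a ∈ U.1 ↔ a ∉ B)

end Basic

/-! ### Refinements -/

/-- Refinement maps of poc sets. Fibers over proper elements may be empty. -/
structure IsRefinement {Q P : Type*} [PocSet Q] [PocSet P] (f : Q → P) : Prop where
  monotone : ∀ a b, a ≤ b → f a ≤ f b
  map_compl : ∀ a, f aᶜ = (f a)ᶜ
  fiber_bot : f ⁻¹' {⊥} = {⊥}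
  finite_fiber : ∀ p, IsProper p → (f ⁻¹' {p}).Finite
  chain_fiber : ∀ p, IsProper p → IsChain (· ≤ ·) (f ⁻¹' {p})
  lt_iff : ∀ a b, IsProper (f a) → IsProper (f b) → f a ≠ f b → f a ≠ (f b)ᶜ →
    (a < b ↔ f a < f b)

/-- The refinement of `P` in which each proper `p` is replaced by a chain of `u p` elements
`(p, 0) < (p, 1) < …`; elements with `u p = 0` are deleted. -/
inductive Refined {P : Type*} [PocSet P] (u : P → ℕ) (hu : ∀ a, u aᶜ = u a)
  | bot
  | top
  | mk (p : P) (hp : IsProper p) (i : Fin (u p))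

namespace Refined

variable {P : Type*} [PocSet P] {u : P → ℕ} {hu : ∀ a, u aᶜ = u a}

/-- The order: lexicographic on pairs `(p, i)`. -/
def le : Refined u hu → Refined u hu → Prop
  | .bot, _ => True
  | _, .top => True
  | .mk p _ i, .mk q _ j => p < q ∨ (p = q ∧ i.val ≤ j.val)
  | _, _ => False

/-- The involution: `(p, i) ↦ (pᶜ, u p - 1 - i)`. -/
def compl : Refined u hu → Refined u hu
  | .bot => .top
  | .top => .bot
  | .mk p hp i => .mk pᶜ hp.compl ⟨u p - 1 - i, by have := i.2; rw [hu]; omega⟩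

theorem mk_ext {p q : P} {hp : IsProper p} {hq : IsProper q} {i : Fin (u p)} {j : Fin (u q)}
    (h : p = q) (hij : i.val = j.val) : (mk p hp i : Refined u hu) = mk q hq j := by
  subst h
  rw [Fin.ext hij]

theorem compl_lt {p q : P} (h : p < q) : qᶜ < pᶜ :=
  lt_of_le_of_ne (compl_anti _ _ h.le) fun h' => h.ne (compl_eq_compl h').symm

instance : PocSet (Refined u hu) where
  le := le
  le_refl a := by cases a <;> simp [le]
  le_trans a b c hab hbc := by
    rcases a with _ | _ | ⟨p, hp, i⟩ <;> rcases b with _ | _ | ⟨q, hq, j⟩ <;>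
      rcases c with _ | _ | ⟨r, hr, k⟩ <;> simp only [le] at * 
    rcases hab with h | ⟨rfl, h⟩ <;> rcases hbc with h' | ⟨rfl, h'⟩
    · exact .inl (h.trans h')
    · exact .inl h
    · exact .inl h'
    · exact .inr ⟨rfl, h.trans h'⟩
  le_antisymm a b hab hba := by
    rcases a with _ | _ | ⟨p, hp, i⟩ <;> rcases b with _ | _ | ⟨q, hq, j⟩ <;>
      simp only [le] at *
    rcases hab with h | ⟨h1, h⟩ <;> rcases hba with h' | ⟨h2, h'⟩
    · exact absurd (h.trans h') (lt_irrefl _)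
    · exact absurd h2.symm h.ne
    · exact absurd h1.symm h'.ne
    · exact mk_ext h1 (le_antisymm h h')
  bot := bot
  bot_le a := by cases a <;> trivial
  compl := compl
  compl_invol a := by
    rcases a with _ | _ | ⟨p, hp, i⟩
    · rfl
    · rfl
    · refine mk_ext (compl_invol p) ?_
      have := i.2
      simp only [hu]
      omega
  compl_anti a b hab := by
    rcases a with _ | _ | ⟨p, hp, i⟩ <;> rcases b with _ | _ | ⟨q, hq, j⟩ <;>
      simp only [LE.le, le, compl] at *
    rcases hab with h | ⟨rfl, h⟩
    · exact .inl (compl_lt h)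
    · exact .inr ⟨rfl, Nat.sub_le_sub_left h _⟩
  eq_bot_of_le a h := by
    rcases a with _ | _ | ⟨p, hp, i⟩
    · rfl
    · exact h.elim
    · rcases h with h | ⟨h, -⟩
      · exact absurd (eq_bot_of_le p h.le) hp.1
      · exact absurd (eq_bot_of_le p h.le) hp.1

variable (u hu) in
/-- The refinement map. -/
def proj : Refined u hu → P
  | .bot => ⊥
  | .top => ⊥ᶜ
  | .mk p _ _ => p

theorem isRefinement_proj (h0 : (⊥ : P) ≠ ⊥ᶜ) : IsRefinement (proj u hu) where
  monotone a b h := by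
    rcases a with _ | _ | ⟨p, hp, i⟩ <;> rcases b with _ | _ | ⟨q, hq, j⟩
    case mk.mk => exact h.elim le_of_lt fun h => h.1.le
    case top.bot => exact h.elim
    case top.mk => exact h.elim
    case mk.bot => exact h.elim
    all_goals first | exact le_rfl | exact bot_le | skip
    simp only [proj]
    rw [← compl_invol p]
    exact compl_anti _ _ bot_le
  map_compl a := by
    rcases a with _ | _ | ⟨p, hp, i⟩
    · rfl
    · exact (compl_invol _).symm
    · rfl
  fiber_bot := by
    ext a
    rcases a with _ | _ | ⟨p, hp, i⟩
    · exact ⟨fun _ => rfl, fun _ => rfl⟩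
    · exact ⟨fun h => absurd h h0.symm, fun h => by cases h⟩
    · exact ⟨fun h => absurd h hp.1, fun h => by cases h⟩
  finite_fiber p hp := by
    refine (Set.finite_range fun i : Fin (u p) => (mk p hp i : Refined u hu)).subset ?_
    rintro (_ | _ | ⟨q, hq, i⟩) h
    · exact absurd (Eq.symm h) hp.1
    · exact absurd (Eq.symm h) hp.2
    · obtain rfl : q = p := h
      exact ⟨i, rfl⟩
  chain_fiber p hp := by
    rintro (_ | _ | ⟨q, hq, i⟩) h (_ | _ | ⟨r, hr, j⟩) h' _
    case mk.mk =>
      obtain rfl : q = p := h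
      obtain rfl : r = q := h'
      exact (le_total i.val j.val).imp (fun h => .inr ⟨rfl, h⟩) fun h => .inr ⟨rfl, h⟩
    all_goals first
      | exact absurd (Eq.symm h) hp.1
      | exact absurd (Eq.symm h) hp.2
      | exact absurd (Eq.symm h') hp.1
      | exact absurd (Eq.symm h') hp.2
  lt_iff a b ha hb hne _ := by
    rcases a with _ | _ | ⟨p, hp, i⟩
    · exact absurd rfl ha.1
    · exact absurd rfl ha.2
    rcases b with _ | _ | ⟨q, hq, j⟩
    · exact absurd rfl hb.1
    · exact absurd rfl hb.2
    constructor
    · intro h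
      exact h.le.elim id fun h => absurd h.1 hne
    · intro h
      refine lt_of_le_not_ge (.inl h) ?_
      rintro (h' | ⟨h', -⟩)
      · exact lt_asymm h h'
      · exact hne h'.symm

end Refined

/-! ### Lower rational approximations -/

section LowerApprox

variable {P : Type*} [PocSet P]

/-- `u(p) = ⌊n · w(p)⌋`. -/
noncomputable def floorWeight (w : Weight P) (n : ℕ) (a : P) : ℕ := ⌊n * w a⌋₊

theorem floorWeight_compl (w : Weight P) (n : ℕ) (a : P) :
    floorWeight w n aᶜ = floorWeight w n a := by
  simp only [floorWeight, w.map_compl]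

/-- The poc set underlying the `n`-th lower rational approximation. -/
abbrev LowerApprox (w : Weight P) (n : ℕ) : Type _ :=
  Refined (floorWeight w n) (floorWeight_compl w n)

/-- The basepoint of the approximation: the preimage of `B` under the refinement map. -/
def approxBase (w : Weight P) (B : Set P) (n : ℕ) : Set (LowerApprox w n) :=
  Refined.proj (floorWeight w n) (floorWeight_compl w n) ⁻¹' B

/-- The weight of the approximation: unit weights, rescaled by `1 / n`. -/
noncomputable def approxWeight (w : Weight P) (n : ℕ) : Weight (LowerApprox w n) :=
  constWeight (LowerApprox w n) (1 / n) (by positivity)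

/-- The dual of the `n`-th lower rational approximation as a piecewise-`ℓ^p` cubing. -/
abbrev ApproxCubing (p : Ell) (w : Weight P) (B : Set P) (n : ℕ) : Type _ :=
  Cubing p (approxWeight w n) (approxBase w B n)

/-- The canonical correspondence between the dual of the `n`-th lower rational approximation and
the weighted dual: for every `b ∈ B`, the coordinates of `z` in the chain that replaces `b` add up
to `(⌊n w(b)⌋ / (n w(b))) x(b)`, that is, `z` is the point of the subdivision given by the
point `x` after the `b`-axis is rescaled from length `w(b)` to length `⌊n w(b)⌋ / n`. -/
def Corresponds {w : Weight P} {B : Set P} {n : ℕ}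
    (z : WeightedDual (approxWeight w n) (approxBase w B n)) (x : WeightedDual w B) : Prop :=
  ∀ (b : P) (hp : IsProper b) (hb : b ∈ B),
    w b * ∑ i : Fin (floorWeight w n b), z.1 ⟨Refined.mk b hp i, hb⟩ =
      (floorWeight w n b / n : ℝ) * x.1 ⟨b, hb⟩

/-- `z n ∈ X_n` converges to `x ∈ X`: the distance in `X_n` from `z n` to the point that
corresponds to `x` tends to `0`. -/
def ConvergesTo (p : Ell) {w : Weight P} {B : Set P} (z : ∀ n, ApproxCubing p w B n)
    (x : Cubing p w B) : Prop :=
  ∀ ε > 0, ∃ N : ℕ, ∀ n ≥ N, ∃ x' : ApproxCubing p w B n, Corresponds x' x ∧ dist (z n) x' ≤ ε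

/-- The broken paths `(v n 0, …, v n (m n))` in `X_n`, run through at the rate of one step per
time `1 / n`, converge uniformly to `γ`, and their durations `m n / n` converge to `L`. -/
def PathsConvergeTo (p : Ell) {w : Weight P} {B : Set P}
    (v : ∀ n, ℕ → ApproxCubing p w B n) (m : ℕ → ℕ) (γ : ℝ → Cubing p w B) (L : ℝ) : Prop :=
  Tendsto (fun n => (m n / n : ℝ)) atTop (𝓝 L) ∧
  ∀ ε > 0, ∃ N : ℕ, ∀ n ≥ N, ∀ k ≤ m n, ∃ x' : ApproxCubing p w B n,
    Corresponds x' (γ (k / n)) ∧ dist (v n k) x' ≤ ε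

end LowerApprox

end PocSet

/-! ### Gromov-Hausdorff convergence -/

/-- `ε`-approximations between metric spaces. -/
def IsApproximation {X Y : Type*} [MetricSpace X] [MetricSpace Y] (ε : ℝ)
    (R : Set (X × Y)) : Prop :=
  (∀ x : X, ∃ q ∈ R, dist x q.1 ≤ ε) ∧ (∀ y : Y, ∃ q ∈ R, dist y q.2 ≤ ε) ∧
    ∀ q ∈ R, ∀ r ∈ R, |dist q.1 r.1 - dist q.2 r.2| < ε

/-- Gromov-Hausdorff convergence: for every `ε > 0` there are eventually surjective
`ε`-approximations. -/
def GHConverges {X : ℕ → Type*} {Y : Type*} [∀ n, MetricSpace (X n)] [MetricSpace Y] : Prop :=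
  ∀ ε > 0, ∃ N : ℕ, ∀ n ≥ N, ∃ R : Set (X n × Y), IsApproximation ε R ∧
    Prod.fst '' R = Set.univ ∧ Prod.snd '' R = Set.univ

/-- Pointed Gromov-Hausdorff convergence: the closed balls about the base points converge. -/
def PointedGHConverges {X : ℕ → Type*} {Y : Type*} [∀ n, MetricSpace (X n)] [MetricSpace Y]
    (x : ∀ n, X n) (y : Y) : Prop :=
  ∀ R : ℝ, 0 < R → GHConverges (X := fun n => Metric.closedBall (x n) R)
    (Y := Metric.closedBall y R)

/-! A point of the component of `B` is the same as a fractional ultrafilter: a function μ from `P`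
to [0,1] with μ(aᶜ) = 1 - μ(a), with μ(a) = 0 or μ(b) = 1 whenever a < b, and with μ = 1 on almost
all of `B`; its coordinates are 1 - μ(b). To move from μ to ν, the finitely many elements of `drop μ
ν` have to lose degree, and nestedness says that a smaller element must be finished before a larger
one starts.

Hence d_∞(μ, ν) is the maximum over finite chains C of the sums ∑ w(a)(μ(a) - ν(a)). No chain sum
exceeds the distance, because within a cube at most one element of a chain varies
(`abs_chain_sum_le_ellInf`). The bound is attained, because dropping all minimal elements at the
same speed shortens every chain that matters (`ellInf_le_of_chain`). As d_1 is a sum over walls,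
both metrics are monotone and subadditive in the weight (`pdist_le_add`).

Balls. Distributing the degree of each a over the chain that replaces it embeds the points of X into
X_n, isometrically for the rounded weight ⌊n w⌋ / n (`pdist_subdivide`). So subdivision is
1-Lipschitz for w and distorts a given pair by at most 1/n times its distance for unit weights;
compactness of balls makes this uniform (`eventually_distortion`). If the walls of positive weight
cross the component, each point of X_n is a subdivision (`exists_subdivide`). A point of the R-ball
of X_n whose counterpart leaves the R-ball of X is pulled back along a geodesic
(`exists_close_in_ball`).

Paths. The geodesic γ is the flow that drops every element as early as possible at unit speed: a
starts at the largest weight of a chain below it (`startTime`). A normal cube path does the same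
combinatorially, since it crosses an element only after a longest chain below it. Comparing chains
in the approximate endpoint with chains for μ shows that step number divided by n and flow time
agree up to a small κ (`reachTime_le_of_notMem`, `le_reachTime_of_mem`). Path and flow thus differ
only by the error at the endpoints and by elements reached within κ of the present time, which make
up a short piece of each of finitely many chains (`pdist_subdivide_flow_le`). -/

namespace PocSet

/-! ### Fractional ultrafilters as points of the dual complex -/

section Fractional

variable {P : Type*} [PocSet P]

theorem IsSelection.compl_mem_iff {U : Set P} (h : IsSelection U) {a : P} : aᶜ ∈ U ↔ a ∉ U := by
  have := h a
  grind [Xor]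

theorem IsUltra.mem_of_le {U : Set P} (h : IsUltra U) {a b : P} (ha : a ∈ U) (hab : a ≤ b) :
    b ∈ U := by
  by_contra hb
  exact h.2 a ha bᶜ (h.1.compl_mem_iff.2 hb) (by rwa [compl_invol])

theorem compl_lt_compl {a b : P} (h : a < b) : bᶜ < aᶜ :=
  lt_of_le_of_ne (compl_anti _ _ h.le) fun h' => h.ne (compl_eq_compl h').symm

/-- A fractional ultrafilter: a point of the component of `B` of the dual complex, given by the
degrees to which the elements of `P` belong to it. -/
structure Fractional (B : Set P) where
  toFun : P → ℝ
  nonneg : ∀ a, 0 ≤ toFun a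
  map_compl : ∀ a, toFun aᶜ = 1 - toFun a
  nested : ∀ a b, a < b → toFun a = 0 ∨ toFun b = 1
  finite : {b | b ∈ B ∧ toFun b ≠ 1}.Finite

namespace Fractional

variable {B : Set P}

instance : CoeFun (Fractional B) fun _ => P → ℝ := ⟨Fractional.toFun⟩

theorem le_one (μ : Fractional B) (a : P) : μ a ≤ 1 := by
  have := μ.nonneg aᶜ
  have := μ.map_compl a
  linarith

/-- The point of `[0,1]^B` that corresponds to a fractional ultrafilter. -/
def point (μ : Fractional B) : B → ℝ := fun b => 1 - μ b

/-- The set of the elements whose degrees are strictly larger in `μ` than in `ν`. -/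
def drop (μ ν : Fractional B) : Set P := {a | ν a < μ a}

theorem compl_mem_drop {μ ν : Fractional B} {a : P} : aᶜ ∈ drop μ ν ↔ a ∈ drop ν μ := by
  have h1 := μ.map_compl a
  have h2 := ν.map_compl a
  simp only [drop, mem_ofPred_eq, h1, h2]
  constructor <;> intro <;> linarith

theorem finite_drop (hB : IsSelection B) (μ ν : Fractional B) : (drop μ ν).Finite := by
  have h := μ.finite.union ν.finite
  refine (h.union (h.image compl)).subset fun a ha => ?_
  by_cases hb : a ∈ B
  · by_contra hc
    simp only [mem_union, mem_ofPred_eq, not_or, not_and, not_not] at hc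
    have : ν a < μ a := ha
    rw [hc.1.1 hb, hc.1.2 hb] at this
    exact lt_irrefl _ this
  · refine Or.inr ⟨aᶜ, ?_, compl_invol a⟩
    by_contra hc
    simp only [mem_union, mem_ofPred_eq, not_or, not_and, not_not] at hc
    have hb' := hB.compl_mem_iff.2 hb
    have h1 := hc.1 hb'
    have h2 := hc.2 hb'
    rw [map_compl] at h1 h2
    have : ν a < μ a := ha
    linarith

theorem eq_zero_of_lt {μ ν : Fractional B} {a b : P} (hab : a < b) (hb : b ∈ drop μ ν) :
    ν a = 0 :=
  (ν.nested a b hab).resolve_right (ne_of_lt (lt_of_lt_of_le hb (μ.le_one b)))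

/-- A function between two fractional ultrafilters that respects the order of the elements to be
dropped is a fractional ultrafilter. -/
def between (μ ν : Fractional B) (ρ : P → ℝ) (hc : ∀ a, ρ aᶜ = 1 - ρ a)
    (h1 : ∀ a, min (μ a) (ν a) ≤ ρ a) (h2 : ∀ a, ρ a ≤ max (μ a) (ν a))
    (h : ∀ a b, a < b → a ∈ drop μ ν → b ∈ drop μ ν → ρ b < μ b → ρ a = ν a) :
    Fractional B where
  toFun := ρ
  nonneg a := (le_min (μ.nonneg a) (ν.nonneg a)).trans (h1 a)
  map_compl := hc
  nested a b hab := by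
    by_contra hcon
    push Not at hcon
    obtain ⟨ha0, hb1⟩ := hcon
    have ha1 := h1 a
    have ha2 := h2 a
    have hb1' := h1 b
    have hb2 := h2 b
    have m1 := μ.le_one b
    have n1 := ν.le_one b
    have m0 := μ.nonneg a
    have n0 := ν.nonneg a
    rcases μ.nested a b hab with hm | hm <;> rcases ν.nested a b hab with hn | hn
    · exact ha0 (by rw [hm, hn] at ha1 ha2; simp at ha1 ha2; linarith)
    -- Now μ(a) = 0 and ν(b) = 1, so both elements rise; the condition on the order of dropping is
    -- applied to `bᶜ < aᶜ`.
    · have e1 : aᶜ ∈ drop μ ν := by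
        rw [compl_mem_drop]
        refine lt_of_le_of_ne (hm ▸ n0) fun e => ?_
        rw [← e, hm] at ha1 ha2
        simp at ha1 ha2
        exact ha0 (le_antisymm ha2 ha1)
      have e2 : bᶜ ∈ drop μ ν := by
        rw [compl_mem_drop]
        refine lt_of_le_of_ne (hn ▸ m1) fun e => ?_
        rw [e, hn] at hb1' hb2
        simp at hb1' hb2
        exact hb1 (le_antisymm hb2 hb1')
      have := h _ _ (compl_lt_compl hab) e2 e1 (by
        rw [hc, μ.map_compl, hm]
        have : 0 < ρ a := lt_of_le_of_ne ((le_min m0 n0).trans ha1) (Ne.symm ha0)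
        linarith)
      rw [hc, ν.map_compl, hn] at this
      exact hb1 (by linarith)
    · have e1 : a ∈ drop μ ν := by
        refine lt_of_le_of_ne (hn ▸ m0) fun e => ?_
        rw [← e, hn] at ha1 ha2
        simp at ha1 ha2
        exact ha0 (le_antisymm ha2 ha1)
      have e2 : b ∈ drop μ ν := by
        refine lt_of_le_of_ne (hm ▸ n1) fun e => ?_
        rw [e, hm] at hb1' hb2
        simp at hb1' hb2
        exact hb1 (le_antisymm hb2 hb1')
      have := h _ _ hab e1 e2 (by
        rw [hm]
        exact lt_of_le_of_ne (hb2.trans (max_le m1 n1)) hb1)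
      exact ha0 (this.trans hn)
    · exact hb1 (by rw [hm, hn] at hb1' hb2; simp at hb1' hb2; linarith)
  finite := by
    refine (μ.finite.union ν.finite).subset fun b hb => ?_
    by_contra hcon
    simp only [mem_union, mem_ofPred_eq, not_or, not_and, not_not] at hcon
    have e1 := h1 b
    have e2 := h2 b
    rw [hcon.1 hb.1, hcon.2 hb.1] at e1 e2
    simp at e1 e2
    exact hb.2 (le_antisymm e2 e1)

/-- A cube that contains all points whose midpoint is `κ`. -/
theorem exists_cube (hB : IsSelection B) (κ : Fractional B) :
    ∃ V A : Set P, IsCube V A ∧ ∀ μ ν : Fractional B, (∀ a, μ a + ν a = 2 * κ a) →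
      μ.point ∈ unitCube B V A := by
  -- The cube varies the walls on which κ is neither 0 nor 1, and there `V` follows `B`. On the
  -- other walls two points with midpoint κ must both agree with κ, as degrees lie in [0,1].
  refine ⟨{a | κ a = 1 ∨ (κ a ≠ 0 ∧ a ∈ B)}, {a | a ∈ B ∧ κ a ≠ 0 ∧ κ a ≠ 1},
    ⟨?_, ?_, ?_, ?_⟩, ?_⟩
  · intro a
    have h1 := κ.map_compl a
    have h2 := @hB.compl_mem_iff _ _ _ a
    by_cases e1 : κ a = 1
    · have : κ aᶜ = 0 := by linarith
      exact Or.inl ⟨Or.inl e1, by simp [this]⟩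
    by_cases e0 : κ a = 0
    · have : κ aᶜ = 1 := by linarith
      exact Or.inr ⟨Or.inl this, by simp [e0]⟩
    have e2 : κ aᶜ ≠ 1 := fun h => e0 (by linarith)
    have e3 : κ aᶜ ≠ 0 := fun h => e1 (by linarith)
    by_cases hb : a ∈ B
    · exact Or.inl ⟨Or.inr ⟨e0, hb⟩, by simp [e2, h2, hb]⟩
    · exact Or.inr ⟨Or.inr ⟨e3, h2.2 hb⟩, by simp [e1, hb]⟩
  · exact fun a ha => Or.inr ⟨ha.2.1, ha.1⟩
  · exact κ.finite.subset fun a ha => ⟨ha.1, ha.2.2⟩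
  · intro W hW hVW
    -- If `κ a = 0`, then `aᶜ` has degree one and belongs to every vertex of the cube. So all
    -- elements of `W` have positive degree, and nestedness of κ yields coherence.
    have key : ∀ a ∈ W, κ a ≠ 0 := by
      intro a ha h0
      have h1 : κ aᶜ = 1 := by rw [κ.map_compl, h0, sub_zero]
      exact hW.compl_mem_iff.1 (hVW ⟨Or.inl h1, fun h => h.2.2 h1⟩) ha
    refine ⟨hW, fun a ha b hb hab => ?_⟩
    rcases hab.eq_or_lt with e | hlt
    · exact hW.compl_mem_iff.1 (e ▸ ha) hb
    · rcases κ.nested _ _ hlt with h | h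
      · exact key a ha h
      · exact key b hb (by have := κ.map_compl b; linarith)
  · intro μ ν hμν b
    have m0 := μ.nonneg b
    have m1 := μ.le_one b
    have n0 := ν.nonneg b
    have n1 := ν.le_one b
    have hs := hμν b
    refine ⟨⟨by simp [point, m1], by simp [point, m0]⟩, fun h _ => ?_⟩
    simp only [mem_ofPred_eq, Subtype.coe_prop, true_and, not_and, not_not] at h
    by_cases h0 : κ b = 0
    · have : ¬ ((b : P) ∈ {a | κ a = 1 ∨ (κ a ≠ 0 ∧ a ∈ B)}) := by simp [h0]
      simp only [vertexPoint, this, if_false, point]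
      linarith
    · have : (b : P) ∈ {a | κ a = 1 ∨ (κ a ≠ 0 ∧ a ∈ B)} := by simp [h0]
      have h1 := h h0
      simp only [vertexPoint, this, if_true, point]
      linarith

open Classical in
/-- The fractional ultrafilter of an ultrafilter. -/
noncomputable def ofUltra (U : Set P) (hU : IsUltra U) (hf : (B \ U).Finite) : Fractional B where
  toFun a := if a ∈ U then 1 else 0
  nonneg a := by split_ifs <;> simp
  map_compl a := by
    simp only [hU.1.compl_mem_iff]
    split_ifs <;> simp
  nested a b hab := by
    by_cases h : a ∈ U
    · exact Or.inr (if_pos (hU.mem_of_le h hab.le))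
    · exact Or.inl (if_neg h)
  finite := hf.subset fun b hb => ⟨hb.1, fun h => hb.2 (if_pos h)⟩

theorem ofUltra_point (U : Set P) (hU : IsUltra U) (hf : (B \ U).Finite) :
    (ofUltra U hU hf).point = vertexPoint B U := by
  ext b
  simp only [point, ofUltra, vertexPoint]
  split_ifs <;> simp

theorem inCommonCube (hB : IsSelection B) {μ ν κ : Fractional B}
    (h : ∀ a, μ a + ν a = 2 * κ a) : InCommonCube B μ.point ν.point := by
  obtain ⟨V, A, hc, hA⟩ := exists_cube hB κ
  exact ⟨V, A, hc, hA μ ν h, hA ν μ fun a => by rw [add_comm, h]⟩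

open Classical in
/-- Replace the degree of a maximal element of `B` that has not got degree one. -/
noncomputable def raise (hB : IsUltra B) (μ : Fractional B) (a : P) (ha : a ∈ B) (h1 : μ a ≠ 1)
    (hmax : ∀ b ∈ B, a < b → μ b = 1) (r : ℝ) (h0 : 0 ≤ r) (hr : r ≤ 1) : Fractional B where
  toFun c := if c = a then r else if c = aᶜ then 1 - r else μ c
  nonneg c := by
    split_ifs
    · exact h0
    · linarith
    · exact μ.nonneg c
  map_compl c := by
    have hne : a ≠ aᶜ := fun h => hB.1.compl_mem_iff.1 (h ▸ ha) ha
    have e1 : cᶜ = a ↔ c = aᶜ :=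
      ⟨fun h => by rw [← h, compl_invol], fun h => by rw [h, compl_invol]⟩
    have e2 : cᶜ = aᶜ ↔ c = a := ⟨compl_eq_compl, fun h => by rw [h]⟩
    simp only [e1, e2]
    by_cases h : c = a
    · simp [h, hne]
    · by_cases h' : c = aᶜ
      · simp [h', hne.symm]
      · simp [h, h', μ.map_compl]
  nested b c hbc := by
    -- Everything above `a` has degree one by maximality and everything below has degree zero by
    -- nestedness, so the degree of `a` is free.
    have hu : ∀ c, a < c → μ c = 1 := fun c h => hmax c (hB.mem_of_le ha h.le) h
    have hd : ∀ c, c < a → μ c = 0 := fun c h => (μ.nested c a h).resolve_right h1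
    have hu' : ∀ c, aᶜ < c → μ c = 1 := fun c h => by
      have := hd cᶜ (by simpa [compl_invol] using compl_lt_compl h)
      rw [μ.map_compl] at this
      linarith
    have hd' : ∀ c, c < aᶜ → μ c = 0 := fun c h => by
      have := hu cᶜ (by simpa [compl_invol] using compl_lt_compl h)
      rw [μ.map_compl] at this
      linarith
    have hn1 : ¬ a < aᶜ := fun h => hB.2 a ha a ha h.le
    have hn2 : ¬ aᶜ < a := fun h => by
      have := hd _ h
      rw [μ.map_compl] at this
      exact h1 (by linarith)
    have := μ.nested b c hbc
    have hirr := lt_irrefl b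
    split_ifs <;> first | exact this | (subst_vars; grind)
  finite := (μ.finite.union (finite_singleton a)).subset fun b hb => by
    by_cases h : b = a
    · exact Or.inr h
    · refine Or.inl ⟨hb.1, fun h' => hb.2 ?_⟩
      have : b ≠ aᶜ := fun e => hB.1.compl_mem_iff.1 (e ▸ hb.1) ha
      simp [h, this, h']

/-- Raising to one the degree of a maximal element of `B` of degree less than one moves within a
cube, namely the one around the midpoint. Finitely many such moves reach the vertex `B`. -/
theorem point_mem (hB : IsUltra B) (μ : Fractional B) : μ.point ∈ dualComponent B := by
  classical
  obtain ⟨k, hk⟩ : ∃ k, μ.finite.toFinset.card = k := ⟨_, rfl⟩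
  induction k using Nat.strong_induction_on generalizing μ with
  | _ k ih =>
  rcases μ.finite.toFinset.eq_empty_or_nonempty with he | hne
  · have : μ.point = vertexPoint B B := by
      ext b
      have : (b : P) ∉ μ.finite.toFinset := by simp [he]
      simp only [Finite.mem_toFinset, mem_ofPred_eq, Subtype.coe_prop, true_and, not_not] at this
      simp [point, this, vertexPoint]
    rw [this]
    exact .refl
  · obtain ⟨a, ha⟩ := μ.finite.toFinset.exists_maximal hne
    have ha' : a ∈ B ∧ μ a ≠ 1 := by simpa using ha.prop
    have hmax : ∀ b ∈ B, a < b → μ b = 1 := by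
      intro b hb hab
      by_contra h
      exact ha.not_gt (by simpa using ⟨hb, h⟩) hab
    have h0 := μ.nonneg a
    have h1 := μ.le_one a
    have hne : aᶜ ≠ a := fun h => hB.1.compl_mem_iff.1 (h.symm ▸ ha'.1) ha'.1
    let μ' := raise hB μ a ha'.1 ha'.2 hmax 1 (by simp) le_rfl
    let κ := raise hB μ a ha'.1 ha'.2 hmax ((1 + μ a) / 2) (by linarith) (by linarith)
    refine .tail (ih _ ?_ μ' rfl) (inCommonCube (κ := κ) hB.1 fun c => ?_)
    · rw [← hk]
      refine Finset.card_lt_card (Finset.ssubset_iff_of_subset ?_ |>.2 ⟨a, ha.prop, ?_⟩)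
      · intro b hb
        simp only [Finite.mem_toFinset, mem_ofPred_eq] at hb ⊢
        refine ⟨hb.1, fun h => hb.2 ?_⟩
        have : b ≠ aᶜ := fun e => hB.1.compl_mem_iff.1 (e ▸ hb.1) ha'.1
        simp [μ', raise, this, h]
      · simp [μ', raise]
    · simp only [μ', κ, raise]
      split_ifs with e1 e2
      · rw [e1]; ring
      · rw [e2, μ.map_compl]; ring
      · ring

end Fractional

open Classical in
/-- The degrees to which the elements of `P` belong to a point of `[0,1]^B`. -/
noncomputable def degree (B : Set P) (x : B → ℝ) (a : P) : ℝ :=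
  if h : a ∈ B then 1 - x ⟨a, h⟩ else if h : aᶜ ∈ B then x ⟨aᶜ, h⟩ else 0

/-- The selection that is obtained from `V` by flipping the walls of `F`. -/
def flip (V F : Set P) : Set P := {c | (c ∈ V ∧ c ∉ F) ∨ cᶜ ∈ F}

theorem IsSelection.flip {V F : Set P} (hV : IsSelection V) (hF : F ⊆ V) :
    IsSelection (flip V F) := by
  intro c
  have h := @hV.compl_mem_iff _ _ _ c
  have h1 := @hF c
  have h2 := @hF cᶜ
  simp only [PocSet.flip, mem_ofPred_eq, compl_invol, Xor]
  tauto

/-! ### From points of the component to fractional ultrafilters -/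

section Degree

variable {B : Set P}

theorem degree_compl (hB : IsSelection B) (x : B → ℝ) (a : P) :
    degree B x aᶜ = 1 - degree B x a := by
  by_cases h : a ∈ B
  · have h' : aᶜ ∉ B := fun h' => hB.compl_mem_iff.1 h' h
    simp [degree, h, h', compl_invol]
  · have h' := hB.compl_mem_iff.2 h
    simp [degree, h, h']

theorem degree_mem {V A : Set P} {x : B → ℝ} (hx : x ∈ unitCube B V A) (a : P) :
    0 ≤ degree B x a ∧ degree B x a ≤ 1 := by
  unfold degree
  split_ifs with h1 h2
  · have := (hx ⟨a, h1⟩).1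
    exact ⟨by linarith [this.2], by linarith [this.1]⟩
  · exact (hx ⟨aᶜ, h2⟩).1
  · simp

theorem degree_of_notMem (hB : IsSelection B) {V A : Set P} (hV : IsSelection V) {x : B → ℝ}
    (hx : x ∈ unitCube B V A) {a : P} (h1 : a ∉ A) (h2 : aᶜ ∉ A) :
    (a ∈ V → degree B x a = 1) ∧ (a ∉ V → degree B x a = 0) := by
  have hV' := @hV.compl_mem_iff _ _ _ a
  by_cases h : a ∈ B
  · have := (hx ⟨a, h⟩).2 h1 h2
    simp only [degree, h, dif_pos, this, vertexPoint]
    constructor <;> intro h <;> simp [h]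
  · have h' := hB.compl_mem_iff.2 h
    have := (hx ⟨aᶜ, h'⟩).2 h2 (by rwa [compl_invol])
    simp only [degree, h, h', dif_pos, this, vertexPoint]
    constructor <;> intro h <;> simp [h, hV']

/-- Otherwise the cube leaves enough freedom to flip `V` to a vertex that contains both `a` and
`bᶜ`, and this is incoherent because `a ≤ b`. -/
theorem degree_nested (hB : IsSelection B) {V A : Set P} (hc : IsCube V A) {x : B → ℝ}
    (hx : x ∈ unitCube B V A) {a b : P} (hab : a < b) :
    degree B x a = 0 ∨ degree B x b = 1 := by
  by_contra hcon
  push Not at hcon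
  obtain ⟨hV, hA, -, hW⟩ := hc
  have ha := @hV.compl_mem_iff _ _ _ a
  have hb := @hV.compl_mem_iff _ _ _ b
  have hAa := @hA a
  have hAb := @hA b
  have hAa' := @hA aᶜ
  have hAb' := @hA bᶜ
  have d1 : a ∉ V → aᶜ ∈ A := by
    intro h
    by_contra h'
    exact hcon.1 ((degree_of_notMem hB hV hx (fun h1 => h (hA h1)) h').2 h)
  have d2 : b ∈ V → b ∈ A := by
    intro h
    by_contra h'
    exact hcon.2 ((degree_of_notMem hB hV hx h' (fun h1 => hb.1 (hA h1) h)).1 h)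
  let F : Set P := {c | (c = aᶜ ∧ a ∉ V) ∨ (c = b ∧ b ∈ V)}
  have hFA : F ⊆ A := by
    rintro c (⟨rfl, h⟩ | ⟨rfl, h⟩)
    · exact d1 h
    · exact d2 h
  have hU := hW (flip V F) (hV.flip (hFA.trans hA)) fun c hc => by
    exact Or.inl ⟨hc.1, fun h => hc.2 (hFA h)⟩
  have hne : aᶜ ≠ bᶜ := fun h => hab.ne (compl_eq_compl h)
  have e1 : a ∈ flip V F := by
    by_cases h : a ∈ V
    · refine Or.inl ⟨h, ?_⟩
      rintro (⟨h', h''⟩ | ⟨h', -⟩)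
      · exact h'' h
      · exact hab.ne h'
    · exact Or.inr (Or.inl ⟨rfl, h⟩)
  have e2 : bᶜ ∈ flip V F := by
    by_cases h : b ∈ V
    · exact Or.inr (Or.inr ⟨compl_invol b, h⟩)
    · refine Or.inl ⟨hb.2 h, ?_⟩
      rintro (⟨h', h''⟩ | ⟨h', h''⟩)
      · exact hne h'.symm
      · exact h h''
  exact hU.2 _ e1 _ e2 (by rw [compl_invol]; exact hab.le)

theorem exists_cube_of_mem (hB : IsUltra B) {x : B → ℝ} (hx : x ∈ dualComponent B) :
    ∃ V A, IsCube V A ∧ x ∈ unitCube B V A := by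
  rcases hx.cases_tail with rfl | ⟨y, -, V, A, hc, -, h⟩
  · refine ⟨B, ∅, ⟨hB.1, empty_subset _, finite_empty, fun W hW h => ?_⟩, fun b => ⟨?_, ?_⟩⟩
    · have : W = B := by
        refine Subset.antisymm (fun a ha => ?_) (by simpa using h)
        by_contra hb
        exact hW.compl_mem_iff.1 (h ⟨hB.1.compl_mem_iff.2 hb, notMem_empty _⟩) ha
      rwa [this]
    · simp [vertexPoint]
    · simp
  · exact ⟨V, A, hc, h⟩

/-- The fractional ultrafilter of a point of the component. -/
noncomputable def Fractional.ofPoint (hB : IsUltra B) (x : B → ℝ) (hx : x ∈ dualComponent B) :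
    Fractional B where
  toFun := degree B x
  nonneg a := by
    obtain ⟨V, A, -, h⟩ := exists_cube_of_mem hB hx
    exact (degree_mem h a).1
  map_compl := degree_compl hB.1 x
  nested a b hab := by
    obtain ⟨V, A, hc, h⟩ := exists_cube_of_mem hB hx
    exact degree_nested hB.1 hc h hab
  finite := by
    refine ((finite_dualComponent hx).image Subtype.val).subset fun b hb => ?_
    refine ⟨⟨b, hb.1⟩, ?_, rfl⟩
    have := hb.2
    simp only [degree, hb.1, dif_pos] at this
    simp only [vertexPoint, hb.1, if_true, mem_ofPred_eq]
    intro h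
    exact this (by rw [← h]; simp)

theorem Fractional.ofPoint_point (hB : IsUltra B) (x : B → ℝ) (hx : x ∈ dualComponent B) :
    (Fractional.ofPoint hB x hx).point = x := by
  ext b
  simp [Fractional.point, Fractional.ofPoint, degree]

/-- In a common cube, no two nested walls vary. -/
theorem eq_or_eq_of_inCommonCube (hB : IsSelection B) {V A : Set P} (hc : IsCube V A)
    {μ ν : Fractional B} (hμ : μ.point ∈ unitCube B V A) (hν : ν.point ∈ unitCube B V A)
    {a b : P} (hab : a < b) : μ a = ν a ∨ μ b = ν b := by
  have hd : ∀ (κ : Fractional B) (c : P), degree B κ.point c = κ c := by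
    intro κ c
    by_cases h : c ∈ B
    · simp [degree, h, Fractional.point]
    · have h' := hB.compl_mem_iff.2 h
      simp [degree, h, h', Fractional.point, κ.map_compl]
  -- Nestedness is applied to the midpoint: an average of degrees is 0 or 1 only if both degrees
  -- are.
  have hm : (fun c => (μ.point c + ν.point c) / 2) ∈ unitCube B V A := by
    intro b
    obtain ⟨⟨h1, h2⟩, h3⟩ := hμ b
    obtain ⟨⟨h4, h5⟩, h6⟩ := hν b
    refine ⟨⟨by linarith, by linarith⟩, fun h h' => ?_⟩
    simp only [h3 h h', h6 h h']
    ring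
  have hd' : ∀ c, degree B (fun c => (μ.point c + ν.point c) / 2) c = (μ c + ν c) / 2 := by
    intro c
    rw [← hd μ, ← hd ν]
    unfold degree
    split_ifs <;> ring
  have m0 := μ.nonneg a
  have n0 := ν.nonneg a
  have m1 := μ.le_one b
  have n1 := ν.le_one b
  rcases degree_nested hB hc hm hab with h | h <;> rw [hd'] at h
  · left; linarith
  · right; linarith

end Degree

end Fractional

/-! ### Distances as chain sums -/

section Chains

variable {P : Type*} [PocSet P]

theorem chain_induction {Q : Type*} [PartialOrder Q] [DecidableEq Q] {p : Finset Q → Prop}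
    (h0 : p ∅)
    (h : ∀ (C : Finset Q) (m : Q), (∀ c ∈ C, c < m) → p C → p (insert m C)) (C : Finset Q)
    (hC : IsChain (· ≤ ·) (C : Set Q)) : p C := by
  induction C using Finset.strongInduction with
  | H C ih =>
  rcases C.eq_empty_or_nonempty with rfl | hne
  · exact h0
  · obtain ⟨m, hm⟩ := C.exists_maximal hne
    rw [← Finset.insert_erase hm.prop]
    refine h _ m (fun c hc => ?_) (ih _ (Finset.erase_ssubset hm.prop)
      (hC.mono (by simp)))
    have hc' := Finset.mem_of_mem_erase hc
    have hne := Finset.ne_of_mem_erase hc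
    rcases hC hc' hm.prop hne with h | h
    · exact lt_of_le_of_ne h hne
    · exact absurd (lt_of_le_of_ne h hne.symm) (hm.not_gt hc')

/-- If the intervals `[τ c, τ c + f c]` occur in the order of a chain, then their total length is
bounded by the length of an interval that contains them. -/
theorem sum_chain_le {Q : Type*} [PartialOrder Q] {C : Finset Q}
    (hC : IsChain (· ≤ ·) (C : Set Q)) (τ f : Q → ℝ) (lo hi : ℝ)
    (hτ : ∀ c ∈ C, ∀ d ∈ C, c < d → τ c + f c ≤ τ d) (hlo : ∀ c ∈ C, lo ≤ τ c)
    (hhi : ∀ c ∈ C, τ c + f c ≤ hi) (h : lo ≤ hi) : ∑ c ∈ C, f c ≤ hi - lo := by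
  classical
  have key : ∀ C : Finset Q, IsChain (· ≤ ·) (C : Set Q) →
      (∀ c ∈ C, ∀ d ∈ C, c < d → τ c + f c ≤ τ d) → (∀ c ∈ C, lo ≤ τ c) →
      ∀ hi, lo ≤ hi → (∀ c ∈ C, τ c + f c ≤ hi) → ∑ c ∈ C, f c ≤ hi - lo := by
    intro C hC
    refine chain_induction (p := fun C => (∀ c ∈ C, ∀ d ∈ C, c < d → τ c + f c ≤ τ d) →
      (∀ c ∈ C, lo ≤ τ c) → ∀ hi, lo ≤ hi → (∀ c ∈ C, τ c + f c ≤ hi) →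
      ∑ c ∈ C, f c ≤ hi - lo) ?_ (fun C m hm ih => ?_) C hC
    · intro _ _ hi h _
      simpa using h
    · intro hτ hlo hi h hhi
      -- All intervals below `m` end by time `τ m`, which takes the role of `hi` for the shorter
      -- chain.
      have h1 := ih (fun c hc d hd => hτ c (by simp [hc]) d (by simp [hd]))
        (fun c hc => hlo c (by simp [hc])) (τ m) (hlo m (by simp))
        (fun c hc => hτ c (by simp [hc]) m (by simp) (hm c hc))
      have h2 := hhi m (by simp)
      rw [Finset.sum_insert fun h => lt_irrefl _ (hm m h)]
      linarith
  exact key C hC hτ hlo hi h hhi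

/-- For a move within one cube: at most one term of a chain sum changes. -/
theorem abs_sum_le_of_unique {ι : Type*} (C : Finset ι) (f : ι → ℝ) {K : ℝ} (hK : 0 ≤ K)
    (h : ∀ a ∈ C, |f a| ≤ K) (h' : ∀ a ∈ C, ∀ b ∈ C, a ≠ b → f a = 0 ∨ f b = 0) :
    |∑ a ∈ C, f a| ≤ K := by
  by_cases hz : ∀ a ∈ C, f a = 0
  · rwa [Finset.sum_eq_zero hz, abs_zero]
  · push Not at hz
    obtain ⟨a, ha, hne⟩ := hz
    rw [Finset.sum_eq_single_of_mem a ha fun b hb hba =>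
      (h' a ha b hb hba.symm).resolve_left hne]
    exact h a ha

variable {B : Set P}

namespace Fractional

open Classical in
/-- Lower the degrees of the elements to be dropped to prescribed values. -/
noncomputable def dropTo (μ ν : Fractional B) (r : P → ℝ)
    (h1 : ∀ a ∈ drop μ ν, ν a ≤ r a) (h2 : ∀ a ∈ drop μ ν, r a ≤ μ a)
    (h : ∀ a b, a < b → a ∈ drop μ ν → b ∈ drop μ ν → r b < μ b → r a = ν a) :
    Fractional B :=
  between μ ν (fun a => if a ∈ drop μ ν then r a else if aᶜ ∈ drop μ ν then 1 - r aᶜ else μ a)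
    (fun a => by
      simp only [compl_invol]
      have : a ∈ drop μ ν → aᶜ ∉ drop μ ν := by
        rw [compl_mem_drop]
        exact fun h h' => lt_asymm (a := ν a) (b := μ a) h h'
      have := μ.map_compl a
      split_ifs <;> first | linarith | (exfalso; tauto))
    (fun a => by
      have e1 := h1 a
      have e2 := h2 aᶜ
      have := μ.map_compl a
      have := ν.map_compl a
      split_ifs with i1 i2
      · exact (min_le_right _ _).trans (e1 i1)
      · exact (min_le_left _ _).trans (by linarith [e2 i2])
      · exact min_le_left _ _)
    (fun a => by
      have e1 := h2 a
      have e2 := h1 aᶜ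
      have := μ.map_compl a
      have := ν.map_compl a
      split_ifs with i1 i2
      · exact (e1 i1).trans (le_max_left _ _)
      · exact le_trans (by linarith [e2 i2]) (le_max_right _ _)
      · exact le_max_left _ _)
    (fun a b hab ha hb => by
      simp only [ha, hb, if_true]
      exact h a b hab ha hb)

section dropTo

variable {μ ν : Fractional B} {r : P → ℝ} {h1 : ∀ a ∈ drop μ ν, ν a ≤ r a}
  {h2 : ∀ a ∈ drop μ ν, r a ≤ μ a}
  {h : ∀ a b, a < b → a ∈ drop μ ν → b ∈ drop μ ν → r b < μ b → r a = ν a}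

theorem dropTo_of_mem {a : P} (ha : a ∈ drop μ ν) : dropTo μ ν r h1 h2 h a = r a :=
  if_pos ha

theorem dropTo_of_notMem {a : P} (ha : a ∉ drop μ ν) (ha' : aᶜ ∉ drop μ ν) :
    dropTo μ ν r h1 h2 h a = μ a :=
  (if_neg ha).trans (if_neg ha')

theorem drop_dropTo_left : drop μ (dropTo μ ν r h1 h2 h) ⊆ drop μ ν := by
  intro a ha
  by_contra hn
  have hd : dropTo μ ν r h1 h2 h a < μ a := ha
  by_cases hc : aᶜ ∈ drop μ ν
  · have e := (dropTo μ ν r h1 h2 h).map_compl a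
    rw [dropTo_of_mem hc] at e
    have := h2 _ hc
    rw [μ.map_compl] at this
    linarith
  · rw [dropTo_of_notMem hn hc] at hd
    exact lt_irrefl _ hd

theorem drop_dropTo_right : drop (dropTo μ ν r h1 h2 h) ν ⊆ drop μ ν := by
  intro a ha
  by_contra hn
  have hd : ν a < dropTo μ ν r h1 h2 h a := ha
  by_cases hc : aᶜ ∈ drop μ ν
  · have e := (dropTo μ ν r h1 h2 h).map_compl a
    rw [dropTo_of_mem hc] at e
    have := h1 _ hc
    rw [ν.map_compl] at this
    linarith
  · rw [dropTo_of_notMem hn hc] at hd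
    exact hn hd

end dropTo

/-- The point of the weighted dual given by a fractional ultrafilter. -/
def toDual (hB : IsUltra B) (w : Weight P) (μ : Fractional B) : WeightedDual w B :=
  ⟨diag w B μ.point, mem_image_of_mem _ (μ.point_mem hB)⟩

theorem toDual_apply (hB : IsUltra B) (w : Weight P) (μ : Fractional B) (b : B) :
    (μ.toDual hB w).1 b = w b * (1 - μ b) := rfl

theorem exists_toDual (hB : IsUltra B) {w : Weight P} (x : WeightedDual w B) :
    ∃ μ : Fractional B, μ.toDual hB w = x := by
  obtain ⟨_, x', hx, rfl⟩ := x
  exact ⟨ofPoint hB x' hx, Subtype.ext (by simp [toDual, ofPoint_point])⟩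

theorem abs_coord_eq (hB : IsUltra B) (w : Weight P) (μ ν : Fractional B) (b : B) :
    |(μ.toDual hB w).1 b - (ν.toDual hB w).1 b| = w b * |μ b - ν b| := by
  rw [toDual_apply, toDual_apply, ← mul_sub, abs_mul, abs_of_nonneg (w.nonneg _), abs_sub_comm]
  congr 2
  ring

/-- A rising element is the complement of a dropping one, so it suffices to control the latter. -/
theorem abs_le_of_drop (w : Weight P) {μ ν : Fractional B} {s : ℝ} (hs : 0 ≤ s)
    (h : ∀ a ∈ drop μ ν, w a * (μ a - ν a) ≤ s) (a : P) : w a * |μ a - ν a| ≤ s := by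
  have hw := w.nonneg a
  rcases lt_trichotomy (μ a) (ν a) with h' | h' | h'
  · have := h aᶜ (compl_mem_drop.2 h')
    rw [w.map_compl, μ.map_compl, ν.map_compl] at this
    rw [abs_of_neg (by linarith)]
    linarith
  · simpa [h'] using hs
  · rw [abs_of_pos (by linarith)]
    exact h a h'

theorem abs_le_supDist (hB : IsUltra B) (w : Weight P) (μ ν : Fractional B) (a : P) :
    w a * |μ a - ν a| ≤ supDist (μ.toDual hB w) (ν.toDual hB w) := by
  by_cases h : a ∈ B
  · have := le_supDist (μ.toDual hB w) (ν.toDual hB w) ⟨a, h⟩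
    rwa [abs_coord_eq] at this
  · have := le_supDist (μ.toDual hB w) (ν.toDual hB w) ⟨aᶜ, hB.1.compl_mem_iff.2 h⟩
    rw [abs_coord_eq] at this
    simp only [w.map_compl, μ.map_compl, ν.map_compl] at this
    rw [abs_sub_comm] at this
    convert this using 3
    ring

theorem supDist_le (hB : IsUltra B) (w : Weight P) {μ ν : Fractional B} {s : ℝ} (hs : 0 ≤ s)
    (h : ∀ a ∈ drop μ ν, w a * (μ a - ν a) ≤ s) :
    supDist (μ.toDual hB w) (ν.toDual hB w) ≤ s := by
  refine Real.iSup_le (fun b => ?_) hs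
  rw [abs_coord_eq]
  exact abs_le_of_drop w hs h b

theorem shareCube (hB : IsUltra B) (w : Weight P) {μ ν κ : Fractional B}
    (h : ∀ a, μ a + ν a = 2 * κ a) : ShareCube (μ.toDual hB w) (ν.toDual hB w) := by
  obtain ⟨V, A, hc, hA⟩ := exists_cube hB.1 κ
  have hμ := hA μ ν h
  refine ⟨V, A, hc, fun x hx => ?_, mem_image_of_mem _ hμ,
    mem_image_of_mem _ (hA ν μ fun a => by rw [add_comm, h])⟩
  exact Relation.ReflTransGen.tail (μ.point_mem hB) ⟨V, A, hc, hμ, hx⟩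

theorem toDual_eq (hB : IsUltra B) {w : Weight P} {μ ν : Fractional B}
    (h : ∀ a ∈ B, w a * μ a = w a * ν a) : μ.toDual hB w = ν.toDual hB w := by
  refine Subtype.ext (funext fun b => ?_)
  rw [toDual_apply, toDual_apply, mul_sub, mul_sub, h b b.2]

end Fractional

open Fractional

open Classical in
/-- The weighted degrees of a point of the weighted dual. -/
noncomputable def wdegree {w : Weight P} (x : WeightedDual w B) (a : P) : ℝ :=
  if h : a ∈ B then w a - x.1 ⟨a, h⟩ else if h : aᶜ ∈ B then x.1 ⟨aᶜ, h⟩ else 0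

theorem wdegree_toDual (hB : IsUltra B) (w : Weight P) (μ : Fractional B) (a : P) :
    wdegree (μ.toDual hB w) a = w a * μ a := by
  by_cases h : a ∈ B
  · simp only [wdegree, h, dif_pos, toDual_apply]
    ring
  · have h' := hB.1.compl_mem_iff.2 h
    simp only [wdegree, h, h', dif_pos, dif_neg, not_false_iff, toDual_apply, w.map_compl,
      μ.map_compl]
    ring

/-- Nested walls do not vary together in a cube, so each step of a broken path changes a chain sum
by at most one coordinate difference, hence by at most its length. -/
theorem HasBrokenPath.abs_chain_sum_le (hB : IsUltra B) {w : Weight P} {x y : WeightedDual w B}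
    {L : ℝ} (h : HasBrokenPath x y L) {C : Finset P} (hC : IsChain (· ≤ ·) (C : Set P)) :
    |∑ a ∈ C, wdegree x a - ∑ a ∈ C, wdegree y a| ≤ L := by
  induction h with
  | nil => simp
  | cons x y z L hs _ ih =>
    refine (abs_sub_le _ (∑ a ∈ C, wdegree y a) _).trans (add_le_add ?_ ih)
    obtain ⟨V, A, hc, hsub, ⟨x', hx, hx'⟩, ⟨y', hy, hy'⟩⟩ := hs
    let μ := ofPoint hB x' (hsub hx)
    let ν := ofPoint hB y' (hsub hy)
    have hμ : μ.toDual hB w = x := Subtype.ext (by simp [toDual, μ, ofPoint_point, hx'])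
    have hν : ν.toDual hB w = y := Subtype.ext (by simp [toDual, ν, ofPoint_point, hy'])
    rw [← hμ, ← hν, ← Finset.sum_sub_distrib]
    simp only [wdegree_toDual]
    refine abs_sum_le_of_unique _ _ (supDist_nonneg _ _) (fun a _ => ?_) fun a ha b hb hab => ?_
    · rw [← mul_sub, abs_mul, abs_of_nonneg (w.nonneg a)]
      exact abs_le_supDist hB w μ ν a
    · have key : ∀ a b, a < b → μ a = ν a ∨ μ b = ν b := fun a b hab =>
        eq_or_eq_of_inCommonCube hB.1 hc (by rwa [ofPoint_point]) (by rwa [ofPoint_point]) hab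
      rcases hC ha hb hab with h | h
      · exact (key a b (lt_of_le_of_ne h hab)).imp (fun h => by rw [h, sub_self])
          fun h => by rw [h, sub_self]
      · exact (key b a (lt_of_le_of_ne h hab.symm)).symm.imp (fun h => by rw [h, sub_self])
          fun h => by rw [h, sub_self]

theorem abs_chain_sum_le_ellInf (hB : IsUltra B) (w : Weight P) (μ ν : Fractional B)
    {C : Finset P} (hC : IsChain (· ≤ ·) (C : Set P)) :
    |∑ a ∈ C, w a * (μ a - ν a)| ≤ ellInf (μ.toDual hB w) (ν.toDual hB w) := by
  refine le_csInf (exists_path _ _) fun L hL => ?_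
  have := hL.abs_chain_sum_le hB hC
  simp only [wdegree_toDual, ← Finset.sum_sub_distrib, ← mul_sub] at this
  exact this

/-- Greedy construction. The minimal elements of `drop μ ν` may all be lowered at once inside one
cube. If each loses the weighted length `s`, the bound on chain sums decreases by `s`, because every
remaining chain can be prolonged downwards by a minimal element. The induction is on the number of
elements to be dropped. -/
theorem exists_path_le_of_chain (hB : IsUltra B) (w : Weight P) (μ ν : Fractional B) {M : ℝ}
    (h : ∀ C : Finset P, IsChain (· ≤ ·) (C : Set P) → (C : Set P) ⊆ drop μ ν →
      ∑ a ∈ C, w a * (μ a - ν a) ≤ M) :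
    ∃ L ≤ M, HasBrokenPath (μ.toDual hB w) (ν.toDual hB w) L := by
  classical
  obtain ⟨k, hk⟩ : ∃ k, (finite_drop hB.1 μ ν).toFinset.card = k := ⟨_, rfl⟩
  induction k using Nat.strong_induction_on generalizing μ M with
  | _ k ih =>
  rcases (finite_drop hB.1 μ ν).toFinset.eq_empty_or_nonempty with he | hne
  · have e : drop μ ν = ∅ := by simpa using he
    have : μ.toDual hB w = ν.toDual hB w := toDual_eq hB fun a _ => by
      have h1 : a ∉ drop μ ν := by simp [e]
      have h2 : aᶜ ∉ drop μ ν := by simp [e]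
      rw [compl_mem_drop] at h2
      simp only [drop, mem_ofPred_eq, not_lt] at h1 h2
      rw [le_antisymm h1 h2]
    exact ⟨0, by simpa using h ∅, this ▸ .nil _⟩
  · let D := (finite_drop hB.1 μ ν).toFinset
    have hD : ∀ a, a ∈ D ↔ a ∈ drop μ ν := by simp [D]
    let N := D.filter (Minimal (· ∈ D))
    have hmin : ∀ a ∈ D, ∃ m ∈ N, m ≤ a := by
      intro a ha
      obtain ⟨m, hma, hm⟩ := D.exists_le_minimal ha
      exact ⟨m, by simp [N, hm, hm.prop], hma⟩
    have hN : N.Nonempty := by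
      obtain ⟨a, ha⟩ := hne
      obtain ⟨m, hm, -⟩ := hmin a ha
      exact ⟨m, hm⟩
    -- `s` is the least weighted length of a minimal element; `a₀` is used up by the step, so the
    -- induction advances.
    obtain ⟨a₀, ha₀, hs⟩ := N.exists_min_image (fun a => w a * (μ a - ν a)) hN
    set s := w a₀ * (μ a₀ - ν a₀) with hsdef
    have hND : ∀ a ∈ N, a ∈ D := fun a ha => (Finset.mem_filter.1 ha).1
    have hpos : ∀ a ∈ D, ν a < μ a := fun a ha => (hD a).1 ha
    have hs0 : 0 ≤ s := mul_nonneg (w.nonneg _) (sub_nonneg.2 (hpos _ (hND _ ha₀)).le)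
    -- A minimal element of weight zero is dropped entirely; its presence forces `s = 0`, so no
    -- length is lost.
    let r : P → ℝ := fun a => if a ∈ N then (if w a = 0 then ν a else μ a - s / w a) else μ a
    have hr1 : ∀ a ∈ drop μ ν, ν a ≤ r a := by
      intro a ha
      simp only [r]
      split_ifs with i1 i2
      · exact le_rfl
      · have hw := lt_of_le_of_ne (w.nonneg a) (Ne.symm i2)
        have := (div_le_iff₀ hw).2 ((hs a i1).trans (le_of_eq (mul_comm _ _)))
        linarith
      · exact le_of_lt ha
    have hr2 : ∀ a ∈ drop μ ν, r a ≤ μ a := by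
      intro a ha
      simp only [r]
      split_ifs with i1 i2
      · exact le_of_lt ha
      · have := div_nonneg hs0 (w.nonneg a)
        linarith
      · exact le_rfl
    have hr3 : ∀ a b, a < b → a ∈ drop μ ν → b ∈ N → False := by
      intro a b hab ha hb
      exact (Finset.mem_filter.1 hb).2.not_lt ((hD a).2 ha) hab
    have hr3' : ∀ a b, a < b → a ∈ drop μ ν → r b = μ b := by
      intro a b hab ha
      simp only [r]
      rw [if_neg fun hb => hr3 a b hab ha hb]
    have hwr : ∀ a ∈ N, w a * r a = w a * μ a - s := by
      intro a ha
      simp only [r, ha, if_true]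
      split_ifs with i
      · have : s ≤ 0 := by simpa [i] using hs a ha
        rw [i]
        linarith
      · field_simp
    let ρ := dropTo μ ν r hr1 hr2 fun a b hab ha hb hlt =>
      absurd (hr3' a b hab ha) hlt.ne
    -- The midpoint of μ and ρ, which exhibits the cube that contains both.
    let κ := dropTo μ ν (fun a => (μ a + r a) / 2)
      (fun a ha => by have := hr1 a ha; have : ν a < μ a := ha; linarith)
      (fun a ha => by have := hr2 a ha; linarith)
      fun a b hab ha hb hlt => absurd (hr3' a b hab ha) (by intro h; linarith)
    have hκ : ∀ a, μ a + ρ a = 2 * κ a := by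
      intro a
      by_cases i1 : a ∈ drop μ ν
      · simp only [ρ, κ, dropTo_of_mem i1]
        ring
      · by_cases i2 : aᶜ ∈ drop μ ν
        · have e1 := ρ.map_compl a
          have e2 := κ.map_compl a
          have e3 := μ.map_compl a
          rw [dropTo_of_mem i2] at e1 e2
          linarith
        · simp only [ρ, κ, dropTo_of_notMem i1 i2]
          ring
    have hdρ : drop ρ ν ⊆ drop μ ν := drop_dropTo_right
    have hlt : (finite_drop hB.1 ρ ν).toFinset.card < k := by
      rw [← hk]
      refine Finset.card_lt_card (Finset.ssubset_iff_of_subset (by simpa using hdρ) |>.2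
        ⟨a₀, hND _ ha₀, ?_⟩)
      have e : ρ a₀ = r a₀ := dropTo_of_mem ((hD _).1 (hND _ ha₀))
      have : r a₀ = ν a₀ := by
        simp only [r, ha₀, if_true]
        split_ifs with i
        · rfl
        · rw [hsdef]
          field_simp
          ring
      simp [drop, e, this]
    -- A nonempty chain is prolonged by a minimal `m`, whose term decreases by `s`. For the empty
    -- chain `s ≤ M` is needed, which the chain `{a₀}` provides.
    obtain ⟨L, hL, hp⟩ := ih _ hlt ρ (M := M - s) (fun C hC hsub => by
      rcases C.eq_empty_or_nonempty with rfl | hne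
      · have := h {a₀} (by simp) (by simpa using (hD _).1 (hND _ ha₀))
        simpa [← hsdef] using this
      obtain ⟨c, hc⟩ := C.exists_minimal hne
      obtain ⟨m, hm, hmc⟩ := hmin c ((hD c).2 (hdρ (hsub hc.prop)))
      have hmD := (hD m).1 (hND m hm)
      have hle : ∀ d ∈ C, m ≤ d := by
        intro d hd
        refine hmc.trans ?_
        by_cases e : c = d
        · exact e.le
        · exact (hC hc.prop hd e).elim id fun h => hc.le_of_le hd h
      have hC' : IsChain (· ≤ ·) ((insert m C : Finset P) : Set P) := by
        rw [Finset.coe_insert]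
        exact hC.insert fun b hb _ => Or.inl (hle b hb)
      have hsub' : ((insert m C : Finset P) : Set P) ⊆ drop μ ν := by
        rw [Finset.coe_insert]
        exact insert_subset hmD (hsub.trans hdρ)
      have h1 := h _ hC' hsub'
      have h2 : ∑ a ∈ C, w a * (ρ a - ν a) ≤ ∑ a ∈ insert m C, w a * (ρ a - ν a) := by
        refine Finset.sum_le_sum_of_subset_of_nonneg (Finset.subset_insert _ _) fun a ha _ => ?_
        have haD := hsub' ha
        refine mul_nonneg (w.nonneg a) (sub_nonneg.2 ?_)
        exact (hr1 a haD).trans (dropTo_of_mem haD).ge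
      have h3 : ∑ a ∈ insert m C, w a * (ρ a - ν a) ≤
          ∑ a ∈ insert m C, (w a * (μ a - ν a) - if a = m then s else 0) := by
        refine Finset.sum_le_sum fun a ha => ?_
        have haD := hsub' ha
        have e : ρ a = r a := dropTo_of_mem haD
        rw [e]
        split_ifs with i
        · have := hwr m hm
          rw [i]
          linarith
        · have := mul_le_mul_of_nonneg_left (hr2 a haD) (w.nonneg a)
          linarith
      rw [Finset.sum_sub_distrib, Finset.sum_ite_eq' (insert m C) m (fun _ => s),
        if_pos (Finset.mem_insert_self _ _)] at h3
      linarith) rfl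
    refine ⟨supDist (μ.toDual hB w) (ρ.toDual hB w) + L, ?_, .cons _ _ _ _ (shareCube hB w hκ) hp⟩
    have : supDist (μ.toDual hB w) (ρ.toDual hB w) ≤ s := by
      refine supDist_le hB w hs0 fun a ha => ?_
      have haD : a ∈ drop μ ν := drop_dropTo_left ha
      have e : ρ a = r a := dropTo_of_mem haD
      rw [e, mul_sub]
      by_cases i : a ∈ N
      · rw [hwr a i]
        linarith
      · simp only [r, i, if_false]
        linarith
    linarith

theorem ellInf_le_of_chain (hB : IsUltra B) (w : Weight P) (μ ν : Fractional B) {M : ℝ}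
    (h : ∀ C : Finset P, IsChain (· ≤ ·) (C : Set P) → (C : Set P) ⊆ drop μ ν →
      ∑ a ∈ C, w a * (μ a - ν a) ≤ M) :
    ellInf (μ.toDual hB w) (ν.toDual hB w) ≤ M := by
  obtain ⟨L, hL, hp⟩ := exists_path_le_of_chain hB w μ ν h
  exact (csInf_le (bddBelow_paths _ _) hp).trans hL

theorem ellOne_eq_sum (hB : IsUltra B) (w : Weight P) (μ ν : Fractional B) (F : Finset P)
    (hF : ∀ a ∈ F, a ∈ B) (h : ∀ a ∈ B, μ a ≠ ν a → a ∈ F) :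
    ellOne (μ.toDual hB w) (ν.toDual hB w) = ∑ a ∈ F, w a * |μ a - ν a| := by
  classical
  unfold ellOne
  simp only [abs_coord_eq]
  rw [tsum_eq_sum (s := F.subtype (· ∈ B)) fun b hb => by
    by_contra hne
    refine hb (Finset.mem_subtype.2 (h b b.2 fun e => hne ?_))
    rw [e, sub_self, abs_zero, mul_zero]]
  rw [Finset.sum_subtype_of_mem (fun a => w a * |μ a - ν a|) hF]

theorem exists_support (μ ν : Fractional B) :
    ∃ F : Finset P, (∀ a ∈ F, a ∈ B) ∧ ∀ a ∈ B, μ a ≠ ν a → a ∈ F := by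
  classical
  refine ⟨μ.finite.toFinset ∪ ν.finite.toFinset, fun a ha => ?_, fun a ha hne => ?_⟩
  · simp only [Finset.mem_union, Finite.mem_toFinset, mem_ofPred_eq] at ha
    exact ha.elim (·.1) (·.1)
  · by_contra h
    simp only [Finset.mem_union, Finite.mem_toFinset, mem_ofPred_eq, ha, true_and, not_or,
      not_not] at h
    exact hne (h.1.trans h.2.symm)

/-- The distance of two fractional ultrafilters in the weighted dual. -/
noncomputable def pdist (p : Ell) (hB : IsUltra B) (w : Weight P) (μ ν : Fractional B) : ℝ :=
  dist (α := Cubing p w B) (μ.toDual hB w) (ν.toDual hB w)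

theorem pdist_one (hB : IsUltra B) (w : Weight P) (μ ν : Fractional B) :
    pdist .one hB w μ ν = ellOne (μ.toDual hB w) (ν.toDual hB w) := rfl

theorem pdist_infty (hB : IsUltra B) (w : Weight P) (μ ν : Fractional B) :
    pdist .infty hB w μ ν = ellInf (μ.toDual hB w) (ν.toDual hB w) := rfl

theorem pdist_nonneg (p : Ell) (hB : IsUltra B) (w : Weight P) (μ ν : Fractional B) :
    0 ≤ pdist p hB w μ ν := dist_nonneg

theorem pdist_comm (p : Ell) (hB : IsUltra B) (w : Weight P) (μ ν : Fractional B) :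
    pdist p hB w μ ν = pdist p hB w ν μ := dist_comm _ _

theorem pdist_triangle (p : Ell) (hB : IsUltra B) (w : Weight P) (μ ν κ : Fractional B) :
    pdist p hB w μ κ ≤ pdist p hB w μ ν + pdist p hB w ν κ := dist_triangle _ _ _

theorem abs_coord_le_ellInf (hB : IsUltra B) (w : Weight P) (μ ν : Fractional B) (a : P) :
    w a * |μ a - ν a| ≤ ellInf (μ.toDual hB w) (ν.toDual hB w) := by
  have := abs_chain_sum_le_ellInf hB w μ ν (C := {a}) (by simp)
  simpa [abs_mul, abs_of_nonneg (w.nonneg a)] using this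

/-- A chain has at most one element of each wall, and so a chain sum is bounded by the `ℓ^1`
distance. -/
theorem chain_sum_abs_le_ellOne (hB : IsUltra B) (w : Weight P) (μ ν : Fractional B)
    {C : Finset P} (hC : IsChain (· ≤ ·) (C : Set P)) :
    ∑ a ∈ C, w a * |μ a - ν a| ≤ ellOne (μ.toDual hB w) (ν.toDual hB w) := by
  classical
  obtain ⟨F, hF, hF'⟩ := exists_support μ ν
  rw [ellOne_eq_sum hB w μ ν F hF hF']
  let g : P → P := fun a => if a ∈ B then a else aᶜ
  have hg : ∀ a, w (g a) * |μ (g a) - ν (g a)| = w a * |μ a - ν a| := by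
    intro a
    simp only [g]
    split_ifs
    · rfl
    · rw [w.map_compl, μ.map_compl, ν.map_compl, abs_sub_comm]
      congr 2
      ring
  have hgB : ∀ a, g a ∈ B := by
    intro a
    simp only [g]
    split_ifs with h
    · exact h
    · exact hB.1.compl_mem_iff.2 h
  -- A chain that contains `a` and `aᶜ` forces one of them to be `⊥`; so a chain meets each wall at
  -- most once.
  have hinj : Set.InjOn g {a ∈ C | a ≠ ⊥ ∧ a ≠ ⊥ᶜ} := by
    have hcc : ∀ a ∈ C, a ≠ ⊥ → a ≠ ⊥ᶜ → aᶜ ∉ C := by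
      intro a ha h0 h1 ha'
      have hne : a ≠ aᶜ := fun e => h0 (eq_bot_of_le a e.le)
      rcases hC ha ha' hne with h | h
      · exact h0 (eq_bot_of_le a h)
      · exact h1 (compl_eq_bot.1 (eq_bot_of_le aᶜ (by rwa [compl_invol])))
    rintro a ⟨ha, ha0, ha1⟩ b ⟨hb, hb0, hb1⟩ hab
    simp only [g] at hab
    split_ifs at hab
    · exact hab
    · exact absurd hb (by rw [← compl_invol b, ← hab]; exact hcc a ha ha0 ha1)
    · exact absurd ha (by rw [← compl_invol a, hab]; exact hcc b hb hb0 hb1)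
    · exact compl_eq_compl hab
  -- The improper elements are not covered by injectivity, but their degrees are constant and their
  -- terms vanish.
  have hbot : μ ⊥ = ν ⊥ := by
    have hne : (⊥ : P) ≠ ⊥ᶜ := fun e => hB.1.compl_mem_iff.not.2
      (fun h => by have := @hB.1.compl_mem_iff _ _ _ (⊥ : P); rw [← e] at this; tauto)
      (by by_contra h; have := @hB.1.compl_mem_iff _ _ _ (⊥ : P); rw [← e] at this; tauto)
    have key : ∀ κ : Fractional B, κ ⊥ = 0 := fun κ => by
      have := κ.nested _ _ (lt_of_le_of_ne bot_le hne)
      have := κ.map_compl ⊥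
      rcases κ.nested _ _ (lt_of_le_of_ne bot_le hne) with h | h
      · exact h
      · linarith
    rw [key, key]
  have htop : μ ⊥ᶜ = ν ⊥ᶜ := by rw [μ.map_compl, ν.map_compl, hbot]
  calc ∑ a ∈ C, w a * |μ a - ν a|
      = ∑ a ∈ C.filter (fun a => μ a ≠ ν a), w a * |μ a - ν a| := by
        rw [Finset.sum_filter]
        refine Finset.sum_congr rfl fun a _ => ?_
        split_ifs with h
        · rfl
        · rw [not_not.1 h, sub_self, abs_zero, mul_zero]
    _ = ∑ a ∈ (C.filter (fun a => μ a ≠ ν a)).image g, w a * |μ a - ν a| := by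
        rw [Finset.sum_image]
        · exact Finset.sum_congr rfl fun a _ => (hg a).symm
        · refine hinj.mono fun a ha => ?_
          have ha' := Finset.mem_filter.1 ha
          exact ⟨ha'.1, fun e => ha'.2 (e ▸ hbot), fun e => ha'.2 (e ▸ htop)⟩
    _ ≤ _ := by
        refine Finset.sum_le_sum_of_subset_of_nonneg (fun a ha => ?_) fun a _ _ =>
          mul_nonneg (w.nonneg a) (abs_nonneg _)
        obtain ⟨c, hc, rfl⟩ := Finset.mem_image.1 ha
        refine hF' _ (hgB c) fun e => (Finset.mem_filter.1 hc).2 ?_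
        simp only [g] at e
        split_ifs at e
        · exact e
        · rw [μ.map_compl, ν.map_compl] at e
          linarith

theorem ellInf_le_ellOne (hB : IsUltra B) (w : Weight P) (μ ν : Fractional B) :
    ellInf (μ.toDual hB w) (ν.toDual hB w) ≤ ellOne (μ.toDual hB w) (ν.toDual hB w) := by
  refine ellInf_le_of_chain hB w μ ν fun C hC _ => ?_
  refine le_trans (Finset.sum_le_sum fun a _ => ?_) (chain_sum_abs_le_ellOne hB w μ ν hC)
  exact mul_le_mul_of_nonneg_left (le_abs_self _) (w.nonneg a)

theorem ellInf_le_pdist (p : Ell) (hB : IsUltra B) (w : Weight P) (μ ν : Fractional B) :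
    ellInf (μ.toDual hB w) (ν.toDual hB w) ≤ pdist p hB w μ ν := by
  cases p
  · exact ellInf_le_ellOne hB w μ ν
  · exact le_rfl

/-- The coefficients |μ(a) - ν(a)|, or μ(a) - ν(a) along a chain in `drop μ ν`, are nonnegative and
do not depend on the weight, so the sums that compute the distances can be compared term by term. -/
theorem pdist_le_add (p : Ell) (hB : IsUltra B) {w w₁ w₂ : Weight P} {c : ℝ} (hc : 0 ≤ c)
    (h : ∀ a, w a ≤ w₁ a + c * w₂ a) (μ ν : Fractional B) :
    pdist p hB w μ ν ≤ pdist p hB w₁ μ ν + c * pdist p hB w₂ μ ν := by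
  cases p
  · obtain ⟨F, hF, hF'⟩ := exists_support μ ν
    simp only [pdist_one, ellOne_eq_sum hB _ μ ν F hF hF']
    rw [Finset.mul_sum, ← Finset.sum_add_distrib]
    refine Finset.sum_le_sum fun a _ => ?_
    have := mul_le_mul_of_nonneg_right (h a) (abs_nonneg (μ a - ν a))
    linarith
  · simp only [pdist_infty]
    refine ellInf_le_of_chain hB w μ ν fun C hC hsub => ?_
    have h1 := (le_abs_self _).trans (abs_chain_sum_le_ellInf hB w₁ μ ν hC)
    have h2 := (le_abs_self _).trans (abs_chain_sum_le_ellInf hB w₂ μ ν hC)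
    refine le_trans ?_ (add_le_add h1 (mul_le_mul_of_nonneg_left h2 hc))
    rw [Finset.mul_sum, ← Finset.sum_add_distrib]
    refine Finset.sum_le_sum fun a ha => ?_
    have : ν a < μ a := hsub ha
    have := mul_le_mul_of_nonneg_right (h a) (sub_nonneg.2 this.le)
    linarith

theorem pdist_mono (p : Ell) (hB : IsUltra B) {w w₁ : Weight P} (h : ∀ a, w a ≤ w₁ a)
    (μ ν : Fractional B) : pdist p hB w μ ν ≤ pdist p hB w₁ μ ν := by
  simpa using pdist_le_add p hB (w₂ := w₁) le_rfl (fun a => by simpa using h a) μ ν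

end Chains

/-! ### The geodesic flow -/

section Flow

variable {P : Type*} [PocSet P] {B : Set P}

open Fractional

/-- The time at which the flow from `μ` to `ν` starts to cross the wall of `a`. -/
noncomputable def startTime (w : Weight P) (μ ν : Fractional B) (a : P) : ℝ :=
  sSup {r | ∃ C : Finset P, IsChain (· ≤ ·) (C : Set P) ∧ (C : Set P) ⊆ drop μ ν ∧
    (∀ c ∈ C, c < a) ∧ r = ∑ c ∈ C, w c * (μ c - ν c)}

section

variable (hB : IsUltra B) (w : Weight P) (μ ν : Fractional B)

include hB in
theorem finite_chain_sums (a : P) :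
    {r | ∃ C : Finset P, IsChain (· ≤ ·) (C : Set P) ∧ (C : Set P) ⊆ drop μ ν ∧
      (∀ c ∈ C, c < a) ∧ r = ∑ c ∈ C, w c * (μ c - ν c)}.Finite := by
  classical
  refine (Finset.finite_toSet ((finite_drop hB.1 μ ν).toFinset.powerset.image
    fun C => ∑ c ∈ C, w c * (μ c - ν c))).subset ?_
  rintro r ⟨C, -, hC, -, rfl⟩
  simp only [Finset.coe_image, Finset.coe_powerset]
  exact mem_image_of_mem _ (by simpa using hC)

include hB in
theorem sum_le_startTime {a : P} {C : Finset P} (hC : IsChain (· ≤ ·) (C : Set P))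
    (hD : (C : Set P) ⊆ drop μ ν) (ha : ∀ c ∈ C, c < a) :
    ∑ c ∈ C, w c * (μ c - ν c) ≤ startTime w μ ν a :=
  le_csSup (finite_chain_sums hB w μ ν a).bddAbove ⟨C, hC, hD, ha, rfl⟩

include hB in
theorem exists_startTime (a : P) :
    ∃ C : Finset P, IsChain (· ≤ ·) (C : Set P) ∧ (C : Set P) ⊆ drop μ ν ∧ (∀ c ∈ C, c < a) ∧
      startTime w μ ν a = ∑ c ∈ C, w c * (μ c - ν c) :=
  Set.Nonempty.csSup_mem (by exact ⟨0, ∅, by simp⟩) (finite_chain_sums hB w μ ν a)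

include hB in
theorem startTime_nonneg (a : P) : 0 ≤ startTime w μ ν a := by
  simpa using sum_le_startTime hB w μ ν (a := a) (C := ∅) (by simp) (by simp) (by simp)

include hB in
theorem exists_endTime {a : P} (ha : a ∈ drop μ ν) :
    ∃ C : Finset P, IsChain (· ≤ ·) (C : Set P) ∧ (C : Set P) ⊆ drop μ ν ∧ (∀ c ∈ C, c ≤ a) ∧
      startTime w μ ν a + w a * (μ a - ν a) = ∑ c ∈ C, w c * (μ c - ν c) := by
  classical
  obtain ⟨C, hC, hD, hlt, h⟩ := exists_startTime hB w μ ν a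
  refine ⟨insert a C, ?_, ?_, ?_, ?_⟩
  · rw [Finset.coe_insert]
    exact hC.insert fun b hb _ => Or.inr (hlt b hb).le
  · rw [Finset.coe_insert]
    exact insert_subset ha hD
  · intro c hc
    rcases Finset.mem_insert.1 hc with rfl | hc
    · exact le_rfl
    · exact (hlt c hc).le
  · rw [Finset.sum_insert fun h => lt_irrefl _ (hlt a h), h, add_comm]

-- A heaviest chain below `a`, prolonged by `a`, is a competitor for the start time of `b`. Thus the
-- flow finishes `a` before it starts `b`.
include hB in
theorem startTime_add_le {a b : P} (ha : a ∈ drop μ ν) (hab : a < b) :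
    startTime w μ ν a + w a * (μ a - ν a) ≤ startTime w μ ν b := by
  obtain ⟨C, hC, hD, hle, h⟩ := exists_endTime hB w μ ν ha
  rw [h]
  exact sum_le_startTime hB w μ ν hC hD fun c hc => (hle c hc).trans_lt hab

theorem startTime_add_le_ellInf {a : P} (ha : a ∈ drop μ ν) :
    startTime w μ ν a + w a * (μ a - ν a) ≤ ellInf (μ.toDual hB w) (ν.toDual hB w) := by
  obtain ⟨C, hC, -, -, h⟩ := exists_endTime hB w μ ν ha
  rw [h]
  exact (le_abs_self _).trans (abs_chain_sum_le_ellInf hB w μ ν hC)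

/-- The degrees at time `t` of the elements that are dropped by the flow from `μ` to `ν`. -/
noncomputable def flowDegree (t : ℝ) (a : P) : ℝ :=
  -- A wall of weight zero is crossed instantaneously, just after its start time.
  if w a = 0 then (if t ≤ startTime w μ ν a then μ a else ν a)
  else max (ν a) (μ a - max (t - startTime w μ ν a) 0 / w a)

-- After multiplication by the weight the case distinction disappears: the length removed by time
-- `t` is the elapsed time, clamped between 0 and the whole length.
variable {μ ν} in
theorem mul_flowDegree (t : ℝ) (a : P) :
    w a * flowDegree w μ ν t a =
      w a * μ a - min (max (t - startTime w μ ν a) 0) (w a * (μ a - ν a)) := by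
  unfold flowDegree
  split_ifs with h h'
  · rw [h]; simp
  · rw [h]; simp
  · have hw := lt_of_le_of_ne (w.nonneg a) (Ne.symm h)
    rw [mul_max_of_nonneg _ _ hw.le, mul_sub, mul_div_cancel₀ _ h, mul_sub]
    generalize max (t - startTime w μ ν a) 0 = m
    simp only [max_def, min_def]
    split_ifs <;> linarith

variable {μ ν} in
theorem le_flowDegree (t : ℝ) {a : P} (ha : a ∈ drop μ ν) : ν a ≤ flowDegree w μ ν t a := by
  have : ν a < μ a := ha
  unfold flowDegree
  split_ifs
  · exact this.le
  · exact le_rfl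
  · exact le_max_left _ _

variable {μ ν} in
theorem flowDegree_le (t : ℝ) {a : P} (ha : a ∈ drop μ ν) : flowDegree w μ ν t a ≤ μ a := by
  have : ν a < μ a := ha
  unfold flowDegree
  split_ifs
  · exact le_rfl
  · exact this.le
  · refine max_le this.le ?_
    have := div_nonneg (le_max_right (t - startTime w μ ν a) 0) (w.nonneg a)
    linarith

variable {μ ν} in
theorem flowDegree_anti {s t : ℝ} (hst : s ≤ t) {a : P} (ha : a ∈ drop μ ν) :
    flowDegree w μ ν t a ≤ flowDegree w μ ν s a := by
  have : ν a < μ a := ha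
  unfold flowDegree
  split_ifs with h1 h2 h3 h3
  · exact le_rfl
  · exact absurd (hst.trans h2) h3
  · exact this.le
  · exact le_rfl
  · refine max_le_max le_rfl (sub_le_sub_left (div_le_div_of_nonneg_right ?_ (w.nonneg a)) _)
    exact max_le_max (by linarith) le_rfl

-- If `b` has begun to drop, then its start time has passed, and by then `a` is finished.
include hB in
theorem flowDegree_nested (t : ℝ) {a b : P} (hab : a < b) (ha : a ∈ drop μ ν)
    (hlt : flowDegree w μ ν t b < μ b) : flowDegree w μ ν t a = ν a := by
  have hT : startTime w μ ν b < t := by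
    by_contra hle
    push Not at hle
    refine hlt.not_ge ?_
    unfold flowDegree
    rw [max_eq_right (sub_nonpos.2 hle)]
    split_ifs <;> simp
  have h1 := startTime_add_le hB w μ ν ha hab
  unfold flowDegree
  have hab : ν a < μ a := ha
  have : 0 ≤ w a * (μ a - ν a) := mul_nonneg (w.nonneg a) (by linarith)
  split_ifs with h h'
  · linarith
  · rfl
  · have hw := lt_of_le_of_ne (w.nonneg a) (Ne.symm h)
    refine max_eq_left ?_
    have : μ a - ν a ≤ max (t - startTime w μ ν a) 0 / w a := by
      rw [le_div_iff₀ hw]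
      refine le_trans ?_ (le_max_left _ _)
      linarith
    linarith

/-- The flow from `μ` to `ν`, that crosses the walls as soon as possible with unit speed. -/
noncomputable def flow (t : ℝ) : Fractional B :=
  dropTo μ ν (flowDegree w μ ν t) (fun _ => le_flowDegree w t) (fun _ => flowDegree_le w t)
    fun _ _ hab ha _ => flowDegree_nested hB w μ ν t hab ha

variable {μ ν}

theorem flow_of_mem (t : ℝ) {a : P} (ha : a ∈ drop μ ν) :
    flow hB w μ ν t a = flowDegree w μ ν t a := dropTo_of_mem ha

theorem flow_of_notMem (t : ℝ) {a : P} (ha : a ∉ drop μ ν) (ha' : aᶜ ∉ drop μ ν) :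
    flow hB w μ ν t a = μ a := dropTo_of_notMem ha ha'

theorem flow_anti {s t : ℝ} (hst : s ≤ t) {a : P} (ha : a ∈ drop μ ν) :
    flow hB w μ ν t a ≤ flow hB w μ ν s a := by
  rw [flow_of_mem hB w t ha, flow_of_mem hB w s ha]
  exact flowDegree_anti w hst ha

theorem drop_flow_subset {s t : ℝ} (hst : s ≤ t) :
    drop (flow hB w μ ν s) (flow hB w μ ν t) ⊆ drop μ ν := by
  intro a ha
  by_contra hn
  have hd : flow hB w μ ν t a < flow hB w μ ν s a := ha
  by_cases hc : aᶜ ∈ drop μ ν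
  · have := flow_anti hB w hst hc
    rw [(flow hB w μ ν s).map_compl, (flow hB w μ ν t).map_compl] at this
    linarith
  · rw [flow_of_notMem hB w t hn hc, flow_of_notMem hB w s hn hc] at hd
    exact lt_irrefl _ hd

/-- The part of the crossing interval `[T, T + l]` that lies in the window `[s, t]` has for its ends
the clamped ends of that interval. -/
theorem clamp_add {s t T l : ℝ} (hst : s ≤ t) (hl : 0 ≤ l) :
    max s (min t T) + (min (max (t - T) 0) l - min (max (s - T) 0) l) =
      max s (min t (T + l)) := by
  simp only [max_def, min_def]
  split_ifs <;> linarith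

/-- The elements of a chain are crossed one after the other. The parts of their crossing times in
`[s, t]` are therefore successive, and their total length is at most `t - s`. -/
theorem ellInf_flow_le {s t : ℝ} (hst : s ≤ t) :
    ellInf ((flow hB w μ ν s).toDual hB w) ((flow hB w μ ν t).toDual hB w) ≤ t - s := by
  refine ellInf_le_of_chain hB w _ _ fun C hC hsub => ?_
  have hD := hsub.trans (drop_flow_subset hB w hst)
  have key : ∀ c ∈ C, max s (min t (startTime w μ ν c)) +
      w c * (flow hB w μ ν s c - flow hB w μ ν t c) =
      max s (min t (startTime w μ ν c + w c * (μ c - ν c))) := by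
    intro c hc
    have : ν c < μ c := hD hc
    rw [flow_of_mem hB w s (hD hc), flow_of_mem hB w t (hD hc), mul_sub,
      mul_flowDegree w s c, mul_flowDegree w t c,
      ← clamp_add hst (mul_nonneg (w.nonneg c) (by linarith))]
    ring
  refine sum_chain_le hC (fun c => max s (min t (startTime w μ ν c))) _ s t ?_
    (fun c _ => le_max_left _ _) ?_ hst
  · intro c hc d hd hcd
    rw [key c hc]
    exact max_le_max le_rfl (min_le_min le_rfl (startTime_add_le hB w μ ν (hD hc) hcd))
  · intro c hc
    rw [key c hc]
    exact max_le hst (min_le_left _ _)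

theorem toDual_flow_zero : (flow hB w μ ν 0).toDual hB w = μ.toDual hB w := by
  have key : ∀ a ∈ drop μ ν, w a * flow hB w μ ν 0 a = w a * μ a := by
    intro a ha
    have : ν a < μ a := ha
    have h0 : 0 ≤ w a * (μ a - ν a) := mul_nonneg (w.nonneg a) (by linarith)
    have hT := startTime_nonneg hB w μ ν a
    rw [flow_of_mem hB w 0 ha, mul_flowDegree w 0 a, max_eq_right (by linarith),
      min_eq_left h0, sub_zero]
  refine toDual_eq hB fun a _ => ?_
  by_cases ha : a ∈ drop μ ν
  · exact key a ha
  · by_cases ha' : aᶜ ∈ drop μ ν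
    · have := key _ ha'
      rw [w.map_compl, (flow hB w μ ν 0).map_compl, μ.map_compl] at this
      linarith
    · rw [flow_of_notMem hB w 0 ha ha']

/-- Each crossing ends with the weight of a chain, which the distance bounds. The equality is one of
points of the weighted dual: a wall of weight zero with start time `t` has not been crossed yet. -/
theorem toDual_flow_of_le {t : ℝ} (ht : ellInf (μ.toDual hB w) (ν.toDual hB w) ≤ t) :
    (flow hB w μ ν t).toDual hB w = ν.toDual hB w := by
  have key : ∀ a ∈ drop μ ν, w a * flow hB w μ ν t a = w a * ν a := by
    intro a ha
    have h1 := startTime_add_le_ellInf hB w μ ν ha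
    rw [flow_of_mem hB w t ha, mul_flowDegree w t a,
      min_eq_right (le_max_of_le_left (by linarith))]
    ring
  refine toDual_eq hB fun a _ => ?_
  by_cases ha : a ∈ drop μ ν
  · exact key a ha
  · by_cases ha' : aᶜ ∈ drop μ ν
    · have := key _ ha'
      rw [w.map_compl, (flow hB w μ ν t).map_compl, ν.map_compl] at this
      linarith
    · rw [flow_of_notMem hB w t ha ha']
      rw [compl_mem_drop] at ha'
      simp only [drop, mem_ofPred_eq, not_lt] at ha ha'
      rw [le_antisymm ha ha']

/-- The upper bounds on `[0, s]`, `[s, t]` and the rest add up to the distance of the endpoints, so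
the triangle inequality makes all of them sharp. -/
theorem ellInf_flow {s t : ℝ} (hs : 0 ≤ s) (hst : s ≤ t)
    (ht : t ≤ ellInf (μ.toDual hB w) (ν.toDual hB w)) :
    ellInf ((flow hB w μ ν s).toDual hB w) ((flow hB w μ ν t).toDual hB w) = t - s := by
  refine le_antisymm (ellInf_flow_le hB w hst) ?_
  have h1 := ellInf_flow_le hB w (μ := μ) (ν := ν) hs
  have h2 := ellInf_flow_le hB w (μ := μ) (ν := ν) ht
  rw [toDual_flow_zero] at h1
  rw [toDual_flow_of_le hB w le_rfl] at h2
  have h3 := pdist_triangle .infty hB w μ (flow hB w μ ν s) ν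
  have h4 := pdist_triangle .infty hB w (flow hB w μ ν s) (flow hB w μ ν t) ν
  simp only [pdist_infty] at h3 h4
  linarith

theorem abs_flow_add {r s t : ℝ} (hrs : r ≤ s) (hst : s ≤ t) (a : P) :
    |flow hB w μ ν r a - flow hB w μ ν t a| =
      |flow hB w μ ν r a - flow hB w μ ν s a| + |flow hB w μ ν s a - flow hB w μ ν t a| := by
  by_cases ha : a ∈ drop μ ν
  · have h1 := flow_anti hB w hrs ha
    have h2 := flow_anti hB w hst ha
    rw [abs_of_nonneg (by linarith), abs_of_nonneg (by linarith), abs_of_nonneg (by linarith)]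
    ring
  · by_cases ha' : aᶜ ∈ drop μ ν
    · have h1 := flow_anti hB w hrs ha'
      have h2 := flow_anti hB w hst ha'
      simp only [Fractional.map_compl] at h1 h2
      rw [abs_of_nonpos (by linarith), abs_of_nonpos (by linarith), abs_of_nonpos (by linarith)]
      ring
    · simp only [flow_of_notMem hB w _ ha ha']
      simp

theorem mem_drop_of_flow_ne {s t : ℝ} {a : P} (h : flow hB w μ ν s a ≠ flow hB w μ ν t a) :
    μ a ≠ ν a := by
  intro e
  have ha : a ∉ drop μ ν := fun h => (ne_of_gt h) e
  have ha' : aᶜ ∉ drop μ ν := by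
    rw [compl_mem_drop]
    exact fun h => (ne_of_lt h) e
  exact h (by rw [flow_of_notMem hB w _ ha ha', flow_of_notMem hB w _ ha ha'])

/-- Every degree changes monotonically along the flow. -/
theorem ellOne_flow_add {r s t : ℝ} (hrs : r ≤ s) (hst : s ≤ t) :
    ellOne ((flow hB w μ ν r).toDual hB w) ((flow hB w μ ν t).toDual hB w) =
      ellOne ((flow hB w μ ν r).toDual hB w) ((flow hB w μ ν s).toDual hB w) +
      ellOne ((flow hB w μ ν s).toDual hB w) ((flow hB w μ ν t).toDual hB w) := by
  obtain ⟨F, hF, hF'⟩ := exists_support μ ν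
  have h : ∀ s t, ∀ a ∈ B, flow hB w μ ν s a ≠ flow hB w μ ν t a → a ∈ F := fun s t a ha hne =>
    hF' a ha (mem_drop_of_flow_ne hB w hne)
  rw [ellOne_eq_sum hB w _ _ F hF (h r t), ellOne_eq_sum hB w _ _ F hF (h r s),
    ellOne_eq_sum hB w _ _ F hF (h s t), ← Finset.sum_add_distrib]
  exact Finset.sum_congr rfl fun a _ => by rw [abs_flow_add hB w hrs hst, mul_add]

-- For d_1 the constant is the number of coordinates that may move, each with at most unit speed.
variable (μ ν) in
theorem exists_pdist_flow_le (p : Ell) :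
    ∃ K : ℝ, 0 ≤ K ∧ ∀ s t, s ≤ t →
      pdist p hB w (flow hB w μ ν s) (flow hB w μ ν t) ≤ K * (t - s) := by
  cases p
  · obtain ⟨F, hF, hF'⟩ := exists_support μ ν
    refine ⟨F.card, Nat.cast_nonneg _, fun s t hst => ?_⟩
    rw [pdist_one, ellOne_eq_sum hB w _ _ F hF fun a ha hne =>
      hF' a ha (mem_drop_of_flow_ne hB w hne), ← nsmul_eq_mul]
    refine Finset.sum_le_card_nsmul _ _ _ fun a _ => ?_
    exact (abs_coord_le_ellInf hB w _ _ a).trans (ellInf_flow_le hB w hst)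
  · exact ⟨1, zero_le_one, fun s t hst => by
      rw [one_mul]
      exact ellInf_flow_le hB w hst⟩

theorem pdist_flow_add (p : Ell) {t : ℝ} (h0 : 0 ≤ t)
    (ht : t ≤ ellInf (μ.toDual hB w) (ν.toDual hB w)) :
    pdist p hB w μ (flow hB w μ ν t) + pdist p hB w (flow hB w μ ν t) ν = pdist p hB w μ ν := by
  have e0 := toDual_flow_zero hB w (μ := μ) (ν := ν)
  have e1 := toDual_flow_of_le hB w (μ := μ) (ν := ν) le_rfl
  cases p
  · have := ellOne_flow_add hB w (μ := μ) (ν := ν) h0 ht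
    rw [e0, e1] at this
    exact this.symm
  · have h1 := ellInf_flow hB w le_rfl h0 ht
    have h2 := ellInf_flow hB w h0 ht le_rfl
    rw [e0] at h1
    rw [e1] at h2
    simp only [pdist_infty]
    linarith

end

end Flow

/-! ### Subdivision: the lower approximations as duals with rounded weights -/

section Subdivision

variable {P : Type*} [PocSet P]

theorem IsUltra.top_mem {B : Set P} (hB : IsUltra B) : (⊥ᶜ : P) ∈ B := by
  by_contra h
  have h0 : (⊥ : P) ∈ B := by
    have := hB.1.compl_mem_iff.not.1 h
    simpa using this
  exact hB.2 _ h0 _ h0 bot_le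

theorem IsUltra.bot_ne_top {B : Set P} (hB : IsUltra B) : (⊥ : P) ≠ ⊥ᶜ := fun h =>
  hB.1.compl_mem_iff.1 hB.top_mem (h ▸ hB.top_mem)

theorem Weight.eq_zero_of_not_isProper (w : Weight P) {a : P} (ha : ¬ IsProper a) : w a = 0 := by
  simp only [IsProper, not_and_or, not_not] at ha
  rcases ha with rfl | rfl
  · exact w.map_bot
  · rw [w.map_compl, w.map_bot]

/-- The weight rounded down to the multiples of `1 / n`. -/
noncomputable def roundWeight (w : Weight P) (n : ℕ) : Weight P where
  toFun a := floorWeight w n a / n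
  nonneg a := by positivity
  map_bot := by simp [floorWeight, w.map_bot]
  map_compl a := by rw [floorWeight_compl]

theorem roundWeight_apply (w : Weight P) (n : ℕ) (a : P) :
    roundWeight w n a = floorWeight w n a / n := rfl

theorem roundWeight_le (w : Weight P) (n : ℕ) (a : P) : roundWeight w n a ≤ w a := by
  rw [roundWeight_apply]
  rcases n.eq_zero_or_pos with rfl | hn
  · simpa using w.nonneg a
  · rw [div_le_iff₀ (by exact_mod_cast hn), mul_comm]
    exact Nat.floor_le (mul_nonneg (Nat.cast_nonneg _) (w.nonneg a))

theorem floorWeight_le (w : Weight P) (n : ℕ) (a : P) : (floorWeight w n a : ℝ) ≤ n * w a :=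
  Nat.floor_le (mul_nonneg (Nat.cast_nonneg _) (w.nonneg a))

theorem lt_floorWeight_add_one (w : Weight P) (n : ℕ) (a : P) : n * w a < floorWeight w n a + 1 :=
  Nat.lt_floor_add_one _

theorem le_roundWeight_add (w : Weight P) {n : ℕ} (hn : 0 < n) (a : P) :
    w a ≤ roundWeight w n a + 1 / n := by
  have hn' : (0 : ℝ) < n := by exact_mod_cast hn
  rw [roundWeight_apply, ← add_div, le_div_iff₀ hn', mul_comm]
  exact (lt_floorWeight_add_one w n a).le

theorem floorWeight_of_not_isProper (w : Weight P) (n : ℕ) {a : P} (ha : ¬ IsProper a) :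
    floorWeight w n a = 0 := by
  simp [floorWeight, w.eq_zero_of_not_isProper ha]

namespace Refined

variable {u : P → ℕ} {hu : ∀ a, u aᶜ = u a}

theorem isProper_mk (p : P) (hp : IsProper p) (i : Fin (u p)) :
    IsProper (mk p hp i : Refined u hu) :=
  ⟨nofun, nofun⟩

theorem mk_le_mk {p q : P} {hp : IsProper p} {hq : IsProper q} {i : Fin (u p)} {j : Fin (u q)} :
    (mk p hp i : Refined u hu) ≤ mk q hq j ↔ p < q ∨ (p = q ∧ i.val ≤ j.val) := Iff.rfl

theorem mk_lt_mk {p q : P} {hp : IsProper p} {hq : IsProper q} {i : Fin (u p)} {j : Fin (u q)} :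
    (mk p hp i : Refined u hu) < mk q hq j ↔ p < q ∨ (p = q ∧ i.val < j.val) := by
  rw [lt_iff_le_not_ge, mk_le_mk, mk_le_mk]
  constructor
  · rintro ⟨h | ⟨rfl, h⟩, h'⟩
    · exact Or.inl h
    · exact Or.inr ⟨rfl, by simpa using h'⟩
  · rintro (h | ⟨rfl, h⟩)
    · exact ⟨Or.inl h, fun h' => h'.elim (lt_asymm h) fun h' => h.ne h'.1.symm⟩
    · exact ⟨Or.inr ⟨rfl, h.le⟩, by simpa using h⟩

theorem mk_compl (p : P) (hp : IsProper p) (i : Fin (u p)) :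
    ((mk p hp i : Refined u hu))ᶜ =
      mk pᶜ hp.compl ⟨u p - 1 - i, by have := i.2; rw [hu]; omega⟩ := rfl

theorem mk_injective (p : P) (hp : IsProper p) :
    Function.Injective fun i : Fin (u p) => (mk p hp i : Refined u hu) := by
  intro i j h
  simpa using h

open Classical in
variable (u hu) in
/-- The elements of the chains that replace the elements of a finite set. -/
noncomputable def lift (F : Finset P) : Finset (Refined u hu) :=
  F.biUnion fun p => if hp : IsProper p then Finset.univ.image (mk (hu := hu) p hp) else ∅

open Classical in
theorem mem_lift {F : Finset P} {c : Refined u hu} :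
    c ∈ lift u hu F ↔ ∃ (p : P) (hp : IsProper p) (i : Fin (u p)), p ∈ F ∧ c = mk p hp i := by
  simp only [lift, Finset.mem_biUnion]
  constructor
  · rintro ⟨p, hp, h⟩
    split_ifs at h with h'
    · obtain ⟨i, -, rfl⟩ := Finset.mem_image.1 h
      exact ⟨p, h', i, hp, rfl⟩
    · simp at h
  · rintro ⟨p, hp, i, hF, rfl⟩
    exact ⟨p, hF, by simp [hp]⟩

theorem mk_mem_lift {F : Finset P} {p : P} {hp : IsProper p} {i : Fin (u p)} :
    (mk p hp i : Refined u hu) ∈ lift u hu F ↔ p ∈ F := by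
  rw [mem_lift]
  constructor
  · rintro ⟨q, hq, j, hF, h⟩
    cases h
    exact hF
  · exact fun h => ⟨p, hp, i, h, rfl⟩

open Classical in
theorem sum_lift (F : Finset P) (f : Refined u hu → ℝ) :
    ∑ c ∈ lift u hu F, f c =
      ∑ p ∈ F, if hp : IsProper p then ∑ i : Fin (u p), f (mk p hp i) else 0 := by
  rw [lift, Finset.sum_biUnion]
  · refine Finset.sum_congr rfl fun p _ => ?_
    split_ifs with hp
    · rw [Finset.sum_image ((mk_injective p hp).injOn)]
    · simp
  · intro p _ q _ hpq
    rw [Function.onFun, Finset.disjoint_left]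
    intro c hc hc'
    split_ifs at hc hc' with h1 h2
    · obtain ⟨i, -, rfl⟩ := Finset.mem_image.1 hc
      obtain ⟨j, -, h⟩ := Finset.mem_image.1 hc'
      cases h
      exact hpq rfl
    · simp at hc'
    · simp at hc
    · simp at hc

theorem isChain_lift {F : Finset P} (hF : IsChain (· ≤ ·) (F : Set P)) :
    IsChain (· ≤ ·) (lift u hu F : Set (Refined u hu)) := by
  rintro c hc d hd -
  obtain ⟨p, hp, i, hpF, rfl⟩ := mem_lift.1 hc
  obtain ⟨q, hq, j, hqF, rfl⟩ := mem_lift.1 hd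
  by_cases e : p = q
  · subst e
    exact (le_total i.val j.val).imp (fun h => Or.inr ⟨rfl, h⟩) fun h => Or.inr ⟨rfl, h⟩
  · exact (hF hpF hqF e).imp (fun h => Or.inl (lt_of_le_of_ne h e))
      fun h => Or.inl (lt_of_le_of_ne h (Ne.symm e))

open Classical in
theorem isChain_image_proj (h0 : (⊥ : P) ≠ ⊥ᶜ) {C : Finset (Refined u hu)}
    (hC : IsChain (· ≤ ·) (C : Set (Refined u hu))) :
    IsChain (· ≤ ·) ((C.image (proj u hu) : Finset P) : Set P) := by
  rw [Finset.coe_image]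
  exact hC.image_of_map_rel _ _ _ fun a b h => (isRefinement_proj h0).monotone a b h

end Refined

open Refined

theorem isUltra_approxBase (w : Weight P) {B : Set P} (hB : IsUltra B) (n : ℕ) :
    IsUltra (approxBase w B n) := by
  have href := isRefinement_proj (u := floorWeight w n) (hu := floorWeight_compl w n) hB.bot_ne_top
  refine ⟨fun a => ?_, fun a ha b hb hab => ?_⟩
  · have := hB.1 (proj (floorWeight w n) (floorWeight_compl w n) a)
    rw [← href.map_compl] at this
    exact this
  · have := href.monotone _ _ hab
    rw [href.map_compl] at this
    exact hB.2 _ ha _ hb this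

theorem approxWeight_mk (w : Weight P) (n : ℕ) (p : P) (hp : IsProper p)
    (i : Fin (floorWeight w n p)) :
    approxWeight w n (.mk p hp i : LowerApprox w n) = 1 / n :=
  if_pos (isProper_mk p hp i)

/-- The degree of the `i`-th element of a chain when a length `s` has been removed from its lower
end. -/
noncomputable def ramp (s : ℝ) (i : ℕ) : ℝ := max (i + 1 - s) 0 - max (i - s) 0

theorem ramp_nonneg (s : ℝ) (i : ℕ) : 0 ≤ ramp s i :=
  sub_nonneg.2 (max_le_max (by linarith) le_rfl)

theorem ramp_anti {s t : ℝ} (h : s ≤ t) (i : ℕ) : ramp t i ≤ ramp s i := by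
  unfold ramp
  simp only [max_def]
  split_ifs <;> linarith

theorem ramp_eq_one {s : ℝ} {i : ℕ} (h : s ≤ i) : ramp s i = 1 := by
  unfold ramp
  rw [max_eq_left (by linarith), max_eq_left (by linarith)]
  ring

theorem ramp_eq_zero {s : ℝ} {i : ℕ} (h : i + 1 ≤ s) : ramp s i = 0 := by
  unfold ramp
  rw [max_eq_right (by linarith), max_eq_right (by linarith)]
  ring

theorem ramp_nested (s : ℝ) {i j : ℕ} (h : i < j) : ramp s i = 0 ∨ ramp s j = 1 := by
  have h' : (i : ℝ) + 1 ≤ j := by exact_mod_cast h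
  rcases le_total s (i + 1) with h1 | h1
  · exact Or.inr (ramp_eq_one (h1.trans h'))
  · exact Or.inl (ramp_eq_zero h1)

theorem ramp_compl {s : ℝ} {u i : ℕ} (hi : i < u) : ramp (u - s) (u - 1 - i) = 1 - ramp s i := by
  have : ((u - 1 - i : ℕ) : ℝ) = u - 1 - i := by
    rw [Nat.cast_sub (by omega), Nat.cast_sub (by omega)]
    simp
  unfold ramp
  rw [this]
  simp only [max_def]
  split_ifs <;> linarith

theorem sum_ramp {s : ℝ} (hs : 0 ≤ s) (u : ℕ) :
    ∑ i ∈ Finset.range u, ramp s i = max (u - s) 0 := by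
  have := Finset.sum_range_sub (fun i : ℕ => max ((i : ℝ) - s) 0) u
  simp only [Nat.cast_add, Nat.cast_one, Nat.cast_zero, zero_sub] at this
  rw [max_eq_right (by linarith : -s ≤ 0), sub_zero] at this
  exact this

variable {B : Set P}

namespace Fractional

/-- The subdivision of a fractional ultrafilter of `P`. -/
noncomputable def subdivide (w : Weight P) (n : ℕ) (μ : Fractional B) :
    Fractional (approxBase w B n) where
  toFun
    | .bot => 0
    | .top => 1
    -- The missing length is taken from the lower end of the chain, as nestedness requires a lower
    -- element to vanish before a higher one decreases.
    | .mk p _ i => ramp (floorWeight w n p * (1 - μ p)) i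
  nonneg := by
    rintro (_ | _ | ⟨p, hp, i⟩)
    · exact le_rfl
    · exact zero_le_one
    · exact ramp_nonneg _ _
  map_compl := by
    rintro (_ | _ | ⟨p, hp, i⟩)
    · exact (sub_zero _).symm
    · exact (sub_self _).symm
    · rw [mk_compl]
      simp only [floorWeight_compl]
      rw [μ.map_compl, ← ramp_compl i.2]
      congr 1
      ring
  nested := by
    rintro (_ | _ | ⟨p, hp, i⟩) (_ | _ | ⟨q, hq, j⟩) h
    case mk.mk =>
      have hi : (i.val : ℝ) + 1 ≤ floorWeight w n p := by exact_mod_cast i.2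
      rcases mk_lt_mk.1 h with h | ⟨rfl, h⟩
      · rcases μ.nested _ _ h with h | h
        · left
          simp only [h]
          exact ramp_eq_zero (by linarith)
        · right
          simp only [h]
          exact ramp_eq_one (by simp)
      · exact ramp_nested _ h
    all_goals first
      | exact Or.inl rfl
      | exact Or.inr rfl
      | exact absurd h.le id
  finite := by
    classical
    refine ((finite_singleton Refined.bot).union
      (Finset.finite_toSet (lift _ _ μ.finite.toFinset))).subset ?_
    rintro (_ | _ | ⟨p, hp, i⟩) ⟨hb, h⟩
    · exact Or.inl rfl
    · exact absurd rfl h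
    · refine Or.inr (mk_mem_lift.2 ?_)
      simp only [Finite.mem_toFinset, mem_ofPred_eq]
      refine ⟨hb, fun h1 => h ?_⟩
      simp only [h1]
      exact ramp_eq_one (by simp)

section

variable (w : Weight P) (n : ℕ)

theorem subdivide_mk (μ : Fractional B) (p : P) (hp : IsProper p) (i : Fin (floorWeight w n p)) :
    subdivide w n μ (.mk p hp i) = ramp (floorWeight w n p * (1 - μ p)) i := rfl

theorem sum_subdivide (μ : Fractional B) (p : P) (hp : IsProper p) :
    ∑ i : Fin (floorWeight w n p), subdivide w n μ (.mk p hp i) = floorWeight w n p * μ p := by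
  have h0 := μ.nonneg p
  have h1 := μ.le_one p
  have hu : (0 : ℝ) ≤ floorWeight w n p := Nat.cast_nonneg _
  simp only [subdivide_mk]
  rw [Fin.sum_univ_eq_sum_range (fun i => ramp (floorWeight w n p * (1 - μ p)) i),
    sum_ramp (mul_nonneg hu (by linarith)), max_eq_left]
  · ring
  · nlinarith

theorem subdivide_mono {μ ν : Fractional B} {p : P} (h : ν p ≤ μ p) (hp : IsProper p)
    (i : Fin (floorWeight w n p)) :
    subdivide w n ν (.mk p hp i) ≤ subdivide w n μ (.mk p hp i) := by
  refine ramp_anti (mul_le_mul_of_nonneg_left (by linarith) (Nat.cast_nonneg _)) _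

/-- The degrees over `p` telescope to ⌊n w(p)⌋ μ(p). Chain sums for unit weights in the
approximation thereby become chain sums for the rounded weight. -/
theorem sum_lift_subdivide (μ ν : Fractional B) (F : Finset P) :
    ∑ c ∈ lift _ _ F, approxWeight w n c * (subdivide w n μ c - subdivide w n ν c) =
      ∑ p ∈ F, roundWeight w n p * (μ p - ν p) := by
  rw [sum_lift]
  refine Finset.sum_congr rfl fun p _ => ?_
  split_ifs with hp
  · simp only [approxWeight_mk]
    rw [← Finset.mul_sum, Finset.sum_sub_distrib, sum_subdivide, sum_subdivide, roundWeight_apply]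
    ring
  · rw [roundWeight_apply, floorWeight_of_not_isProper w n hp]
    simp

/-- All degrees in one fiber change in the same direction, so absolute values pass through the sum.
-/
theorem sum_lift_abs_subdivide (μ ν : Fractional B) (F : Finset P) :
    ∑ c ∈ lift _ _ F, approxWeight w n c * |subdivide w n μ c - subdivide w n ν c| =
      ∑ p ∈ F, roundWeight w n p * |μ p - ν p| := by
  rw [sum_lift]
  refine Finset.sum_congr rfl fun p _ => ?_
  split_ifs with hp
  · simp only [approxWeight_mk]
    rw [← Finset.mul_sum, roundWeight_apply]
    rcases le_total (μ p) (ν p) with h | h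
    · rw [abs_of_nonpos (by linarith), Finset.sum_congr rfl fun i _ => abs_of_nonpos
        (sub_nonpos.2 (subdivide_mono w n h hp i)), Finset.sum_neg_distrib,
        Finset.sum_sub_distrib, sum_subdivide, sum_subdivide]
      ring
    · rw [abs_of_nonneg (by linarith), Finset.sum_congr rfl fun i _ => abs_of_nonneg
        (sub_nonneg.2 (subdivide_mono w n h hp i)),
        Finset.sum_sub_distrib, sum_subdivide, sum_subdivide]
      ring
  · rw [roundWeight_apply, floorWeight_of_not_isProper w n hp]
    simp

theorem mem_lift_of_subdivide_ne {μ ν : Fractional B} {F : Finset P} {c : LowerApprox w n}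
    (h : subdivide w n μ c ≠ subdivide w n ν c)
    (hF : ∀ p hp i, c = .mk p hp i → μ p ≠ ν p → p ∈ F) : c ∈ lift _ _ F := by
  rcases c with _ | _ | ⟨p, hp, i⟩
  · exact absurd rfl h
  · exact absurd rfl h
  · exact mk_mem_lift.2 (hF p hp i rfl fun e => h (by rw [subdivide_mk, subdivide_mk, e]))

end

end Fractional

open Fractional

/-- The subdivision is an isometry for the rounded weight. -/
theorem pdist_subdivide (p : Ell) (hB : IsUltra B) (w : Weight P) (n : ℕ) (μ ν : Fractional B) :
    pdist p (isUltra_approxBase w hB n) (approxWeight w n) (subdivide w n μ) (subdivide w n ν) =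
      pdist p hB (roundWeight w n) μ ν := by
  classical
  cases p
  · obtain ⟨F, hF, hF'⟩ := exists_support μ ν
    rw [pdist_one, pdist_one, ellOne_eq_sum hB _ _ _ F hF hF', ← sum_lift_abs_subdivide]
    refine ellOne_eq_sum _ _ _ _ _ (fun c hc => ?_) fun c hc hne => ?_
    · obtain ⟨q, hq, i, hqF, rfl⟩ := mem_lift.1 hc
      exact hF q hqF
    · refine mem_lift_of_subdivide_ne w n hne ?_
      rintro q hq i rfl
      exact hF' q hc
  · rw [pdist_infty, pdist_infty]
    refine le_antisymm (ellInf_le_of_chain _ _ _ _ fun C hC hsub => ?_)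
      (ellInf_le_of_chain _ _ _ _ fun C hC hsub => ?_)
    -- A chain of the approximation is enlarged to the union of all fibers that it meets; the
    -- additional terms are nonnegative, since these fibers lie over dropped elements.
    · have h1 := abs_chain_sum_le_ellInf hB (roundWeight w n) μ ν
        (isChain_image_proj hB.bot_ne_top hC)
      refine le_trans ?_ ((le_abs_self _).trans h1)
      rw [← sum_lift_subdivide]
      have hmk : ∀ c ∈ C, ∃ q hq i, c = (.mk q hq i : LowerApprox w n) ∧ ν q < μ q := by
        rintro (_ | _ | ⟨q, hq, i⟩) hc
        · exact absurd (hsub hc) (lt_irrefl (0 : ℝ))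
        · exact absurd (hsub hc) (lt_irrefl (1 : ℝ))
        · refine ⟨q, hq, i, rfl, ?_⟩
          by_contra hle
          exact (subdivide_mono w n (not_lt.1 hle) hq i).not_gt (hsub hc)
      refine Finset.sum_le_sum_of_subset_of_nonneg (fun c hc => ?_) fun c hc _ => ?_
      · obtain ⟨q, hq, i, rfl, -⟩ := hmk c hc
        exact mk_mem_lift.2 (Finset.mem_image_of_mem _ hc)
      · obtain ⟨q, hq, i, hqC, rfl⟩ := mem_lift.1 hc
        obtain ⟨d, hd, e⟩ := Finset.mem_image.1 hqC
        obtain ⟨q', hq', j, rfl, hlt⟩ := hmk d hd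
        obtain rfl : q' = q := e
        exact mul_nonneg (Weight.nonneg _ _) (sub_nonneg.2 (subdivide_mono w n hlt.le hq i))
    -- Conversely, the union of the fibers over a chain is a chain.
    · have h1 := abs_chain_sum_le_ellInf (isUltra_approxBase w hB n) (approxWeight w n)
        (subdivide w n μ) (subdivide w n ν) (isChain_lift hC)
      rw [sum_lift_subdivide] at h1
      exact (le_abs_self _).trans h1

theorem corresponds_iff (hB : IsUltra B) (w : Weight P) (n : ℕ) (μ : Fractional B)
    (ξ : Fractional (approxBase w B n)) :
    Corresponds (ξ.toDual (isUltra_approxBase w hB n) (approxWeight w n)) (μ.toDual hB w) ↔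
      ∀ (b : P) (hp : IsProper b), b ∈ B →
        w b * ((floorWeight w n b - ∑ i, ξ (.mk b hp i)) / n) =
          floorWeight w n b / n * (w b * (1 - μ b)) := by
  simp only [Corresponds, toDual_apply, approxWeight_mk]
  refine forall_congr' fun b => forall_congr' fun hp => forall_congr' fun hb => ?_
  rw [← Finset.mul_sum, Finset.sum_sub_distrib]
  simp only [Finset.sum_const, Finset.card_univ, Fintype.card_fin, nsmul_eq_mul, mul_one]
  rw [one_div_mul_eq_div]

theorem corresponds_subdivide (hB : IsUltra B) (w : Weight P) (n : ℕ) (μ : Fractional B) :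
    Corresponds ((subdivide w n μ).toDual (isUltra_approxBase w hB n) (approxWeight w n))
      (μ.toDual hB w) := by
  rw [corresponds_iff]
  intro b hp _
  rw [sum_subdivide]
  ring

/-- If `f i > g i`, then nestedness makes `f` equal to one above `i` and `g` equal to zero below
`i`. Hence `f ≥ g` everywhere, and the sums differ. -/
theorem eq_of_sum_eq {u : ℕ} {f g : Fin u → ℝ} (hf0 : ∀ i, 0 ≤ f i) (hf1 : ∀ i, f i ≤ 1)
    (hg0 : ∀ i, 0 ≤ g i) (hg1 : ∀ i, g i ≤ 1) (hf : ∀ i j, i < j → f i = 0 ∨ f j = 1)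
    (hg : ∀ i j, i < j → g i = 0 ∨ g j = 1) (h : ∑ i, f i = ∑ i, g i) : f = g := by
  have key : ∀ f g : Fin u → ℝ, (∀ i, 0 ≤ f i) → (∀ i, f i ≤ 1) → (∀ i, 0 ≤ g i) →
      (∀ i, g i ≤ 1) → (∀ i j, i < j → f i = 0 ∨ f j = 1) →
      (∀ i j, i < j → g i = 0 ∨ g j = 1) → ∑ i, f i = ∑ i, g i → ∀ i, f i ≤ g i := by
    intro f g hf0 hf1 hg0 hg1 hf hg h i
    by_contra hlt
    push Not at hlt
    refine (Finset.sum_lt_sum (s := Finset.univ) (fun j _ => ?_) ⟨i, Finset.mem_univ _, hlt⟩).ne'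
      h
    rcases lt_trichotomy i j with hij | rfl | hij
    · rw [(hf i j hij).resolve_left ((hg0 i).trans_lt hlt).ne']
      exact hg1 j
    · exact hlt.le
    · rw [(hg j i hij).resolve_right (hlt.trans_le (hf1 i)).ne]
      exact hf0 j
  exact funext fun i => le_antisymm (key f g hf0 hf1 hg0 hg1 hf hg h i)
    (key g f hg0 hg1 hf0 hf1 hg hf h.symm i)

/-- The correspondence prescribes the sum of the degrees over each wall, and nestedness recovers the
degrees from their sum. -/
theorem eq_subdivide_of_corresponds (hB : IsUltra B) (w : Weight P) {n : ℕ} (μ : Fractional B)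
    (z : WeightedDual (approxWeight w n) (approxBase w B n))
    (h : Corresponds z (μ.toDual hB w)) :
    z = (subdivide w n μ).toDual (isUltra_approxBase w hB n) (approxWeight w n) := by
  obtain ⟨ξ, rfl⟩ := exists_toDual (isUltra_approxBase w hB n) z
  rw [corresponds_iff] at h
  refine toDual_eq _ fun c hc => ?_
  rcases c with _ | _ | ⟨p, hp, i⟩
  · rw [Weight.eq_zero_of_not_isProper (a := Refined.bot) _ fun h => h.1 rfl, zero_mul, zero_mul]
  · rw [Weight.eq_zero_of_not_isProper (a := Refined.top) _ fun h => h.2 rfl, zero_mul, zero_mul]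
  rw [approxWeight_mk]
  rcases n.eq_zero_or_pos with rfl | hn
  · simp
  congr 1
  have hn' : (0 : ℝ) < n := by exact_mod_cast hn
  have hw : 0 < w p := by
    have h1 : (1 : ℝ) ≤ floorWeight w n p := by exact_mod_cast (Nat.zero_le _).trans_lt i.2
    have h2 := h1.trans (floorWeight_le w n p)
    by_contra hle
    have : n * w p ≤ 0 := mul_nonpos_of_nonneg_of_nonpos hn'.le (not_lt.1 hle)
    linarith
  have hsum : ∑ i, ξ (.mk p hp i) = ∑ i, subdivide w n μ (.mk p hp i) := by
    have := h p hp hc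
    rw [sum_subdivide]
    field_simp at this
    linarith
  refine congrFun (eq_of_sum_eq (fun i => ξ.nonneg _) (fun i => ξ.le_one _)
    (fun i => (subdivide w n μ).nonneg _) (fun i => (subdivide w n μ).le_one _)
    (fun i j hij => ξ.nested _ _ (mk_lt_mk.2 (Or.inr ⟨rfl, hij⟩)))
    (fun i j hij => (subdivide w n μ).nested _ _ (mk_lt_mk.2 (Or.inr ⟨rfl, hij⟩))) hsum) i

theorem pdist_subdivide_le (p : Ell) (hB : IsUltra B) (w : Weight P) (n : ℕ)
    (μ ν : Fractional B) :
    pdist p (isUltra_approxBase w hB n) (approxWeight w n) (subdivide w n μ) (subdivide w n ν) ≤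
      pdist p hB w μ ν := by
  rw [pdist_subdivide p hB]
  exact pdist_mono p hB (roundWeight_le w n) μ ν

/-- Rounding costs less than 1/n per wall. The error involves the distance for unit weights, which
need not be bounded on balls; a uniform estimate requires compactness. -/
theorem pdist_le_subdivide_add (p : Ell) (hB : IsUltra B) (w : Weight P) {n : ℕ} (hn : 0 < n)
    (μ ν : Fractional B) :
    pdist p hB w μ ν ≤ pdist p (isUltra_approxBase w hB n) (approxWeight w n) (subdivide w n μ)
      (subdivide w n ν) + 1 / n * pdist p hB (constWeight P 1 zero_le_one) μ ν := by
  rw [pdist_subdivide p hB]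
  refine pdist_le_add p hB (by positivity) (fun a => ?_) μ ν
  by_cases ha : IsProper a
  · simpa [constWeight, ha] using le_roundWeight_add w hn a
  · rw [w.eq_zero_of_not_isProper ha]
    have := (roundWeight w n).nonneg a
    simpa [constWeight, ha] using this

end Subdivision

end PocSet

/-- The relation is thickened by ε in both factors to make its projections surjective. Moving four
endpoints by at most ε each adds 4ε to the distortion. -/
theorem IsApproximation.enlarge {X Y : Type*} [MetricSpace X] [MetricSpace Y] {ε : ℝ}
    (hε : 0 < ε) {R : Set (X × Y)} (h : IsApproximation ε R) :
    ∃ S : Set (X × Y), IsApproximation (5 * ε) S ∧ Prod.fst '' S = Set.univ ∧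
      Prod.snd '' S = Set.univ := by
  obtain ⟨h1, h2, h3⟩ := h
  let S : Set (X × Y) := {q | ∃ r ∈ R, dist q.1 r.1 ≤ ε ∧ dist q.2 r.2 ≤ ε}
  have s1 : ∀ x, ∃ q ∈ S, q.1 = x := fun x => by
    obtain ⟨q, hq, hd⟩ := h1 x
    exact ⟨(x, q.2), ⟨q, hq, hd, by simpa using hε.le⟩, rfl⟩
  have s2 : ∀ y, ∃ q ∈ S, q.2 = y := fun y => by
    obtain ⟨q, hq, hd⟩ := h2 y
    exact ⟨(q.1, y), ⟨q, hq, by simpa using hε.le, hd⟩, rfl⟩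
  refine ⟨S, ⟨fun x => ?_, fun y => ?_, ?_⟩, eq_univ_of_forall s1, eq_univ_of_forall s2⟩
  · obtain ⟨q, hq, rfl⟩ := s1 x
    exact ⟨q, hq, by simpa using hε.le⟩
  · obtain ⟨q, hq, rfl⟩ := s2 y
    exact ⟨q, hq, by simpa using hε.le⟩
  · rintro q ⟨q', hq', a1, a2⟩ r ⟨r', hr', b1, b2⟩
    have h := abs_lt.1 (h3 q' hq' r' hr')
    have e1 := abs_le.1 (abs_dist_sub_le q.1 q'.1 r.1)
    have e2 := abs_le.1 (abs_dist_sub_le r.1 r'.1 q'.1)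
    have e3 := abs_le.1 (abs_dist_sub_le q.2 q'.2 r.2)
    have e4 := abs_le.1 (abs_dist_sub_le r.2 r'.2 q'.2)
    rw [dist_comm r.1 q'.1, dist_comm r'.1 q'.1] at e2
    rw [dist_comm r.2 q'.2, dist_comm r'.2 q'.2] at e4
    rw [abs_lt]
    constructor <;> linarith [h.1, h.2, e1.1, e1.2, e2.1, e2.2, e3.1, e3.2, e4.1, e4.2]

namespace PocSet

/-! ### Surjectivity of the correspondence and convergence of balls -/

section Coarsening

variable {P : Type*} [PocSet P] {B : Set P}

open Fractional

theorem Vertex.finite_diff (U : Vertex B) : (B \ U.1).Finite := by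
  refine ((finite_dualComponent U.2.2).image Subtype.val).subset fun b hb => ?_
  refine ⟨⟨b, hb.1⟩, ?_, rfl⟩
  simp [vertexPoint, hb.2]

/-- The fractional ultrafilter of a vertex. -/
noncomputable def Vertex.frac (U : Vertex B) : Fractional B :=
  ofUltra U.1 U.2.1 U.finite_diff

theorem Vertex.toPoint_eq (hB : IsUltra B) (w : Weight P) (U : Vertex B) :
    U.toPoint w = U.frac.toDual hB w :=
  Subtype.ext (by simp only [Vertex.toPoint, toDual, Vertex.frac, ofUltra_point])

/-- The fractional ultrafilter of the base point. -/
noncomputable def baseFrac (hB : IsUltra B) : Fractional B := ofUltra B hB (by simp)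

theorem baseFrac_of_mem (hB : IsUltra B) {b : P} (hb : b ∈ B) : baseFrac hB b = 1 := if_pos hb

theorem basePoint_eq (hB : IsUltra B) (w : Weight P) :
    basePoint w B = (baseFrac hB).toDual hB w :=
  Subtype.ext (by simp only [basePoint, toDual, baseFrac, ofUltra_point])

theorem basePoint_approx_eq (hB : IsUltra B) (w : Weight P) (n : ℕ) :
    basePoint (approxWeight w n) (approxBase w B n) =
      (subdivide w n (baseFrac hB)).toDual (isUltra_approxBase w hB n) (approxWeight w n) := by
  rw [basePoint_eq (isUltra_approxBase w hB n)]
  refine toDual_eq _ fun c hc => ?_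
  rw [baseFrac_of_mem _ hc]
  rcases c with _ | _ | ⟨p, hp, i⟩
  · rw [Weight.eq_zero_of_not_isProper (a := Refined.bot) _ fun h => h.1 rfl, zero_mul, zero_mul]
  · rfl
  · rw [subdivide_mk, baseFrac_of_mem hB (b := p) hc, ramp_eq_one (by simp)]

/-! ### Points of the approximations correspond to points of the weighted dual -/

section Coarsen

variable {w : Weight P} {n : ℕ} (ξ : Fractional (approxBase w B n))

open Classical in
/-- The degree of the `i`-th element of the chain that replaces `p`. -/
noncomputable def chainDegree (p : P) (i : ℕ) : ℝ :=
  if h : IsProper p ∧ i < floorWeight w n p then ξ (.mk p h.1 ⟨i, h.2⟩) else 0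

/-- The average degree of the elements of the chain that replaces `p`. -/
noncomputable def averageDegree (p : P) : ℝ :=
  (∑ i ∈ Finset.range (floorWeight w n p), chainDegree ξ p i) / floorWeight w n p

theorem isProper_of_floorWeight_pos {p : P} (h : 0 < floorWeight w n p) : IsProper p := by
  by_contra hp
  exact h.ne' (floorWeight_of_not_isProper w n hp)

theorem chainDegree_mem (p : P) (i : ℕ) : 0 ≤ chainDegree ξ p i ∧ chainDegree ξ p i ≤ 1 := by
  unfold chainDegree
  split_ifs
  · exact ⟨ξ.nonneg _, ξ.le_one _⟩
  · simp

theorem mul_averageDegree (p : P) : floorWeight w n p * averageDegree ξ p =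
    ∑ i ∈ Finset.range (floorWeight w n p), chainDegree ξ p i := by
  unfold averageDegree
  rcases (floorWeight w n p).eq_zero_or_pos with h | h
  · simp [h]
  · have : (floorWeight w n p : ℝ) ≠ 0 := by exact_mod_cast h.ne'
    field_simp

theorem averageDegree_nonneg (p : P) : 0 ≤ averageDegree ξ p :=
  div_nonneg (Finset.sum_nonneg fun i _ => (chainDegree_mem ξ p i).1) (Nat.cast_nonneg _)

theorem averageDegree_le_one (p : P) : averageDegree ξ p ≤ 1 := by
  refine div_le_one_of_le₀ ?_ (Nat.cast_nonneg _)
  simpa using Finset.sum_le_card_nsmul (Finset.range (floorWeight w n p)) _ 1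
    fun i _ => (chainDegree_mem ξ p i).2

theorem averageDegree_compl {p : P} (h : 0 < floorWeight w n p) :
    averageDegree ξ pᶜ = 1 - averageDegree ξ p := by
  have hp := isProper_of_floorWeight_pos h
  unfold averageDegree
  rw [floorWeight_compl, ← Finset.sum_range_reflect]
  have : ∀ i ∈ Finset.range (floorWeight w n p),
      chainDegree ξ pᶜ (floorWeight w n p - 1 - i) = 1 - chainDegree ξ p i := by
    intro i hi
    have hi' := Finset.mem_range.1 hi
    have h1 : floorWeight w n p - 1 - i < floorWeight w n pᶜ := by
      rw [floorWeight_compl]; omega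
    unfold chainDegree
    rw [dif_pos ⟨hp.compl, h1⟩, dif_pos ⟨hp, hi'⟩, ← ξ.map_compl]
    rfl
  rw [Finset.sum_congr rfl this, Finset.sum_sub_distrib]
  have hne : (floorWeight w n p : ℝ) ≠ 0 := by exact_mod_cast h.ne'
  simp only [Finset.sum_const, Finset.card_range, nsmul_eq_mul, mul_one]
  field_simp

theorem averageDegree_eq_one {p : P} (h : 0 < floorWeight w n p)
    (h1 : ∀ i hp, ξ (.mk p hp i) = 1) : averageDegree ξ p = 1 := by
  have hne : (floorWeight w n p : ℝ) ≠ 0 := by exact_mod_cast h.ne'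
  unfold averageDegree
  rw [Finset.sum_congr rfl fun i hi => show chainDegree ξ p i = 1 by
    unfold chainDegree
    rw [dif_pos ⟨isProper_of_floorWeight_pos h, Finset.mem_range.1 hi⟩, h1]]
  simp [hne]

theorem averageDegree_nested {p q : P} (hpq : p < q) (hq : 0 < floorWeight w n q) :
    averageDegree ξ p = 0 ∨ averageDegree ξ q = 1 := by
  by_cases h : ∀ i hp, ξ (.mk q hp i) = 1
  · exact Or.inr (averageDegree_eq_one ξ hq h)
  · push Not at h
    obtain ⟨i, hp, h⟩ := h
    left
    unfold averageDegree
    rw [Finset.sum_eq_zero, zero_div]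
    intro j _
    unfold chainDegree
    split_ifs with hj
    · exact (ξ.nested _ _ (Refined.mk_lt_mk.2 (Or.inl hpq))).resolve_right h
    · rfl

theorem finite_averageDegree :
    {a | a ∈ B ∧ 0 < floorWeight w n a ∧ averageDegree ξ a ≠ 1}.Finite := by
  refine (ξ.finite.image (Refined.proj _ _)).subset ?_
  rintro a ⟨ha, hu, h⟩
  have : ∃ i hp, ξ (.mk a hp i) ≠ 1 := by
    by_contra hcon
    push Not at hcon
    exact h (averageDegree_eq_one ξ hu hcon)
  obtain ⟨i, hp, h⟩ := this
  exact ⟨_, ⟨ha, h⟩, rfl⟩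

/-- The wall of `a` is crossed: some vertex `U` omits `a`, hence omits everything below `a`, and `B
\ U` is finite. This is what walls crossing the component is needed for. -/
theorem finite_below (hX : WallsCross w B) {a : P} (ha : a ∈ B)
    (hu : 0 < floorWeight w n a) : {c | c ∈ B ∧ c ≤ a}.Finite := by
  have hw : 0 < w a := by
    refine lt_of_le_of_ne (w.nonneg a) fun h => hu.ne' ?_
    simp [floorWeight, ← h]
  obtain ⟨U, hU⟩ := hX a (isProper_of_floorWeight_pos hu) hw
  refine U.finite_diff.subset fun c hc => ⟨hc.1, fun h => ?_⟩
  exact hU.1 (U.2.1.mem_of_le h hc.2) ha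

open Classical in
/-- The extension of the average degrees to the elements of `B` that are deleted. -/
noncomputable def extendedDegree (c : P) : ℝ :=
  if 0 < floorWeight w n c then averageDegree ξ c
  -- A deleted element must have degree zero below a surviving element of degree less than one.
  -- Degree one everywhere else keeps the support finite.
  else if ∃ a ∈ B, 0 < floorWeight w n a ∧ averageDegree ξ a ≠ 1 ∧ c < a then 0 else 1

/-- A degree less than one is always witnessed by a surviving element above; this reduces nestedness
and finiteness to the average degrees. -/
theorem exists_of_extendedDegree_ne_one {c : P} (hc : c ∈ B) (h : extendedDegree ξ c ≠ 1) :
    ∃ a ∈ B, 0 < floorWeight w n a ∧ averageDegree ξ a ≠ 1 ∧ c ≤ a := by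
  unfold extendedDegree at h
  split_ifs at h with h1 h2
  · exact ⟨c, hc, h1, h, le_rfl⟩
  · obtain ⟨a, ha, h3, h4, h5⟩ := h2
    exact ⟨a, ha, h3, h4, h5.le⟩
  · exact absurd rfl h

theorem extendedDegree_nested {a b : P} (hb : b ∈ B) (hab : a < b) :
    extendedDegree ξ a = 0 ∨ extendedDegree ξ b = 1 := by
  by_cases h : extendedDegree ξ b = 1
  · exact Or.inr h
  · left
    obtain ⟨c, hc, h1, h2, h3⟩ := exists_of_extendedDegree_ne_one ξ hb h
    have hac := hab.trans_le h3
    unfold extendedDegree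
    split_ifs with i1 i2
    · exact (averageDegree_nested ξ hac h1).resolve_right h2
    · rfl
    · exact absurd ⟨c, hc, h1, h2, hac⟩ i2

theorem extendedDegree_mem (c : P) : 0 ≤ extendedDegree ξ c ∧ extendedDegree ξ c ≤ 1 := by
  unfold extendedDegree
  split_ifs
  · exact ⟨averageDegree_nonneg ξ c, averageDegree_le_one ξ c⟩
  · simp
  · simp

open Classical in
/-- A fractional ultrafilter of `P` whose subdivision is `ξ`. -/
noncomputable def coarsen (hB : IsUltra B) (hX : WallsCross w B) : Fractional B where
  toFun a := if a ∈ B then extendedDegree ξ a else 1 - extendedDegree ξ aᶜ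
  nonneg a := by
    have h1 := (extendedDegree_mem ξ a).1
    have h2 := (extendedDegree_mem ξ aᶜ).2
    split_ifs <;> linarith
  map_compl a := by
    simp only [hB.1.compl_mem_iff, compl_invol]
    split_ifs <;> simp
  nested a b hab := by
    by_cases ha : a ∈ B
    · have hb := hB.mem_of_le ha hab.le
      simp only [ha, hb, if_true]
      exact extendedDegree_nested ξ hb hab
    · have ha' := hB.1.compl_mem_iff.2 ha
      by_cases hb : b ∈ B
      · simp only [ha, hb, if_true, if_false]
        -- Surviving witnesses `c ≥ aᶜ` and `d ≥ b` satisfy `cᶜ < d`, against the nestedness of the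
        -- averages.
        by_contra hcon
        push Not at hcon
        obtain ⟨c, -, hc1, hc2, hc3⟩ :=
          exists_of_extendedDegree_ne_one ξ ha' fun h => hcon.1 (by rw [h, sub_self])
        obtain ⟨d, -, hd1, hd2, hd3⟩ := exists_of_extendedDegree_ne_one ξ hb hcon.2
        have hcd : cᶜ < d := by
          have := compl_anti _ _ hc3
          rw [compl_invol] at this
          exact this.trans_lt (hab.trans_le hd3)
        rcases averageDegree_nested ξ hcd hd1 with h | h
        · rw [averageDegree_compl ξ hc1] at h
          exact hc2 (by linarith)
        · exact hd2 h
      · simp only [ha, hb, if_false]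
        rcases extendedDegree_nested ξ ha' (compl_lt_compl hab) with h | h
        · right; rw [h, sub_zero]
        · left; rw [h, sub_self]
  finite := by
    refine ((finite_averageDegree ξ).biUnion (t := fun a => {c | c ∈ B ∧ c ≤ a})
      fun a ha => finite_below hX ha.1 ha.2.1).subset ?_
    rintro b ⟨hb, h⟩
    rw [if_pos hb] at h
    obtain ⟨a, ha, h1, h2, h3⟩ := exists_of_extendedDegree_ne_one ξ hb h
    exact mem_biUnion (show a ∈ {a | a ∈ B ∧ 0 < floorWeight w n a ∧ averageDegree ξ a ≠ 1} from
      ⟨ha, h1, h2⟩) ⟨hb, h3⟩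

theorem corresponds_coarsen (hB : IsUltra B) (hX : WallsCross w B) :
    Corresponds (ξ.toDual (isUltra_approxBase w hB n) (approxWeight w n))
      ((coarsen ξ hB hX).toDual hB w) := by
  rw [corresponds_iff]
  intro b hp hb
  have e : ∑ i, ξ (.mk b hp i) = floorWeight w n b * coarsen ξ hB hX b := by
    rcases (floorWeight w n b).eq_zero_or_pos with h | h
    · have : IsEmpty (Fin (floorWeight w n b)) := by rw [h]; infer_instance
      rw [Finset.univ_eq_empty, Finset.sum_empty, h, Nat.cast_zero, zero_mul]
    · have : coarsen ξ hB hX b = averageDegree ξ b := (if_pos hb).trans (if_pos h)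
      rw [this, mul_averageDegree, ← Fin.sum_univ_eq_sum_range]
      refine Finset.sum_congr rfl fun i _ => ?_
      unfold chainDegree
      rw [dif_pos ⟨hp, i.2⟩]
  rw [e]
  ring

end Coarsen

theorem exists_subdivide (hB : IsUltra B) {w : Weight P} (hX : WallsCross w B) {n : ℕ}
    (z : WeightedDual (approxWeight w n) (approxBase w B n)) :
    ∃ μ : Fractional B,
      z = (subdivide w n μ).toDual (isUltra_approxBase w hB n) (approxWeight w n) := by
  obtain ⟨ξ, rfl⟩ := exists_toDual (isUltra_approxBase w hB n) z
  exact ⟨_, eq_subdivide_of_corresponds hB w _ _ (corresponds_coarsen ξ hB hX)⟩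

/-! ### Convergence of balls -/

/-- The ball is compact, so it has a finite ε/5-net, and for the finitely many pairs of the net the
rounding error is eventually below ε/5. Replacing μ and ν by points of the net costs 2ε/5 in X, and
again 2ε/5 in the approximation, as subdivision is 1-Lipschitz. -/
theorem eventually_distortion (hB : IsUltra B) (w : Weight P) (p : Ell)
    [ProperSpace (Cubing p w B)] (R : ℝ) {ε : ℝ} (hε : 0 < ε) :
    ∃ N : ℕ, ∀ n ≥ N, ∀ μ ν : Fractional B, pdist p hB w μ (baseFrac hB) ≤ R →
      pdist p hB w ν (baseFrac hB) ≤ R →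
      pdist p hB w μ ν < pdist p (isUltra_approxBase w hB n) (approxWeight w n)
        (subdivide w n μ) (subdivide w n ν) + ε := by
  let b : Cubing p w B := (baseFrac hB).toDual hB w
  have hc := isCompact_closedBall b R
  obtain ⟨t, ht, hcov⟩ := Metric.totallyBounded_iff.1 hc.totallyBounded (ε / 5) (by positivity)
  have hrep : ∀ y : Cubing p w B, ∃ μ : Fractional B, μ.toDual hB w = y :=
    fun y => exists_toDual hB y
  choose rep hrep using hrep
  have hev : ∀ᶠ n : ℕ in atTop, ∀ y ∈ t, ∀ y' ∈ t,
      1 / (n : ℝ) * pdist p hB (constWeight P 1 zero_le_one) (rep y) (rep y') < ε / 5 := by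
    rw [eventually_all_finite ht]
    intro y _
    rw [eventually_all_finite ht]
    intro y' _
    have := (tendsto_one_div_atTop_nhds_zero_nat (𝕜 := ℝ)).mul_const
      (pdist p hB (constWeight P 1 zero_le_one) (rep y) (rep y'))
    rw [zero_mul] at this
    exact this.eventually_lt_const (by positivity)
  obtain ⟨N, hN⟩ := eventually_atTop.1 hev
  refine ⟨max N 1, fun n hn μ ν hμ hν => ?_⟩
  have hn0 : 0 < n := (le_max_right _ _).trans hn
  have hnet : ∀ μ : Fractional B, pdist p hB w μ (baseFrac hB) ≤ R →
      ∃ y ∈ t, pdist p hB w μ (rep y) < ε / 5 := by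
    intro μ hμ
    obtain ⟨y, hy, h⟩ := mem_iUnion₂.1
      (hcov (show (μ.toDual hB w : Cubing p w B) ∈ Metric.closedBall b R from hμ))
    refine ⟨y, hy, ?_⟩
    unfold pdist
    rw [hrep y]
    exact h
  obtain ⟨y, hy, h1⟩ := hnet μ hμ
  obtain ⟨y', hy', h2⟩ := hnet ν hν
  have h3 := hN n ((le_max_left _ _).trans hn) y hy y' hy'
  have h4 := pdist_le_subdivide_add p hB w hn0 (rep y) (rep y')
  have h5 := pdist_subdivide_le p hB w n μ (rep y)
  have h6 := pdist_subdivide_le p hB w n ν (rep y')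
  have hBn := isUltra_approxBase w hB n
  have t1 := pdist_triangle p hB w μ (rep y) ν
  have t2 := pdist_triangle p hB w (rep y) (rep y') ν
  rw [pdist_comm p hB w (rep y') ν] at t2
  have t3 := pdist_triangle p hBn (approxWeight w n) (subdivide w n (rep y)) (subdivide w n μ)
    (subdivide w n (rep y'))
  have t4 := pdist_triangle p hBn (approxWeight w n) (subdivide w n μ) (subdivide w n ν)
    (subdivide w n (rep y'))
  rw [pdist_comm p hBn _ (subdivide w n (rep y)) (subdivide w n μ)] at t3
  linarith

/-- The sum of a weight and a multiple of another one. -/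
def Weight.addMul (w w' : Weight P) (c : ℝ) (hc : 0 ≤ c) : Weight P where
  toFun a := w a + c * w' a
  nonneg a := add_nonneg (w.nonneg a) (mul_nonneg hc (w'.nonneg a))
  map_bot := by simp [w.map_bot, w'.map_bot]
  map_compl a := by rw [w.map_compl, w'.map_compl]

theorem pdist_le_mul (p : Ell) (hB : IsUltra B) {w w' : Weight P} {c : ℝ} (hc : 0 ≤ c)
    (h : ∀ a, w a ≤ c * w' a) (μ ν : Fractional B) :
    pdist p hB w μ ν ≤ c * pdist p hB w' μ ν := by
  have hz : ∀ a, constWeight P 0 le_rfl a = 0 := fun a => by simp [constWeight]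
  have h1 := pdist_le_add p hB (w := w) (w₁ := constWeight P 0 le_rfl) (w₂ := w') hc
    (fun a => by rw [hz, zero_add]; exact h a) μ ν
  have h2 : pdist p hB (constWeight P 0 le_rfl) μ ν = 0 := by
    unfold pdist
    rw [toDual_eq hB (ν := ν) fun a _ => by rw [hz, zero_mul, zero_mul]]
    exact dist_self _
  linarith

/-- A point of the ball in the approximation may come from a μ far outside the ball of X. The
desired κ is where a flow from the base point to μ leaves the ball of X. By the distortion bound it
is nearly at distance `R` in the approximation too, and since the whole flow has length little more
than `R` there, little of it remains. -/
theorem exists_close_in_ball (hB : IsUltra B) (w : Weight P) (p : Ell) {R ε : ℝ} (hR : 0 < R)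
    (hε : 0 < ε) {n : ℕ}
    (hn : ∀ μ ν : Fractional B, pdist p hB w μ (baseFrac hB) ≤ R →
      pdist p hB w ν (baseFrac hB) ≤ R →
      pdist p hB w μ ν < pdist p (isUltra_approxBase w hB n) (approxWeight w n)
        (subdivide w n μ) (subdivide w n ν) + ε / 2)
    (μ : Fractional B) (hμ : pdist p (isUltra_approxBase w hB n) (approxWeight w n)
      (subdivide w n μ) (subdivide w n (baseFrac hB)) ≤ R) :
    ∃ κ : Fractional B, pdist p hB w κ (baseFrac hB) ≤ R ∧
      pdist p (isUltra_approxBase w hB n) (approxWeight w n)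
        (subdivide w n μ) (subdivide w n κ) ≤ ε := by
  set β := baseFrac hB
  by_cases hle : pdist p hB w μ β ≤ R
  · refine ⟨μ, hle, ?_⟩
    have : pdist p (isUltra_approxBase w hB n) (approxWeight w n)
        (subdivide w n μ) (subdivide w n μ) = 0 := dist_self _
    rw [this]
    exact hε.le
  push Not at hle
  set K := pdist p hB w β μ with hK
  have hK0 : 0 ≤ K := pdist_nonneg p hB w β μ
  set δ := ε / (2 * (K + 1)) with hδ
  have hδ0 : 0 < δ := by positivity
  have hδK : δ * K ≤ ε / 2 := by
    have : δ * (K + 1) = ε / 2 := by rw [hδ]; field_simp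
    nlinarith
  -- The rounded weight alone would let the flow jump across walls that round to zero. The summand δ
  -- w makes it continuous for the w-distance, and δ K ≤ ε/2 keeps it almost geodesic for the
  -- rounded weight.
  let w' := (roundWeight w n).addMul w δ hδ0.le
  have hw1 : ∀ a, roundWeight w n a ≤ w' a := fun a =>
    le_add_of_nonneg_right (mul_nonneg hδ0.le (w.nonneg a))
  have hw2 : ∀ μ ν, pdist p hB w μ ν ≤ 1 / δ * pdist p hB w' μ ν := by
    intro μ ν
    refine pdist_le_mul p hB (by positivity) (fun a => ?_) μ ν
    have h1 : 1 / δ * w' a = 1 / δ * roundWeight w n a + w a := by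
      simp only [w', Weight.addMul]
      field_simp
    have h2 : 0 ≤ 1 / δ * roundWeight w n a := mul_nonneg (by positivity) (Weight.nonneg _ _)
    linarith
  have hw3 : pdist p hB w' β μ ≤ pdist p hB (roundWeight w n) β μ + δ * K :=
    pdist_le_add p hB hδ0.le (fun a => le_rfl) β μ
  set L := ellInf (β.toDual hB w') (μ.toDual hB w') with hL
  have hL0 : 0 ≤ L := pdist_nonneg .infty hB w' β μ
  have e0 : pdist p hB w β (flow hB w' β μ 0) = 0 := by
    have h1 := hw2 β (flow hB w' β μ 0)
    have h2 : pdist p hB w' β (flow hB w' β μ 0) = 0 := by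
      unfold pdist
      rw [toDual_flow_zero]
      exact dist_self _
    rw [h2, mul_zero] at h1
    exact le_antisymm h1 (pdist_nonneg _ _ _ _ _)
  have e1 : pdist p hB w (flow hB w' β μ L) μ = 0 := by
    have h1 := hw2 (flow hB w' β μ L) μ
    have h2 : pdist p hB w' (flow hB w' β μ L) μ = 0 := by
      unfold pdist
      rw [toDual_flow_of_le hB w' le_rfl]
      exact dist_self _
    rw [h2, mul_zero] at h1
    exact le_antisymm h1 (pdist_nonneg _ _ _ _ _)
  obtain ⟨C, hC0, hC⟩ := exists_pdist_flow_le hB w' β μ p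
  have hcont : Continuous fun t => pdist p hB w β (flow hB w' β μ t) := by
    refine (LipschitzWith.of_dist_le' (K := 1 / δ * C) fun s t => ?_).continuous
    have key : ∀ s t, s ≤ t → dist (pdist p hB w β (flow hB w' β μ s))
        (pdist p hB w β (flow hB w' β μ t)) ≤ 1 / δ * C * dist s t := by
      intro s t hst
      have h1 := pdist_triangle p hB w β (flow hB w' β μ s) (flow hB w' β μ t)
      have h2 := pdist_triangle p hB w β (flow hB w' β μ t) (flow hB w' β μ s)
      rw [pdist_comm p hB w (flow hB w' β μ t)] at h2
      have h3 := (hw2 (flow hB w' β μ s) (flow hB w' β μ t)).trans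
        (mul_le_mul_of_nonneg_left (hC s t hst) (by positivity))
      rw [Real.dist_eq, Real.dist_eq, abs_sub_comm s t, abs_of_nonneg (sub_nonneg.2 hst), abs_le,
        mul_assoc]
      constructor <;> linarith
    rcases le_total s t with h | h
    · exact key s t h
    · rw [dist_comm, dist_comm s t]
      exact key t s h
  have hend : R ≤ pdist p hB w β (flow hB w' β μ L) := by
    have := pdist_triangle p hB w β (flow hB w' β μ L) μ
    rw [pdist_comm] at hle
    linarith
  -- The w-distance from the base point is continuous along the flow; it starts at 0 and ends above
  -- `R`.
  obtain ⟨t, ht, hft⟩ := intermediate_value_Icc hL0 hcont.continuousOn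
    (show R ∈ Icc _ _ from ⟨by simp only [e0]; exact hR.le, hend⟩)
  simp only at hft
  have hself : pdist p hB w β β = 0 := dist_self _
  refine ⟨flow hB w' β μ t, by rw [pdist_comm, hft], ?_⟩
  have h1 := hn β (flow hB w' β μ t) (by rw [hself]; exact hR.le) (by rw [pdist_comm, hft])
  have h2 := pdist_flow_add hB w' p ht.1 ht.2
  -- For the rounded weight the rest of the flow has length at most (R + ε/2) - (R - ε/2).
  have h3 := pdist_mono p hB hw1 β (flow hB w' β μ t)
  have h4 := pdist_mono p hB hw1 (flow hB w' β μ t) μ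
  rw [pdist_comm, pdist_subdivide p hB] at hμ ⊢
  rw [pdist_subdivide p hB] at h1
  linarith

theorem exists_isApproximation (hB : IsUltra B) (w : Weight P) (p : Ell) (hX : WallsCross w B)
    [ProperSpace (Cubing p w B)] {R : ℝ} (hR : 0 < R) {ε : ℝ} (hε : 0 < ε) :
    ∃ N : ℕ, ∀ n ≥ N, IsApproximation ε
      {q : Metric.closedBall (α := ApproxCubing p w B n)
            (basePoint (approxWeight w n) (approxBase w B n)) R ×
          Metric.closedBall (α := Cubing p w B) (basePoint w B) R |
        Corresponds q.1.1 q.2.1} := by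
  obtain ⟨N, hN⟩ := eventually_distortion hB w p R (half_pos hε)
  refine ⟨N, fun n hn => ?_⟩
  have hdist := hN n hn
  have hBn := isUltra_approxBase w hB n
  have mem1 : ∀ μ : Fractional B,
      ((subdivide w n μ).toDual hBn (approxWeight w n) : ApproxCubing p w B n) ∈
        Metric.closedBall (α := ApproxCubing p w B n)
          (basePoint (approxWeight w n) (approxBase w B n)) R ↔
      pdist p hBn (approxWeight w n) (subdivide w n μ) (subdivide w n (baseFrac hB)) ≤ R := by
    intro μ
    rw [basePoint_approx_eq hB]
    rfl
  have mem2 : ∀ μ : Fractional B, (μ.toDual hB w : Cubing p w B) ∈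
      Metric.closedBall (α := Cubing p w B) (basePoint w B) R ↔
      pdist p hB w μ (baseFrac hB) ≤ R := by
    intro μ
    rw [basePoint_eq hB]
    rfl
  refine ⟨?_, ?_, ?_⟩
  · rintro ⟨z, hz⟩
    obtain ⟨μ, rfl⟩ := exists_subdivide hB hX z
    obtain ⟨κ, hκ, hd⟩ := exists_close_in_ball hB w p hR hε hdist μ ((mem1 μ).1 hz)
    exact ⟨⟨⟨_, (mem1 κ).2 ((pdist_subdivide_le p hB w n _ _).trans hκ)⟩, ⟨_, (mem2 κ).2 hκ⟩⟩,
      corresponds_subdivide hB w n κ, hd⟩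
  · rintro ⟨x, hx⟩
    obtain ⟨μ, rfl⟩ := exists_toDual hB x
    exact ⟨⟨⟨_, (mem1 μ).2 ((pdist_subdivide_le p hB w n _ _).trans ((mem2 μ).1 hx))⟩, ⟨_, hx⟩⟩,
      corresponds_subdivide hB w n μ, by simpa using hε.le⟩
  · rintro ⟨⟨z, hz⟩, ⟨x, hx⟩⟩ hq ⟨⟨z', hz'⟩, ⟨x', hx'⟩⟩ hr
    obtain ⟨μ, rfl⟩ := exists_toDual hB x
    obtain ⟨ν, rfl⟩ := exists_toDual hB x'
    obtain rfl := eq_subdivide_of_corresponds hB w μ z hq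
    obtain rfl := eq_subdivide_of_corresponds hB w ν z' hr
    have h1 := hdist μ ν ((mem2 μ).1 hx) ((mem2 ν).1 hx')
    have h2 := pdist_subdivide_le p hB w n μ ν
    change |pdist p hBn (approxWeight w n) (subdivide w n μ) (subdivide w n ν) -
      pdist p hB w μ ν| < ε
    rw [abs_lt]
    constructor <;> linarith

theorem pointedGHConverges (hB : IsUltra B) (w : Weight P) (p : Ell) (hX : WallsCross w B)
    [ProperSpace (Cubing p w B)] :
    PointedGHConverges (X := fun n => ApproxCubing p w B n) (Y := Cubing p w B)
      (fun n => basePoint (approxWeight w n) (approxBase w B n)) (basePoint w B) := by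
  intro R hR ε hε
  obtain ⟨N, hN⟩ := exists_isApproximation hB w p hX hR (ε := ε / 5) (by positivity)
  refine ⟨N, fun n hn => ?_⟩
  obtain ⟨S, h1, h2⟩ := (hN n hn).enlarge (by positivity)
  rw [mul_div_cancel₀ ε (by norm_num)] at h1
  exact ⟨S, h1, h2⟩

end Coarsening

/-! ### Normal cube paths and the lengths of chains -/

section NormalPaths

variable {P : Type*} [PocSet P] {B : Set P}

open Fractional

theorem IsUltra.eq_of_subset {U V : Set P} (hU : IsUltra U) (hV : IsUltra V) (h : U ⊆ V) :
    U = V := by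
  refine h.antisymm fun a ha => ?_
  by_contra hn
  exact hV.1.compl_mem_iff.1 (h (hU.1.compl_mem_iff.2 hn)) ha

theorem Vertex.frac_of_mem {U : Vertex B} {a : P} (h : a ∈ U.1) : U.frac a = 1 := if_pos h

theorem Vertex.frac_of_notMem {U : Vertex B} {a : P} (h : a ∉ U.1) : U.frac a = 0 := if_neg h

theorem Vertex.drop_frac (U V : Vertex B) : drop U.frac V.frac = U.1 \ V.1 := by
  ext a
  by_cases h1 : a ∈ U.1 <;> by_cases h2 : a ∈ V.1 <;>
    simp [drop, h1, h2, Vertex.frac_of_mem, Vertex.frac_of_notMem]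

theorem Vertex.finite_sdiff (hB : IsUltra B) (U V : Vertex B) : (U.1 \ V.1).Finite := by
  rw [← Vertex.drop_frac]
  exact finite_drop hB.1 _ _

/-- An ultrafilter that contains almost all of `B` is a vertex of the component of `B`. -/
def Vertex.ofUltra (hB : IsUltra B) (U : Set P) (hU : IsUltra U) (hf : (B \ U).Finite) :
    Vertex B :=
  ⟨U, hU, by
    rw [← ofUltra_point U hU hf]
    exact (Fractional.ofUltra U hU hf).point_mem hB⟩

/-- A conflict between a kept `c` and the complement of a flipped `m` means `c ≤ m`. If `c ∈ V`,
then `m ∈ V`; otherwise minimality of `m` gives `c = m`. The complements of two flipped elements lie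
in `V` and are coherent. -/
theorem isUltra_flip_minimal {U V : Set P} (hU : IsUltra U) (hV : IsUltra V) :
    IsUltra (flip U {a | Minimal (· ∈ U \ V) a}) := by
  have key : ∀ c m, c ∈ U → ¬ Minimal (· ∈ U \ V) c → Minimal (· ∈ U \ V) m → c ≤ m → False := by
    intro c m hc hcm hm hle
    by_cases hcV : c ∈ V
    · exact hm.prop.2 (hV.mem_of_le hcV hle)
    · have := hm.eq_of_le ⟨hc, hcV⟩ hle
      exact hcm (this ▸ hm)
  refine ⟨hU.1.flip fun a ha => ha.prop.1, ?_⟩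
  rintro c (⟨hc, hcm⟩ | hc) d (⟨hd, hdm⟩ | hd) hle
  · exact hU.2 c hc d hd hle
  · exact key c _ hc hcm hd hle
  · refine key d _ hd hdm hc ?_
    have := compl_anti _ _ hle
    rwa [compl_invol] at this
  · have hc' := hV.1.compl_mem_iff.2 hc.prop.2
    have hd' := hV.1.compl_mem_iff.2 hd.prop.2
    rw [compl_invol] at hc' hd'
    exact hV.2 c hc' d hd' hle

theorem sdiff_flip_minimal {U V : Set P} (hU : IsUltra U) :
    U \ flip U {a | Minimal (· ∈ U \ V) a} = {a | Minimal (· ∈ U \ V) a} := by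
  ext c
  constructor
  · rintro ⟨hc, h⟩
    by_contra hn
    exact h (Or.inl ⟨hc, hn⟩)
  · intro hc
    refine ⟨hc.prop.1, ?_⟩
    rintro (h | h)
    · exact h.2 hc
    · exact hU.1.compl_mem_iff.1 h.prop.1 hc.prop.1

/-- Flipping the minimal elements of `U \ V` strictly decreases this finite set, because the new
elements belong to `V`. -/
theorem exists_isNormalCubePath (hB : IsUltra B) (U V : Vertex B) :
    ∃ (v : ℕ → Vertex B) (m : ℕ), v 0 = U ∧ v m = V ∧ IsNormalCubePath v m := by
  obtain ⟨k, hk⟩ : ∃ k, (U.1 \ V.1).ncard = k := ⟨_, rfl⟩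
  induction k using Nat.strong_induction_on generalizing U with
  | _ k ih =>
  rcases (U.1 \ V.1).eq_empty_or_nonempty with he | hne
  · have : U = V := Subtype.ext (U.2.1.eq_of_subset V.2.1 (sdiff_eq_empty.1 he))
    exact ⟨fun _ => U, 0, rfl, this, fun i hi => absurd hi (Nat.not_lt_zero i)⟩
  · have hfin := Vertex.finite_sdiff hB U V
    let M : Set P := {a | Minimal (· ∈ U.1 \ V.1) a}
    have hUM : U.1 \ flip U.1 M = M := sdiff_flip_minimal U.2.1
    let W : Vertex B := Vertex.ofUltra hB (flip U.1 M) (isUltra_flip_minimal U.2.1 V.2.1) (by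
      refine (U.finite_diff.union (hfin.subset (show M ⊆ _ from fun a ha => ha.1))).subset ?_
      intro b hb
      by_cases h : b ∈ U.1
      · exact Or.inr (hUM ▸ ⟨h, hb.2⟩)
      · exact Or.inl ⟨hb.1, h⟩)
    have hsub : W.1 \ V.1 ⊆ U.1 \ V.1 := by
      rintro c ⟨h | h, hV⟩
      · exact ⟨h.1, hV⟩
      · exact absurd (V.2.1.1.compl_mem_iff.2 h.prop.2) (by rwa [compl_invol])
    have hlt : (W.1 \ V.1).ncard < k := by
      rw [← hk]
      refine ncard_lt_ncard (hsub.ssubset_of_ne fun e => ?_) hfin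
      obtain ⟨a, -, ha⟩ := hfin.exists_le_minimal hne.some_mem
      have h1 : a ∈ W.1 \ V.1 := e ▸ ha.prop
      have h2 : a ∈ U.1 \ W.1 := hUM.symm ▸ ha
      exact h2.2 h1.1
    obtain ⟨v, m, h0, hm, hv⟩ := ih _ hlt W rfl
    refine ⟨fun i => Nat.casesOn i U v, m + 1, rfl, hm, fun i hi => ?_⟩
    rcases i with _ | i
    · simp only [h0, hm]
      have hUV : U ≠ V := fun e => hne.ne_empty (sdiff_eq_empty.2 (e ▸ subset_rfl))
      exact ⟨hUV, hUM⟩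
    · exact hv i (by omega)

section

variable {v : ℕ → Vertex B} {m : ℕ} (hv : IsNormalCubePath v m)

include hv

theorem IsNormalCubePath.sdiff_succ_subset {i : ℕ} (hi : i < m) :
    (v (i + 1)).1 \ (v m).1 ⊆ (v i).1 \ (v m).1 := by
  rintro c ⟨hc, hcV⟩
  refine ⟨?_, hcV⟩
  by_contra hn
  have h1 : cᶜ ∈ (v i).1 \ (v (i + 1)).1 :=
    ⟨(v i).2.1.1.compl_mem_iff.2 hn, fun h => (v (i + 1)).2.1.1.compl_mem_iff.1 h hc⟩
  rw [(hv i hi).2] at h1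
  exact h1.prop.2 ((v m).2.1.1.compl_mem_iff.2 hcV)

theorem IsNormalCubePath.sdiff_subset {k : ℕ} (hk : k ≤ m) :
    (v k).1 \ (v m).1 ⊆ (v 0).1 \ (v m).1 := by
  induction k with
  | zero => exact subset_rfl
  | succ k ih => exact (hv.sdiff_succ_subset hk).trans (ih (by omega))

/-- The elements above a long chain are not crossed early. -/
theorem IsNormalCubePath.mem_of_chain {k : ℕ} (hk : k ≤ m) {c : P} (hc : c ∉ (v m).1)
    {C : Finset P} (hC : IsChain (· ≤ ·) (C : Set P)) (hCU : (C : Set P) ⊆ (v 0).1)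
    (hle : ∀ d ∈ C, d ≤ c) (hcard : k + 1 ≤ C.card) : c ∈ (v k).1 := by
  classical
  induction k generalizing c C with
  | zero =>
    obtain ⟨d, hd⟩ := Finset.card_pos.1 (Nat.lt_of_lt_of_le Nat.zero_lt_one hcard)
    exact (v 0).2.1.mem_of_le (hCU hd) (hle d hd)
  | succ k ih =>
    have max_le : ∀ D : Finset P, D ⊆ C → D.Nonempty → ∃ t ∈ D, ∀ d ∈ D, d ≤ t := by
      intro D hD hne
      obtain ⟨t, ht⟩ := D.exists_maximal hne
      refine ⟨t, ht.prop, fun d hd => ?_⟩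
      by_cases e : d = t
      · exact e.le
      · exact (hC (hD hd) (hD ht.prop) e).elim id fun h => ht.le_of_ge hd h
    obtain ⟨t, ht, hmax⟩ := max_le C subset_rfl (Finset.card_pos.1 (by omega))
    have hcard' : k + 1 ≤ (C.erase t).card := by
      rw [Finset.card_erase_of_mem ht]
      omega
    obtain ⟨s, hs, hmax'⟩ := max_le (C.erase t) (Finset.erase_subset _ _)
      (Finset.card_pos.1 (by omega))
    have hst : s < t := lt_of_le_of_ne (hmax s (Finset.mem_of_mem_erase hs))
      (Finset.ne_of_mem_erase hs)
    have hsc : s < c := hst.trans_le (hle t ht)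
    have hsV : s ∉ (v m).1 := fun h => hc ((v m).2.1.mem_of_le h hsc.le)
    have hC' : IsChain (· ≤ ·) ((C.erase t : Finset P) : Set P) :=
      hC.mono (by simp)
    have hCU' : ((C.erase t : Finset P) : Set P) ⊆ (v 0).1 :=
      Subset.trans (by simp) hCU
    -- Without its top `t` the chain still keeps both `s` and `c` up to step `k`. As `s < c` is yet
    -- to be crossed, `c` is not minimal and survives the step.
    have h1 := ih (by omega) hsV hC' hCU' hmax' hcard'
    have h2 := ih (by omega) hc hC' hCU' (fun d hd => hle d (Finset.mem_of_mem_erase hd)) hcard'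
    by_contra hn
    have h3 : c ∈ (v k).1 \ (v (k + 1)).1 := ⟨h2, hn⟩
    rw [(hv k hk).2] at h3
    exact h3.not_lt ⟨h1, hsV⟩ hsc

/-- The elements that are not crossed early are above long chains. -/
theorem IsNormalCubePath.exists_chain {k : ℕ} (hk : k ≤ m) {c : P} (hc : c ∈ (v k).1 \ (v m).1) :
    ∃ C : Finset P, IsChain (· ≤ ·) (C : Set P) ∧ (C : Set P) ⊆ (v 0).1 \ (v m).1 ∧
      (∀ d ∈ C, d ≤ c) ∧ C.card = k + 1 := by
  classical
  induction k generalizing c with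
  | zero => exact ⟨{c}, by simp, by simpa using hc, by simp, by simp⟩
  | succ k ih =>
    have h1 := hv.sdiff_succ_subset hk hc
    -- That `c` survives step `k` means that something smaller remained to be crossed; the chain
    -- below that element is prolonged by `c`.
    have h2 : ¬ Minimal (· ∈ (v k).1 \ (v m).1) c := by
      intro h
      have h3 : c ∈ (v k).1 \ (v (k + 1)).1 := by
        rw [(hv k hk).2]
        exact h
      exact h3.2 hc.1
    rw [not_minimal_iff_exists_lt h1] at h2
    obtain ⟨d, hdc, hd⟩ := h2
    obtain ⟨C, hC, hsub, hle, hcard⟩ := ih (by omega) hd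
    refine ⟨insert c C, ?_, ?_, ?_, ?_⟩
    · rw [Finset.coe_insert]
      exact hC.insert fun b hb _ => Or.inr ((hle b hb).trans hdc.le)
    · rw [Finset.coe_insert]
      exact insert_subset (hv.sdiff_subset hk hc) hsub
    · intro b hb
      rcases Finset.mem_insert.1 hb with rfl | hb
      · exact le_rfl
      · exact (hle b hb).trans hdc.le
    · rw [Finset.card_insert_of_notMem fun h => ((hle c h).trans_lt hdc).false, hcard]

theorem IsNormalCubePath.card_le {C : Finset P} (hC : IsChain (· ≤ ·) (C : Set P))
    (hsub : (C : Set P) ⊆ (v 0).1 \ (v m).1) : C.card ≤ m := by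
  by_contra hlt
  push Not at hlt
  obtain ⟨t, ht⟩ := C.exists_maximal (Finset.card_pos.1 (by omega))
  refine (hsub ht.prop).2 (hv.mem_of_chain le_rfl (hsub ht.prop).2 hC (fun d hd => (hsub hd).1)
    (fun d hd => ?_) hlt)
  by_cases e : d = t
  · exact e.le
  · exact (hC hd ht.prop e).elim id fun h => ht.le_of_ge hd h

/-- An element crossed in the last step sits on top of a chain of `m` elements. With `card_le`, the
number of steps is the maximal length of a chain to be crossed. -/
theorem IsNormalCubePath.exists_chain_card_eq :
    ∃ C : Finset P, IsChain (· ≤ ·) (C : Set P) ∧ (C : Set P) ⊆ (v 0).1 \ (v m).1 ∧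
      C.card = m := by
  rcases m with _ | m
  · exact ⟨∅, by simp, by simp, rfl⟩
  · have hne := (hv m (Nat.lt_succ_self m)).1
    obtain ⟨c, hc⟩ : ((v m).1 \ (v (m + 1)).1).Nonempty := by
      rw [Set.nonempty_iff_ne_empty]
      exact fun e => hne (Subtype.ext
        ((v m).2.1.eq_of_subset (v (m + 1)).2.1 (sdiff_eq_empty.1 e)))
    obtain ⟨C, h1, h2, -, h3⟩ := hv.exists_chain (Nat.le_succ m) hc
    exact ⟨C, h1, h2, h3⟩

end

end NormalPaths

/-! ### Times at which the flow reaches the elements of the approximation -/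

section ReachTime

variable {P : Type*} [PocSet P] {B : Set P}

open Fractional

/-- The factor 2 arises from splitting the chain into its falling and its rising elements. -/
theorem sum_chain_abs_le (hB : IsUltra B) (w : Weight P) (μ ν : Fractional B) {C : Finset P}
    (hC : IsChain (· ≤ ·) (C : Set P)) :
    ∑ a ∈ C, w a * |μ a - ν a| ≤ 2 * ellInf (μ.toDual hB w) (ν.toDual hB w) := by
  classical
  have h1 := (le_abs_self _).trans (abs_chain_sum_le_ellInf hB w μ ν
    (C := C.filter fun a => ν a ≤ μ a) (hC.mono (Finset.coe_subset.2 (Finset.filter_subset _ _))))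
  have h2 := (neg_le_abs _).trans (abs_chain_sum_le_ellInf hB w μ ν
    (C := C.filter fun a => ¬ ν a ≤ μ a) (hC.mono (Finset.coe_subset.2 (Finset.filter_subset _ _))))
  rw [← Finset.sum_filter_add_sum_filter_not C (fun a => ν a ≤ μ a), two_mul]
  refine add_le_add (le_trans (le_of_eq ?_) h1) (le_trans (le_of_eq ?_) h2)
  · refine Finset.sum_congr rfl fun a ha => ?_
    rw [abs_of_nonneg (sub_nonneg.2 (Finset.mem_filter.1 ha).2)]
  · rw [← Finset.sum_neg_distrib]
    refine Finset.sum_congr rfl fun a ha => ?_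
    rw [abs_of_neg (sub_neg.2 (not_le.1 (Finset.mem_filter.1 ha).2))]
    ring

section

variable (hB : IsUltra B) (w : Weight P) (μ ν : Fractional B) (n : ℕ)

/-- The time at which the flow from `μ` to `ν` reaches an element of the approximation. -/
noncomputable def reachTime : LowerApprox w n → ℝ
  | .bot => 0
  | .top => 0
  -- The length ⌊n w(a)⌋ (1 - μ(a)) at the lower end is missing in μ already; beyond it, each
  -- element takes the time 1/n.
  | .mk a _ i => startTime w μ ν a + max (i - floorWeight w n a * (1 - μ a)) 0 / n

/-- The elements of the approximation that replace elements to be dropped. -/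
def dropFibers : Set (LowerApprox w n) :=
  {c | ∃ (a : P) (ha : IsProper a) (i : Fin (floorWeight w n a)), a ∈ drop μ ν ∧ c = .mk a ha i}

variable {μ ν n}

theorem mk_mem_dropFibers {a : P} {ha : IsProper a} {i : Fin (floorWeight w n a)} :
    (.mk a ha i : LowerApprox w n) ∈ dropFibers w μ ν n ↔ a ∈ drop μ ν := by
  constructor
  · rintro ⟨b, hb, j, h, e⟩
    cases e
    exact h
  · exact fun h => ⟨a, ha, i, h, rfl⟩

theorem approxWeight_of_mem {c : LowerApprox w n} (hc : c ∈ dropFibers w μ ν n) :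
    approxWeight w n c = 1 / n := by
  obtain ⟨a, ha, i, -, rfl⟩ := hc
  exact approxWeight_mk w n a ha i

include hB in
theorem reachTime_nonneg {c : LowerApprox w n} (hc : c ∈ dropFibers w μ ν n) :
    0 ≤ reachTime w μ ν n c := by
  obtain ⟨a, ha, i, -, rfl⟩ := hc
  have := startTime_nonneg hB w μ ν a
  have : 0 ≤ max (i - floorWeight w n a * (1 - μ a)) 0 / (n : ℝ) := by positivity
  simp only [reachTime]
  linarith

theorem reachTime_add_mk (a : P) (ha : IsProper a) (i : Fin (floorWeight w n a)) :
    reachTime w μ ν n (.mk a ha i) + 1 / n * subdivide w n μ (.mk a ha i) =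
      startTime w μ ν a + max (i + 1 - floorWeight w n a * (1 - μ a)) 0 / n := by
  rw [subdivide_mk]
  simp only [reachTime, ramp]
  ring

-- For elements over `a < b` with `b` dropped, ν(a) = 0. So all of μ(a) has to go before `b` starts,
-- and rounding down only shortens the fiber. Within a fiber the elements follow each other at
-- intervals of 1/n.
include hB in
theorem reachTime_add_le (hn : 0 < n) {c d : LowerApprox w n} (hc : c ∈ dropFibers w μ ν n)
    (hd : d ∈ dropFibers w μ ν n) (hcd : c < d) :
    reachTime w μ ν n c + 1 / n * subdivide w n μ c ≤ reachTime w μ ν n d := by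
  have hn' : (0 : ℝ) < n := by exact_mod_cast hn
  obtain ⟨a, ha, i, haD, rfl⟩ := hc
  obtain ⟨b, hb, j, hbD, rfl⟩ := hd
  rw [reachTime_add_mk]
  simp only [reachTime]
  rcases Refined.mk_lt_mk.1 hcd with hab | ⟨rfl, hij⟩
  · have h1 := startTime_add_le hB w μ ν haD hab
    rw [eq_zero_of_lt hab hbD, sub_zero] at h1
    have h2 : max (i + 1 - floorWeight w n a * (1 - μ a)) 0 / (n : ℝ) ≤ w a * μ a := by
      rw [div_le_iff₀ hn']
      have hw := w.nonneg a
      have hμ := μ.nonneg a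
      refine max_le ?_ (by positivity)
      have hi : (i.val : ℝ) + 1 ≤ floorWeight w n a := by exact_mod_cast i.2
      have := mul_le_mul_of_nonneg_right (floorWeight_le w n a) hμ
      linarith
    have h3 : 0 ≤ max (j - floorWeight w n b * (1 - μ b)) 0 / (n : ℝ) := by positivity
    linarith
  · have hij' : (i.val : ℝ) + 1 ≤ j.val := by exact_mod_cast hij
    have := div_le_div_of_nonneg_right (max_le_max (sub_le_sub_right hij'
      (floorWeight w n a * (1 - μ a))) (le_refl (0 : ℝ))) hn'.le
    linarith

/-- A chain of elements that are reached during an interval of time. -/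
theorem sum_chain_subdivide_le (hB : IsUltra B) (hn : 0 < n) {C : Finset (LowerApprox w n)}
    (hC : IsChain (· ≤ ·) (C : Set (LowerApprox w n)))
    (hsub : (C : Set (LowerApprox w n)) ⊆ dropFibers w μ ν n) {lo hi : ℝ} (h : lo ≤ hi)
    (hlo : ∀ c ∈ C, lo ≤ reachTime w μ ν n c)
    (hhi : ∀ c ∈ C, reachTime w μ ν n c + 1 / n * subdivide w n μ c ≤ hi) :
    ∑ c ∈ C, 1 / n * subdivide w n μ c ≤ hi - lo :=
  sum_chain_le hC (reachTime w μ ν n) _ lo hi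
    (fun _ hc _ hd hcd => reachTime_add_le hB w hn (hsub hc) (hsub hd) hcd) hlo hhi h

/-- Below a dropped element ν vanishes, so an element there that is not dropped has degree zero in μ
as well. -/
theorem subdivide_eq_zero_of_le {c d : LowerApprox w n} (hcd : c ≤ d)
    (hd : d ∈ dropFibers w μ ν n) (hc : c ∉ dropFibers w μ ν n) : subdivide w n μ c = 0 := by
  obtain ⟨a, ha, i, haD, rfl⟩ := hd
  rcases c with _ | _ | ⟨b, hb, j⟩
  · rfl
  · exact absurd hcd id
  · rw [mk_mem_dropFibers] at hc
    have hba : b < a := (Refined.mk_le_mk.1 hcd).resolve_right fun h => hc (h.1 ▸ haD)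
    have h0 : μ b = 0 := by
      refine le_antisymm ?_ (μ.nonneg b)
      have := eq_zero_of_lt hba haD
      by_contra h
      exact hc (show ν b < μ b by linarith)
    rw [subdivide_mk, h0]
    have hj : (j.val : ℝ) + 1 ≤ floorWeight w n b := by exact_mod_cast j.2
    exact ramp_eq_zero (by linarith)

/-- The cardinality over `n` is the chain sum of `U`, which is within δ of that of μ. In the latter
only dropped elements count, and the flow crosses them in succession before it has finished `c`, at
most 1/n after reaching it. -/
theorem card_chain_le (hB : IsUltra B) (hn : 0 < n) (U : Vertex (approxBase w B n)) {δ : ℝ}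
    (hδ : pdist .infty (isUltra_approxBase w hB n) (approxWeight w n) U.frac
      (subdivide w n μ) ≤ δ)
    {c : LowerApprox w n} (hc : c ∈ dropFibers w μ ν n) {C : Finset (LowerApprox w n)}
    (hC : IsChain (· ≤ ·) (C : Set (LowerApprox w n)))
    (hCU : (C : Set (LowerApprox w n)) ⊆ U.1) (hle : ∀ d ∈ C, d ≤ c) :
    (C.card : ℝ) / n ≤ reachTime w μ ν n c + δ + 1 / n := by
  classical
  have hn' : (0 : ℝ) < n := by exact_mod_cast hn
  have hω : ∀ d ∈ C, approxWeight w n d = 1 / n := by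
    intro d hd
    rcases d with _ | _ | ⟨b, hb, j⟩
    · refine absurd (hCU hd) fun h => U.2.1.2 _ h _ h (bot_le : (⊥ : LowerApprox w n) ≤ _)
    · obtain ⟨a, ha, i, -, rfl⟩ := hc
      exact absurd (hle _ hd) id
    · exact approxWeight_mk w n b hb j
  have h1 := (le_abs_self _).trans (abs_chain_sum_le_ellInf (isUltra_approxBase w hB n)
    (approxWeight w n) U.frac (subdivide w n μ) hC)
  have h2 : ∑ d ∈ C, approxWeight w n d * (U.frac d - subdivide w n μ d) =
      C.card / n - ∑ d ∈ C, 1 / n * subdivide w n μ d := by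
    rw [Finset.sum_congr rfl fun d hd => by
      rw [hω d hd, Vertex.frac_of_mem (hCU hd), mul_sub, mul_one], Finset.sum_sub_distrib]
    simp [div_eq_mul_inv]
  have h3 : ∑ d ∈ C, 1 / n * subdivide w n μ d =
      ∑ d ∈ C.filter (· ∈ dropFibers w μ ν n), 1 / n * subdivide w n μ d := by
    rw [Finset.sum_filter]
    refine Finset.sum_congr rfl fun d hd => ?_
    split_ifs with h
    · rfl
    · rw [subdivide_eq_zero_of_le w (hle d hd) hc h, mul_zero]
  have hone : ∀ d, 1 / (n : ℝ) * subdivide w n μ d ≤ 1 / n := fun d =>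
    mul_le_of_le_one_right (by positivity) ((subdivide w n μ).le_one d)
  have hpos : 0 ≤ 1 / (n : ℝ) := by positivity
  have h4 := sum_chain_subdivide_le w hB hn (C := C.filter (· ∈ dropFibers w μ ν n)) (μ := μ)
    (ν := ν) (hC.mono (Finset.coe_subset.2 (Finset.filter_subset _ _))) (by intro d hd; simpa using (Finset.mem_filter.1 hd).2)
    (lo := 0) (hi := reachTime w μ ν n c + 1 / n)
    (by have := reachTime_nonneg hB w hc; linarith)
    (fun d hd => reachTime_nonneg hB w (Finset.mem_filter.1 hd).2)
    (fun d hd => by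
      have hd' := Finset.mem_filter.1 hd
      rcases (hle d hd'.1).eq_or_lt with rfl | hlt
      · linarith [hone d]
      · linarith [reachTime_add_le hB w hn hd'.2 hc hlt])
  have h5 : ellInf (U.frac.toDual (isUltra_approxBase w hB n) (approxWeight w n))
    ((subdivide w n μ).toDual (isUltra_approxBase w hB n) (approxWeight w n)) ≤ δ := hδ
  linarith

/-- A chain realizing the start time is lifted, continued by the elements below `c` in its own
fiber, and cut down to `U`. Passing from μ to `U` costs δ, and rounding costs 1/n for each of at
most `(drop μ ν).ncard` elements. -/
theorem exists_chain_le_card (hB : IsUltra B) (hn : 0 < n) (U : Vertex (approxBase w B n)) {δ : ℝ}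
    (hδ : pdist .infty (isUltra_approxBase w hB n) (approxWeight w n) U.frac
      (subdivide w n μ) ≤ δ)
    {c : LowerApprox w n} (hc : c ∈ dropFibers w μ ν n) :
    ∃ C : Finset (LowerApprox w n), IsChain (· ≤ ·) (C : Set (LowerApprox w n)) ∧
      (C : Set (LowerApprox w n)) ⊆ U.1 ∧ (∀ d ∈ C, d ≤ c) ∧
      reachTime w μ ν n c - δ - (drop μ ν).ncard / n ≤ C.card / n := by
  classical
  have hn' : (0 : ℝ) < n := by exact_mod_cast hn
  obtain ⟨a, ha, i, haD, rfl⟩ := hc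
  obtain ⟨C₀, hC₀, hsub, hlt, hT⟩ := exists_startTime hB w μ ν a
  let G : Finset (LowerApprox w n) := (Finset.Iio i).image (.mk a ha)
  have hG : ∀ d ∈ G, ∃ j : Fin (floorWeight w n a), j < i ∧ d = .mk a ha j := by
    intro d hd
    obtain ⟨j, hj, rfl⟩ := Finset.mem_image.1 hd
    exact ⟨j, Finset.mem_Iio.1 hj, rfl⟩
  have hdisj : Disjoint (Refined.lift _ (floorWeight_compl w n) C₀) G := by
    rw [Finset.disjoint_left]
    intro d hd hd'
    obtain ⟨j, -, rfl⟩ := hG d hd'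
    exact lt_irrefl _ (hlt a (Refined.mk_mem_lift.1 hd))
  let C₁ := Refined.lift _ (floorWeight_compl w n) C₀ ∪ G
  have hC₁ : IsChain (· ≤ ·) (C₁ : Set (LowerApprox w n)) := by
    rw [Finset.coe_union]
    have key : ∀ d ∈ Refined.lift _ (floorWeight_compl w n) C₀, ∀ e ∈ G, d ≤ e := by
      intro d hd e he
      obtain ⟨b, hb, j, hbC, rfl⟩ := Refined.mem_lift.1 hd
      obtain ⟨l, -, rfl⟩ := hG e he
      exact Or.inl (hlt b hbC)
    rintro d (hd | hd) e (he | he) hne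
    · exact Refined.isChain_lift hC₀ hd he hne
    · exact Or.inl (key d hd e he)
    · exact Or.inr (key e he d hd)
    · obtain ⟨j, -, rfl⟩ := hG d hd
      obtain ⟨l, -, rfl⟩ := hG e he
      exact (le_total j.val l.val).imp (fun h => Or.inr ⟨rfl, h⟩) fun h => Or.inr ⟨rfl, h⟩
  have hω : ∀ d ∈ C₁, approxWeight w n d = 1 / n := by
    intro d hd
    rcases Finset.mem_union.1 hd with h | h
    · obtain ⟨b, hb, j, -, rfl⟩ := Refined.mem_lift.1 h
      exact approxWeight_mk w n b hb j
    · obtain ⟨j, -, rfl⟩ := hG d h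
      exact approxWeight_mk w n a ha j
  have h1 := (neg_le_abs _).trans (abs_chain_sum_le_ellInf (isUltra_approxBase w hB n)
    (approxWeight w n) U.frac (subdivide w n μ) hC₁)
  have h2 : ∑ d ∈ C₁, approxWeight w n d * U.frac d = (C₁.filter (· ∈ U.1)).card / n := by
    rw [Finset.sum_congr rfl fun d hd => show _ = if d ∈ U.1 then 1 / (n : ℝ) else 0 by
      rw [hω d hd]
      split_ifs with h
      · rw [Vertex.frac_of_mem h, mul_one]
      · rw [Vertex.frac_of_notMem h, mul_zero], ← Finset.sum_filter]
    simp [div_eq_mul_inv]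
  have h3 : ∑ d ∈ Refined.lift _ (floorWeight_compl w n) C₀,
      approxWeight w n d * subdivide w n μ d ≥ startTime w μ ν a - (drop μ ν).ncard / n := by
    have e1 : ∑ d ∈ Refined.lift _ (floorWeight_compl w n) C₀,
        approxWeight w n d * (subdivide w n μ d - subdivide w n ν d) ≤
        ∑ d ∈ Refined.lift _ (floorWeight_compl w n) C₀,
          approxWeight w n d * subdivide w n μ d :=
      Finset.sum_le_sum fun d _ => mul_le_mul_of_nonneg_left
        (by linarith [(subdivide w n ν).nonneg d]) (Weight.nonneg _ _)
    rw [sum_lift_subdivide] at e1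
    have e2 : ∑ b ∈ C₀, w b * (μ b - ν b) ≤
        ∑ b ∈ C₀, (roundWeight w n b * (μ b - ν b) + 1 / n) := by
      refine Finset.sum_le_sum fun b hb => ?_
      have hlt : ν b < μ b := hsub hb
      have e3 := mul_le_mul_of_nonneg_right (le_roundWeight_add w hn b)
        (sub_nonneg.2 hlt.le)
      have e4 : 1 / (n : ℝ) * (μ b - ν b) ≤ 1 / n :=
        mul_le_of_le_one_right (by positivity) (by linarith [μ.le_one b, ν.nonneg b])
      linarith
    have e5 : (C₀.card : ℝ) ≤ (drop μ ν).ncard := by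
      rw [← Set.ncard_coe_finset]
      exact_mod_cast Set.ncard_le_ncard hsub (finite_drop hB.1 μ ν)
    rw [Finset.sum_add_distrib, Finset.sum_const, nsmul_eq_mul, mul_one_div] at e2
    have e6 := div_le_div_of_nonneg_right e5 hn'.le
    linarith
  have h4 : ∑ d ∈ G, approxWeight w n d * subdivide w n μ d =
      max (i - floorWeight w n a * (1 - μ a)) 0 / n := by
    rw [Finset.sum_image (Refined.mk_injective a ha).injOn]
    simp only [approxWeight_mk, subdivide_mk]
    rw [← Finset.mul_sum]
    have : ∑ j ∈ Finset.Iio i, ramp (floorWeight w n a * (1 - μ a)) j =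
        ∑ j ∈ Finset.range i, ramp (floorWeight w n a * (1 - μ a)) j := by
      rw [← Nat.Iio_eq_range, ← Fin.map_valEmbedding_Iio, Finset.sum_map]
      rfl
    rw [this, sum_ramp (mul_nonneg (Nat.cast_nonneg _) (by linarith [μ.le_one a]))]
    ring
  refine ⟨C₁.filter (· ∈ U.1), hC₁.mono (Finset.coe_subset.2 (Finset.filter_subset _ _)), ?_, ?_, ?_⟩
  · intro d hd
    exact (Finset.mem_filter.1 hd).2
  · intro d hd
    rcases Finset.mem_union.1 (Finset.mem_filter.1 hd).1 with h | h
    · obtain ⟨b, hb, j, hbC, rfl⟩ := Refined.mem_lift.1 h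
      exact Or.inl (hlt b hbC)
    · obtain ⟨j, hj, rfl⟩ := hG d h
      exact Or.inr ⟨rfl, hj.le⟩
  · simp only [mul_sub] at h1
    rw [Finset.sum_sub_distrib, h2, Finset.sum_union hdisj, h4] at h1
    have h5 : ellInf (U.frac.toDual (isUltra_approxBase w hB n) (approxWeight w n))
      ((subdivide w n μ).toDual (isUltra_approxBase w hB n) (approxWeight w n)) ≤ δ := hδ
    simp only [reachTime]
    linarith

/-! ### The subdivision of the flow -/

theorem flow_mem_of_notMem (t : ℝ) {a : P} (ha : a ∉ drop μ ν) :
    μ a ≤ flow hB w μ ν t a ∧ flow hB w μ ν t a ≤ ν a := by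
  by_cases ha' : aᶜ ∈ drop μ ν
  · have h1 := le_flowDegree w t ha'
    have h2 := flowDegree_le w t ha'
    rw [← flow_of_mem hB w t ha'] at h1 h2
    simp only [Fractional.map_compl] at h1 h2
    constructor <;> linarith
  · rw [flow_of_notMem hB w t ha ha']
    exact ⟨le_rfl, not_lt.1 ha⟩

theorem flow_mem_of_mem (t : ℝ) {a : P} (ha : a ∈ drop μ ν) :
    ν a ≤ flow hB w μ ν t a ∧ flow hB w μ ν t a ≤ μ a := by
  rw [flow_of_mem hB w t ha]
  exact ⟨le_flowDegree w t ha, flowDegree_le w t ha⟩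

theorem weight_pos_of_fin (hn : 0 < n) {a : P} (i : Fin (floorWeight w n a)) : 0 < w a := by
  have hn' : (0 : ℝ) < n := by exact_mod_cast hn
  have h1 : (1 : ℝ) ≤ floorWeight w n a := by exact_mod_cast (Nat.zero_le _).trans_lt i.2
  have h2 := h1.trans (floorWeight_le w n a)
  by_contra hle
  have : n * w a ≤ 0 := mul_nonpos_of_nonneg_of_nonpos hn'.le (not_lt.1 hle)
  linarith

/-- Until then the flow has removed from the fiber only length below the index of `c`, or nothing at
all if `c` lies in the part that is already missing. -/
theorem subdivide_flow_of_le (hn : 0 < n) {t : ℝ} {c : LowerApprox w n}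
    (hc : c ∈ dropFibers w μ ν n) (ht : t ≤ reachTime w μ ν n c) :
    subdivide w n (flow hB w μ ν t) c = subdivide w n μ c := by
  have hn' : (0 : ℝ) < n := by exact_mod_cast hn
  obtain ⟨a, ha, i, haD, rfl⟩ := hc
  have hw := weight_pos_of_fin w hn i
  have hm := mul_flowDegree w (μ := μ) (ν := ν) t a
  rw [← flow_of_mem hB w t haD] at hm
  set ρ := flow hB w μ ν t a
  set T := startTime w μ ν a
  set s := floorWeight w n a * (1 - μ a)
  have hd : ν a < μ a := haD
  have hl : 0 ≤ w a * (μ a - ν a) := mul_nonneg hw.le (by linarith)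
  set f := min (max (t - T) 0) (w a * (μ a - ν a))
  have hf0 : 0 ≤ f := le_min (le_max_right _ _) hl
  have ht' : t ≤ T + max (i - s) 0 / n := ht
  have hfn : n * f ≤ max (i - s) 0 := by
    rw [mul_comm, ← le_div_iff₀ hn']
    refine (min_le_left _ _).trans (max_le (by linarith) (by positivity))
  rw [subdivide_mk, subdivide_mk]
  change ramp (floorWeight w n a * (1 - ρ)) i = ramp s i
  rcases le_total s i with h | h
  · rw [max_eq_left (by linarith)] at hfn
    rw [ramp_eq_one h, ramp_eq_one]
    have hρ : ρ ≤ μ a := (flow_mem_of_mem hB w t haD).2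
    have h1 := mul_le_mul_of_nonneg_right (floorWeight_le w n a) (sub_nonneg.2 hρ)
    have h2 : n * w a * (μ a - ρ) = n * f := by
      rw [mul_assoc, mul_sub, hm]
      ring
    have h3 : floorWeight w n a * (1 - ρ) = s + floorWeight w n a * (μ a - ρ) := by
      simp only [s]; ring
    linarith
  · rw [max_eq_right (by linarith)] at hfn
    have hf : f = 0 := by
      have : f ≤ 0 := by
        by_contra hlt
        have := mul_pos hn' (not_le.1 hlt)
        linarith
      linarith
    rw [hf, sub_zero] at hm
    rw [mul_left_cancel₀ hw.ne' hm]

/-- One 1/n of the delay is for crossing `c` itself. The other makes up for rounding: ⌊n w(a)⌋ may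
fall short of n w(a) by one, so the fiber is used up more slowly. -/
theorem subdivide_flow_of_ge (hn : 0 < n) {t : ℝ} {c : LowerApprox w n}
    (hc : c ∈ dropFibers w μ ν n) (ht : reachTime w μ ν n c + 2 / n ≤ t) :
    subdivide w n (flow hB w μ ν t) c = subdivide w n ν c := by
  have hn' : (0 : ℝ) < n := by exact_mod_cast hn
  obtain ⟨a, ha, i, haD, rfl⟩ := hc
  have hw := weight_pos_of_fin w hn i
  have hm := mul_flowDegree w (μ := μ) (ν := ν) t a
  rw [← flow_of_mem hB w t haD] at hm
  have hρ := (flow_mem_of_mem hB w t haD).1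
  set ρ := flow hB w μ ν t a
  set T := startTime w μ ν a
  set s := floorWeight w n a * (1 - μ a) with hs
  have ht' : T + max (i - s) 0 / n + 2 / n ≤ t := ht
  rw [subdivide_mk, subdivide_mk]
  change ramp (floorWeight w n a * (1 - ρ)) i = _
  rcases le_total (w a * (μ a - ν a)) (max (t - T) 0) with h | h
  · rw [min_eq_right h] at hm
    have : w a * ρ = w a * ν a := by rw [hm]; ring
    rw [mul_left_cancel₀ hw.ne' this]
  · rw [min_eq_left h] at hm
    have h0 : 0 ≤ max (i - s) 0 / (n : ℝ) := by positivity
    have h0' : 0 ≤ 2 / (n : ℝ) := by positivity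
    rw [max_eq_left (by linarith)] at hm h
    have hle : t - T ≤ w a := h.trans
      (mul_le_of_le_one_right hw.le (by linarith [μ.le_one a, ν.nonneg a]))
    have h1 : max (i - s) 0 + 2 ≤ n * (t - T) := by
      have : (max (i - s) 0 + 2) / n ≤ t - T := by rw [add_div]; linarith
      rw [div_le_iff₀ hn'] at this
      linarith
    have h2 := le_max_left (i - s) 0
    have key : i + 1 ≤ floorWeight w n a * (1 - ρ) := by
      refine le_of_mul_le_mul_left ?_ hw
      have e1 : w a * (floorWeight w n a * (1 - ρ)) = w a * s + floorWeight w n a * (t - T) := by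
        have : w a * (floorWeight w n a * (1 - ρ)) =
          floorWeight w n a * w a - floorWeight w n a * (w a * ρ) := by ring
        rw [this, hm, hs]
        ring
      have e2 := mul_le_mul_of_nonneg_right (lt_floorWeight_add_one w n a).le
        (show 0 ≤ t - T by linarith)
      have e3 := mul_le_mul_of_nonneg_left (show i - s + 2 ≤ n * (t - T) by linarith) hw.le
      rw [e1]
      linarith
    rw [ramp_eq_zero key, ramp_eq_zero]
    refine key.trans (mul_le_mul_of_nonneg_left (by linarith) (Nat.cast_nonneg _))

end

end ReachTime

/-! ### Convergence of normal cube paths to the flow -/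

section PathConvergence

variable {P : Type*} [PocSet P] {B : Set P}

open Fractional

section

variable (w : Weight P) (μ ν : Fractional B) (n : ℕ) (t κ : ℝ)

/-- The elements of the approximation that are reached at about the time `t`. -/
def nearFibers : Set (LowerApprox w n) :=
  {c | c ∈ dropFibers w μ ν n ∧ |t - reachTime w μ ν n c| ≤ κ}

open Classical in
/-- The degrees of the elements that are reached at about the time `t`. -/
noncomputable def nearDegree (c : LowerApprox w n) : ℝ :=
  if c ∈ nearFibers w μ ν n t κ then subdivide w n μ c else 0

theorem nearDegree_nonneg (c : LowerApprox w n) : 0 ≤ nearDegree w μ ν n t κ c := by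
  unfold nearDegree
  split_ifs
  · exact (subdivide w n μ).nonneg c
  · exact le_rfl

variable {w μ ν n t κ}

/-- The elements are crossed successively between t - κ and t + κ + 1/n, the last summand allowing
for the final crossing. -/
theorem sum_chain_nearDegree_le (hB : IsUltra B) (hn : 0 < n) (hκ : 0 ≤ κ)
    {C : Finset (LowerApprox w n)} (hC : IsChain (· ≤ ·) (C : Set (LowerApprox w n))) :
    ∑ c ∈ C, approxWeight w n c * nearDegree w μ ν n t κ c ≤ 2 * κ + 1 / n := by
  classical
  have hpos : 0 ≤ 1 / (n : ℝ) := by positivity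
  have h1 : ∑ c ∈ C, approxWeight w n c * nearDegree w μ ν n t κ c =
      ∑ c ∈ C.filter (· ∈ nearFibers w μ ν n t κ), 1 / n * subdivide w n μ c := by
    rw [Finset.sum_filter]
    refine Finset.sum_congr rfl fun c _ => ?_
    unfold nearDegree
    split_ifs with h
    · rw [approxWeight_of_mem w h.1]
    · rw [mul_zero]
  have hmem : ∀ c ∈ C.filter (· ∈ nearFibers w μ ν n t κ), c ∈ nearFibers w μ ν n t κ :=
    fun c hc => (Finset.mem_filter.1 hc).2
  have h2 := sum_chain_subdivide_le w hB hn (C := C.filter (· ∈ nearFibers w μ ν n t κ)) (μ := μ)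
    (ν := ν) (hC.mono (Finset.coe_subset.2 (Finset.filter_subset _ _)))
    (fun c hc => (hmem c hc).1) (lo := t - κ) (hi := t + κ + 1 / n) (by linarith)
    (fun c hc => by have := abs_le.1 (hmem c hc).2; linarith)
    (fun c hc => by
      have h3 := abs_le.1 (hmem c hc).2
      have h4 : 1 / (n : ℝ) * subdivide w n μ c ≤ 1 / n :=
        mul_le_of_le_one_right hpos ((subdivide w n μ).le_one c)
      linarith)
  linarith

/-- Only the fibers over `drop μ ν` contribute, and each of them is a chain. -/
theorem sum_nearDegree_le (hB : IsUltra B) (hn : 0 < n) (hκ : 0 ≤ κ)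
    (F : Finset (LowerApprox w n)) :
    ∑ c ∈ F, approxWeight w n c * nearDegree w μ ν n t κ c ≤
      (drop μ ν).ncard * (2 * κ + 1 / n) := by
  classical
  let pr := Refined.proj (floorWeight w n) (floorWeight_compl w n)
  let D := (finite_drop hB.1 μ ν).toFinset
  let F' := F.filter (· ∈ nearFibers w μ ν n t κ)
  have h1 : ∑ c ∈ F, approxWeight w n c * nearDegree w μ ν n t κ c =
      ∑ c ∈ F', approxWeight w n c * nearDegree w μ ν n t κ c := by
    refine (Finset.sum_filter_of_ne fun c _ hne => ?_).symm
    by_contra h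
    exact hne (by rw [nearDegree, if_neg h, mul_zero])
  have hmk : ∀ c ∈ F', ∃ a ha i, a ∈ drop μ ν ∧ c = (.mk a ha i : LowerApprox w n) :=
    fun c hc => (Finset.mem_filter.1 hc).2.1
  have hmaps : ∀ c ∈ F', pr c ∈ D := by
    intro c hc
    obtain ⟨a, ha, i, haD, rfl⟩ := hmk c hc
    exact (Set.Finite.mem_toFinset _).2 haD
  rw [h1, ← Finset.sum_fiberwise_of_maps_to hmaps, Set.ncard_eq_toFinset_card _
    (finite_drop hB.1 μ ν), ← nsmul_eq_mul]
  refine Finset.sum_le_card_nsmul _ _ _ fun a _ => sum_chain_nearDegree_le hB hn hκ ?_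
  intro c hc d hd _
  have hc' := Finset.mem_filter.1 hc
  have hd' := Finset.mem_filter.1 hd
  obtain ⟨b, hb, i, -, rfl⟩ := hmk c hc'.1
  obtain ⟨b', hb', j, -, rfl⟩ := hmk d hd'.1
  obtain rfl : b = a := hc'.2
  obtain rfl : b' = b := hd'.2
  exact (le_total i.val j.val).imp (fun h => Or.inr ⟨rfl, h⟩) fun h => Or.inr ⟨rfl, h⟩

end

section

variable (hB : IsUltra B) (w : Weight P) {μ ν : Fractional B} {n : ℕ}
  {v : ℕ → Vertex (approxBase w B n)} {m : ℕ} {δ : ℝ}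

/-- A chain of more than `k` elements of the initial vertex below `c` would have kept `c` from being
crossed. -/
theorem reachTime_le_of_notMem (hn : 0 < n) (hv : IsNormalCubePath v m)
    (hU : pdist .infty (isUltra_approxBase w hB n) (approxWeight w n) (v 0).frac
      (subdivide w n μ) ≤ δ) {k : ℕ} (hk : k ≤ m) {c : LowerApprox w n}
    (hc : c ∈ dropFibers w μ ν n) (hcV : c ∉ (v m).1) (hck : c ∉ (v k).1) :
    reachTime w μ ν n c - δ - (drop μ ν).ncard / n ≤ k / n := by
  obtain ⟨C, hC, hCU, hle, hcard⟩ := exists_chain_le_card w hB hn (v 0) hU hc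
  have h : C.card ≤ k := by
    by_contra hlt
    exact hck (hv.mem_of_chain hk hcV hC hCU hle (by omega))
  exact hcard.trans (div_le_div_of_nonneg_right (by exact_mod_cast h) (Nat.cast_nonneg _))

/-- An element not crossed by step `k` lies on top of a chain of `k + 1` elements; the extra element
cancels the 1/n in `card_chain_le`. -/
theorem le_reachTime_of_mem (hn : 0 < n) (hv : IsNormalCubePath v m)
    (hU : pdist .infty (isUltra_approxBase w hB n) (approxWeight w n) (v 0).frac
      (subdivide w n μ) ≤ δ) {k : ℕ} (hk : k ≤ m) {c : LowerApprox w n}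
    (hc : c ∈ dropFibers w μ ν n) (hck : c ∈ (v k).1 \ (v m).1) :
    k / n ≤ reachTime w μ ν n c + δ := by
  obtain ⟨C, hC, hCU, hle, hcard⟩ := hv.exists_chain hk hck
  have := card_chain_le w hB hn (v 0) hU hc hC (fun d hd => (hCU hd).1) hle
  rw [hcard, Nat.cast_add, add_div, Nat.cast_one] at this
  linarith

/-- Elements kept by both endpoints are kept by the flow up to the endpoint errors. For an element
to be crossed, or the complement of one, path and flow agree with the same endpoint unless it is
reached near time k/n. Elements in neither endpoint never occur on the path. -/
theorem one_sub_subdivide_flow_le (hn : 0 < n) (hv : IsNormalCubePath v m)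
    (hU : pdist .infty (isUltra_approxBase w hB n) (approxWeight w n) (v 0).frac
      (subdivide w n μ) ≤ δ) {k : ℕ} (hk : k ≤ m) {κ : ℝ}
    (hκ : δ + ((drop μ ν).ncard + 2) / n ≤ κ) (c : LowerApprox w n) :
    (v k).frac c - subdivide w n (flow hB w μ ν (k / n)) c ≤
      |(v 0).frac c - subdivide w n μ c| + |(v m).frac c - subdivide w n ν c| +
        (nearDegree w μ ν n (k / n) κ c + nearDegree w μ ν n (k / n) κ cᶜ) := by
  set ξ := subdivide w n μ
  set η := subdivide w n ν
  set ζ := subdivide w n (flow hB w μ ν (k / n)) with hζ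
  have p1 := abs_nonneg ((v 0).frac c - ξ c)
  have p2 := abs_nonneg ((v m).frac c - η c)
  have p3 := nearDegree_nonneg w μ ν n (k / n) κ c
  have p4 := nearDegree_nonneg w μ ν n (k / n) κ cᶜ
  have hδ0 : 0 ≤ δ := (pdist_nonneg _ _ _ _ _).trans hU
  have hN : 0 ≤ ((drop μ ν).ncard : ℝ) / n := by positivity
  have h2n : 0 ≤ 2 / (n : ℝ) := by positivity
  rw [add_div] at hκ
  by_cases hZ : c ∈ (v k).1
  swap
  · rw [Vertex.frac_of_notMem hZ]
    linarith [ζ.nonneg c]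
  rw [Vertex.frac_of_mem hZ]
  by_cases hcU : c ∈ (v 0).1 <;> by_cases hcV : c ∈ (v m).1
  · rw [Vertex.frac_of_mem hcU, Vertex.frac_of_mem hcV] at *
    have e1 := le_abs_self (1 - ξ c)
    have e2 := le_abs_self (1 - η c)
    have : min (ξ c) (η c) ≤ ζ c := by
      rcases c with _ | _ | ⟨a, ha, i⟩
      · exact (min_le_left _ _)
      · exact (min_le_left _ _)
      · by_cases haD : a ∈ drop μ ν
        · exact (min_le_right _ _).trans
            (subdivide_mono w n (flow_mem_of_mem hB w _ haD).1 ha i)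
        · exact (min_le_left _ _).trans
            (subdivide_mono w n (flow_mem_of_notMem hB w _ haD).1 ha i)
    rcases min_le_iff.1 this with h | h
    · linarith
    · linarith
  · rw [Vertex.frac_of_mem hcU] at *
    have e1 := le_abs_self (1 - ξ c)
    by_cases hcD : c ∈ dropFibers w μ ν n
    · have h1 := le_reachTime_of_mem hB w hn hv hU hk hcD ⟨hZ, hcV⟩
      rcases le_total (k / n : ℝ) (reachTime w μ ν n c) with h | h
      · rw [hζ, subdivide_flow_of_le hB w hn hcD h]
        linarith
      -- The flow has reached `c` while the path has not crossed it, so k/n exceeds the reach time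
      -- by at most δ.
      · have hnear : c ∈ nearFibers w μ ν n (k / n) κ :=
          ⟨hcD, by rw [abs_le]; constructor <;> linarith⟩
        have : nearDegree w μ ν n (k / n) κ c = ξ c := if_pos hnear
        linarith [ζ.nonneg c]
    · have : ξ c ≤ ζ c := by
        rcases c with _ | _ | ⟨a, ha, i⟩
        · exact le_rfl
        · exact le_rfl
        · rw [mk_mem_dropFibers] at hcD
          exact subdivide_mono w n (flow_mem_of_notMem hB w _ hcD).1 ha i
      linarith
  · rw [Vertex.frac_of_mem hcV] at *
    have e2 := le_abs_self (1 - η c)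
    have eζ := ζ.map_compl c
    have eη := η.map_compl c
    have hcV' : cᶜ ∉ (v m).1 := fun h => (v m).2.1.1.compl_mem_iff.1 h hcV
    have hZ' : cᶜ ∉ (v k).1 := fun h => (v k).2.1.1.compl_mem_iff.1 h hZ
    by_cases hcD : cᶜ ∈ dropFibers w μ ν n
    · have h1 := reachTime_le_of_notMem hB w hn hv hU hk hcD hcV' hZ'
      rcases le_total (reachTime w μ ν n cᶜ + 2 / n) (k / n : ℝ) with h | h
      · rw [hζ, subdivide_flow_of_ge hB w hn hcD h] at eζ
        linarith
      -- The path has crossed `cᶜ` while the flow may not have finished it: the path is early by at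
      -- most δ + N/n, with N the number of dropped elements, and the flow late by at most 2/n. This
      -- explains the bound on κ.
      · have hnear : cᶜ ∈ nearFibers w μ ν n (k / n) κ :=
          ⟨hcD, by rw [abs_le]; constructor <;> linarith⟩
        have h2 : nearDegree w μ ν n (k / n) κ cᶜ = ξ cᶜ := if_pos hnear
        have h3 : ζ cᶜ ≤ ξ cᶜ := by
          obtain ⟨a, ha, i, haD, e⟩ := hcD
          rw [e]
          exact subdivide_mono w n (flow_mem_of_mem hB w _ haD).2 ha i
        linarith
    · have : ζ cᶜ ≤ η cᶜ := by
        generalize cᶜ = d at hcD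
        rcases d with _ | _ | ⟨a, ha, i⟩
        · exact le_rfl
        · exact le_rfl
        · rw [mk_mem_dropFibers] at hcD
          exact subdivide_mono w n (flow_mem_of_notMem hB w _ hcD).2 ha i
      linarith
  · exact absurd (hv.sdiff_subset hk ⟨hZ, hcV⟩).1 hcU

theorem abs_sub_subdivide_flow_le (hn : 0 < n) (hv : IsNormalCubePath v m)
    (hU : pdist .infty (isUltra_approxBase w hB n) (approxWeight w n) (v 0).frac
      (subdivide w n μ) ≤ δ) {k : ℕ} (hk : k ≤ m) {κ : ℝ}
    (hκ : δ + ((drop μ ν).ncard + 2) / n ≤ κ) (c : LowerApprox w n) :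
    |(v k).frac c - subdivide w n (flow hB w μ ν (k / n)) c| ≤
      |(v 0).frac c - subdivide w n μ c| + |(v m).frac c - subdivide w n ν c| +
        (nearDegree w μ ν n (k / n) κ c + nearDegree w μ ν n (k / n) κ cᶜ) := by
  have h1 := one_sub_subdivide_flow_le hB w hn hv hU hk hκ c
  have h2 := one_sub_subdivide_flow_le hB w hn hv hU hk hκ cᶜ
  have h3 : ∀ x y : ℝ, |1 - x - (1 - y)| = |x - y| := fun x y => by
    rw [abs_sub_comm x y]
    congr 1
    ring
  simp only [Fractional.map_compl, compl_invol, h3] at h2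
  rw [abs_le]
  constructor <;> linarith

/-- The pointwise estimate is summed over a common support for d_1 and over chains for d_∞. The
constant covers both: 4δ is needed for absolute values along chains, the number of fibers for d_1.
-/
theorem pdist_subdivide_flow_le (p : Ell) (hn : 0 < n) (hv : IsNormalCubePath v m)
    (hU : pdist p (isUltra_approxBase w hB n) (approxWeight w n) (v 0).frac
      (subdivide w n μ) ≤ δ)
    (hV : pdist p (isUltra_approxBase w hB n) (approxWeight w n) (v m).frac
      (subdivide w n ν) ≤ δ) {k : ℕ} (hk : k ≤ m) {κ : ℝ}
    (hκ : δ + ((drop μ ν).ncard + 2) / n ≤ κ) :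
    pdist p (isUltra_approxBase w hB n) (approxWeight w n) (v k).frac
      (subdivide w n (flow hB w μ ν (k / n))) ≤
      4 * δ + 2 * ((drop μ ν).ncard + 1) * (2 * κ + 1 / n) := by
  classical
  have hBn := isUltra_approxBase w hB n
  have hU' := (ellInf_le_pdist p hBn (approxWeight w n) (v 0).frac (subdivide w n μ)).trans hU
  have hV' := (ellInf_le_pdist p hBn (approxWeight w n) (v m).frac (subdivide w n ν)).trans hV
  have hδ0 : 0 ≤ δ := (pdist_nonneg _ _ _ _ _).trans hU
  have hκ0 : 0 ≤ κ := by
    have : 0 ≤ (((drop μ ν).ncard : ℝ) + 2) / n := by positivity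
    linarith
  have hq : 0 ≤ 2 * κ + 1 / (n : ℝ) := by positivity
  have key := abs_sub_subdivide_flow_le hB w hn hv hU' hk hκ
  have hsum : ∀ F : Finset (LowerApprox w n),
      ∑ c ∈ F, approxWeight w n c * |(v k).frac c - subdivide w n (flow hB w μ ν (k / n)) c| ≤
      ∑ c ∈ F, approxWeight w n c * |(v 0).frac c - subdivide w n μ c| +
      ∑ c ∈ F, approxWeight w n c * |(v m).frac c - subdivide w n ν c| +
      (∑ c ∈ F, approxWeight w n c * nearDegree w μ ν n (k / n) κ c +
      ∑ c ∈ F.image compl, approxWeight w n c * nearDegree w μ ν n (k / n) κ c) := by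
    intro F
    rw [Finset.sum_image fun a _ b _ h => compl_eq_compl h, ← Finset.sum_add_distrib,
      ← Finset.sum_add_distrib, ← Finset.sum_add_distrib]
    refine Finset.sum_le_sum fun c _ => ?_
    rw [Weight.map_compl, ← mul_add, ← mul_add, ← mul_add]
    exact mul_le_mul_of_nonneg_left (key c) (Weight.nonneg _ _)
  have hN : 0 ≤ ((drop μ ν).ncard : ℝ) * (2 * κ + 1 / n) := by positivity
  cases p
  · obtain ⟨F₁, a₁, b₁⟩ := exists_support (v 0).frac (subdivide w n μ)
    obtain ⟨F₂, a₂, b₂⟩ := exists_support (v m).frac (subdivide w n ν)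
    obtain ⟨F₃, a₃, b₃⟩ := exists_support (v k).frac (subdivide w n (flow hB w μ ν (k / n)))
    let F := F₁ ∪ F₂ ∪ F₃
    have hF : ∀ c ∈ F, c ∈ approxBase w B n := by
      intro c hc
      simp only [F, Finset.mem_union] at hc
      exact hc.elim (fun h => h.elim (a₁ c) (a₂ c)) (a₃ c)
    have h := hsum F
    rw [← ellOne_eq_sum hBn _ _ _ F hF fun c hc hne => by simp [F, b₃ c hc hne],
      ← ellOne_eq_sum hBn _ _ _ F hF fun c hc hne => by simp [F, b₁ c hc hne],
      ← ellOne_eq_sum hBn _ _ _ F hF fun c hc hne => by simp [F, b₂ c hc hne]] at h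
    have h3 := sum_nearDegree_le (μ := μ) (ν := ν) (t := k / n) hB hn hκ0 F
    have h4 := sum_nearDegree_le (μ := μ) (ν := ν) (t := k / n) hB hn hκ0 (F.image compl)
    rw [pdist_one] at hU hV ⊢
    linarith
  · rw [pdist_infty]
    refine ellInf_le_of_chain hBn _ _ _ fun C hC hsub => ?_
    have h := hsum C
    have h1 := sum_chain_abs_le hBn (approxWeight w n) (v 0).frac (subdivide w n μ) hC
    have h2 := sum_chain_abs_le hBn (approxWeight w n) (v m).frac (subdivide w n ν) hC
    have hC' : IsChain (· ≤ ·) ((C.image compl : Finset (LowerApprox w n)) :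
        Set (LowerApprox w n)) := by
      rw [Finset.coe_image]
      rintro _ ⟨c, hc, rfl⟩ _ ⟨d, hd, rfl⟩ hne
      exact ((hC hc hd fun e => hne (e ▸ rfl)).imp (compl_anti _ _) (compl_anti _ _)).symm
    have h3 := sum_chain_nearDegree_le (μ := μ) (ν := ν) (t := k / n) hB hn hκ0 hC
    have h4 := sum_chain_nearDegree_le (μ := μ) (ν := ν) (t := k / n) hB hn hκ0 hC'
    have h5 : ∑ c ∈ C, approxWeight w n c *
        ((v k).frac c - subdivide w n (flow hB w μ ν (k / n)) c) ≤
        ∑ c ∈ C, approxWeight w n c *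
          |(v k).frac c - subdivide w n (flow hB w μ ν (k / n)) c| :=
      Finset.sum_le_sum fun c _ =>
        mul_le_mul_of_nonneg_left (le_abs_self _) (Weight.nonneg _ _)
    linarith

/-- The duration of a normal cube path is the distance of its endpoints. -/
theorem IsNormalCubePath.div_eq (hv : IsNormalCubePath v m) :
    (m : ℝ) / n = pdist .infty (isUltra_approxBase w hB n) (approxWeight w n) (v 0).frac
      (v m).frac := by
  have hBn := isUltra_approxBase w hB n
  have hs : ∀ C : Finset (LowerApprox w n), (C : Set (LowerApprox w n)) ⊆ (v 0).1 \ (v m).1 →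
      ∑ c ∈ C, approxWeight w n c * ((v 0).frac c - (v m).frac c) = C.card / n := by
    intro C hC
    have : ∀ c ∈ C, approxWeight w n c * ((v 0).frac c - (v m).frac c) = 1 / n := by
      intro c hc
      have hc' := hC hc
      have hp : IsProper c := by
        refine ⟨?_, ?_⟩
        · rintro rfl
          exact (v 0).2.1.2 _ hc'.1 _ hc'.1 bot_le
        · rintro rfl
          exact hc'.2 (v m).2.1.top_mem
      rw [Vertex.frac_of_mem hc'.1, Vertex.frac_of_notMem hc'.2, sub_zero, mul_one]
      exact if_pos hp
    rw [Finset.sum_congr rfl this]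
    simp [div_eq_mul_inv]
  rw [pdist_infty]
  apply le_antisymm
  · obtain ⟨C, hC, hsub, hcard⟩ := hv.exists_chain_card_eq
    have := (le_abs_self _).trans (abs_chain_sum_le_ellInf hBn (approxWeight w n) (v 0).frac
      (v m).frac hC)
    rwa [hs C hsub, hcard] at this
  · refine ellInf_le_of_chain hBn _ _ _ fun C hC hsub => ?_
    rw [Vertex.drop_frac] at hsub
    rw [hs C hsub]
    exact div_le_div_of_nonneg_right (by exact_mod_cast hv.card_le hC hsub) (Nat.cast_nonneg _)

end

theorem exists_pdist_frac_le (hB : IsUltra B) (p : Ell) {w : Weight P} {μ : Fractional B}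
    {U : ∀ n : ℕ, Vertex (approxBase w B n)}
    (h : ConvergesTo p (fun n => (U n).toPoint (approxWeight w n)) (μ.toDual hB w)) {δ : ℝ}
    (hδ : 0 < δ) :
    ∃ N, ∀ n ≥ N, pdist p (isUltra_approxBase w hB n) (approxWeight w n) (U n).frac
      (subdivide w n μ) ≤ δ := by
  obtain ⟨N, hN⟩ := h δ hδ
  refine ⟨N, fun n hn => ?_⟩
  obtain ⟨x', hx', hd⟩ := hN n hn
  obtain rfl := eq_subdivide_of_corresponds hB w μ x' hx'
  have e := Vertex.toPoint_eq (isUltra_approxBase w hB n) (approxWeight w n) (U n)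
  unfold pdist
  rw [← e]
  exact hd

/-- The durations converge because m/n is the d_∞-distance of the endpoints in the approximation;
the positions, by the uniform comparison with the subdivided flow. -/
theorem pathsConvergeTo_flow (hB : IsUltra B) (p : Ell) (w : Weight P) (μ ν : Fractional B)
    {v : ∀ n : ℕ, ℕ → Vertex (approxBase w B n)} {m : ℕ → ℕ}
    (hv : ∀ n, IsNormalCubePath (v n) (m n))
    (hU : ConvergesTo p (fun n => (v n 0).toPoint (approxWeight w n)) (μ.toDual hB w))
    (hV : ConvergesTo p (fun n => (v n (m n)).toPoint (approxWeight w n)) (ν.toDual hB w)) :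
    PathsConvergeTo p (fun n k => (v n k).toPoint (approxWeight w n)) m
      (fun t => (flow hB w μ ν t).toDual hB w) (ellInf (μ.toDual hB w) (ν.toDual hB w)) := by
  have hlarge : ∀ K ε : ℝ, 0 < ε → ∃ N : ℕ, ∀ n ≥ N, 0 < n ∧ K / n ≤ ε := by
    intro K ε hε
    have h := (tendsto_const_div_atTop_nhds_zero_nat K).eventually_le_const hε
    obtain ⟨N, hN⟩ := eventually_atTop.1 (h.and (eventually_gt_atTop 0))
    exact ⟨N, fun n hn => ⟨(hN n hn).2, (hN n hn).1⟩⟩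
  constructor
  · rw [Metric.tendsto_atTop]
    intro ε hε
    obtain ⟨N₁, h₁⟩ := exists_pdist_frac_le hB p hU (δ := ε / 4) (by positivity)
    obtain ⟨N₂, h₂⟩ := exists_pdist_frac_le hB p hV (δ := ε / 4) (by positivity)
    obtain ⟨N₃, h₃⟩ := hlarge (pdist .infty hB (constWeight P 1 zero_le_one) μ ν) (ε / 4)
      (by positivity)
    refine ⟨max N₁ (max N₂ N₃), fun n hn => ?_⟩
    obtain ⟨hn0, h3⟩ := h₃ n (by omega)
    have hBn := isUltra_approxBase w hB n
    have h1 := (ellInf_le_pdist p hBn _ _ _).trans (h₁ n (by omega))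
    have h2 := (ellInf_le_pdist p hBn _ _ _).trans (h₂ n (by omega))
    rw [← pdist_infty] at h1 h2
    rw [(hv n).div_eq hB w, Real.dist_eq, ← pdist_infty]
    have t1 := pdist_triangle .infty hBn (approxWeight w n) (v n 0).frac (subdivide w n μ)
      (v n (m n)).frac
    have t2 := pdist_triangle .infty hBn (approxWeight w n) (subdivide w n μ) (subdivide w n ν)
      (v n (m n)).frac
    have t3 := pdist_triangle .infty hBn (approxWeight w n) (subdivide w n μ) (v n 0).frac
      (subdivide w n ν)
    have t4 := pdist_triangle .infty hBn (approxWeight w n) (v n 0).frac (v n (m n)).frac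
      (subdivide w n ν)
    rw [pdist_comm _ _ _ (subdivide w n ν)] at t2
    rw [pdist_comm _ _ _ (subdivide w n μ) (v n 0).frac] at t3
    have t5 := pdist_subdivide_le .infty hB w n μ ν
    have t6 := pdist_le_subdivide_add .infty hB w hn0 μ ν
    rw [one_div_mul_eq_div] at t6
    rw [abs_lt]
    constructor <;> linarith
  · intro ε hε
    set N : ℝ := ((drop μ ν).ncard : ℝ)
    have hN0 : 0 ≤ N := Nat.cast_nonneg _
    -- With κ = δ + (N + 2)/n the coefficient of δ in the comparison is 4 + 4(N + 1) = 4N + 8.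
    set δ := ε / (2 * (4 * N + 8)) with hδ
    have hδ0 : 0 < δ := by positivity
    have hδε : δ * (4 * N + 8) = ε / 2 := by rw [hδ]; field_simp
    obtain ⟨N₁, h₁⟩ := exists_pdist_frac_le hB p hU hδ0
    obtain ⟨N₂, h₂⟩ := exists_pdist_frac_le hB p hV hδ0
    obtain ⟨N₃, h₃⟩ := hlarge (2 * (N + 1) * (2 * (N + 2) + 1)) (ε / 2) (by positivity)
    refine ⟨max N₁ (max N₂ N₃), fun n hn k hk => ?_⟩
    obtain ⟨hn0, h3⟩ := h₃ n (by omega)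
    refine ⟨_, corresponds_subdivide hB w n _, ?_⟩
    have h := pdist_subdivide_flow_le hB w p hn0 (hv n) (h₁ n (by omega)) (h₂ n (by omega)) hk
      le_rfl
    unfold pdist at h
    rw [← Vertex.toPoint_eq (isUltra_approxBase w hB n)] at h
    refine le_trans h ?_
    have e : 4 * δ + 2 * (N + 1) * (2 * (δ + (N + 2) / n) + 1 / n) =
        δ * (4 * N + 8) + 2 * (N + 1) * (2 * (N + 2) + 1) / n := by ring
    change 4 * δ + 2 * (N + 1) * (2 * (δ + (N + 2) / n) + 1 / n) ≤ ε
    rw [e]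
    linarith

end PathConvergence

end PocSet

/-! ### The Approximation Lemma -/

theorem mainTheorem8 {P : Type*} [PocSet P] (hP : PocSet.IsDiscrete P)
    (w : PocSet.Weight P) (B : Set P) (hB : PocSet.IsUltra B)
    (hlf : PocSet.IsLocallyFinite B) (p : PocSet.Ell) :
    (PocSet.WallsCross w B → ProperSpace (PocSet.Cubing p w B) →
      PointedGHConverges
        (X := fun n => PocSet.ApproxCubing p w B n) (Y := PocSet.Cubing p w B)
        (fun n => PocSet.basePoint (PocSet.approxWeight w n) (PocSet.approxBase w B n))
        (PocSet.basePoint w B) ∧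
      ∀ R > 0, ∀ ε > 0, ∃ N : ℕ, ∀ n ≥ N,
        IsApproximation ε
          {q : Metric.closedBall (α := PocSet.ApproxCubing p w B n)
                (PocSet.basePoint (PocSet.approxWeight w n) (PocSet.approxBase w B n)) R ×
              Metric.closedBall (α := PocSet.Cubing p w B) (PocSet.basePoint w B) R |
            PocSet.Corresponds q.1.1 q.2.1}) ∧
    ∀ (x y : PocSet.WeightedDual w B) (U V : ∀ n : ℕ, PocSet.Vertex (PocSet.approxBase w B n)),
      PocSet.ConvergesTo p (fun n => (U n).toPoint (PocSet.approxWeight w n)) x →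
      PocSet.ConvergesTo p (fun n => (V n).toPoint (PocSet.approxWeight w n)) y →
      (∀ n, ∃ (v : ℕ → PocSet.Vertex (PocSet.approxBase w B n)) (m : ℕ),
        v 0 = U n ∧ v m = V n ∧ PocSet.IsNormalCubePath v m) ∧
      ∃ γ : ℝ → PocSet.WeightedDual w B,
        γ 0 = x ∧ (∀ t ≥ PocSet.ellInf x y, γ t = y) ∧
        (∀ s ∈ Set.Icc 0 (PocSet.ellInf x y), ∀ t ∈ Set.Icc 0 (PocSet.ellInf x y),
          PocSet.ellInf (γ s) (γ t) = |s - t|) ∧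
        (∀ r s t : ℝ, 0 ≤ r → r ≤ s → s ≤ t → t ≤ PocSet.ellInf x y →
          PocSet.ellOne (γ r) (γ t) = PocSet.ellOne (γ r) (γ s) + PocSet.ellOne (γ s) (γ t)) ∧
        ∀ (v : ∀ n, ℕ → PocSet.Vertex (PocSet.approxBase w B n)) (m : ℕ → ℕ),
          (∀ n, v n 0 = U n ∧ v n (m n) = V n ∧ PocSet.IsNormalCubePath (v n) (m n)) →
          PocSet.PathsConvergeTo p
            (fun n k => (v n k).toPoint (PocSet.approxWeight w n)) m γ (PocSet.ellInf x y) := by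
  open PocSet Fractional in
  refine ⟨fun hX hprop => ⟨pointedGHConverges hB w p hX,
    fun R hR ε hε => exists_isApproximation hB w p hX hR hε⟩, fun x y U V hU hV =>
    ⟨fun n => exists_isNormalCubePath (isUltra_approxBase w hB n) (U n) (V n), ?_⟩⟩
  obtain ⟨μ, rfl⟩ := PocSet.Fractional.exists_toDual hB x
  obtain ⟨ν, rfl⟩ := PocSet.Fractional.exists_toDual hB y
  -- The flow depends only on the chosen lifts μ and ν of the endpoints, so one γ serves all normal
  -- cube paths.
  refine ⟨fun t => (PocSet.flow hB w μ ν t).toDual hB w, PocSet.toDual_flow_zero hB w,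
    fun t ht => PocSet.toDual_flow_of_le hB w ht, fun s hs t ht => ?_,
    fun r s t _ hrs hst _ => PocSet.ellOne_flow_add hB w hrs hst, fun v m hv => ?_⟩
  · rcases le_total s t with h | h
    · rw [PocSet.ellInf_flow hB w hs.1 h ht.2, abs_sub_comm, abs_of_nonneg (sub_nonneg.2 h)]
    · have := PocSet.pdist_comm .infty hB w (PocSet.flow hB w μ ν s) (PocSet.flow hB w μ ν t)
      rw [PocSet.pdist_infty, PocSet.pdist_infty, PocSet.ellInf_flow hB w ht.1 h hs.2] at this
      rw [this, abs_of_nonneg (sub_nonneg.2 h)]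
  · refine PocSet.pathsConvergeTo_flow hB p w μ ν (fun n => (hv n).2.2) ?_ ?_
    · simpa only [fun n => (hv n).1] using hU
    · simpa only [fun n => (hv n).2.1] using hV
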